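/- Let $0<k_1<k_2$ and let $R>0$ be a constant; put $\alpha=\arctan(R)/\pi\in(0,1/2)$. A function $u:\mathbb R\to\mathbb R$ is called a symmetric primitive potential with constant dressing $R$ on $[k_1,k_2]$ if there are real functions $f(q,x)$, $g(q,x)$ on $[k_1,k_2]\times\mathbb R$ such that, for every $x\in\mathbb R$, $f(\cdot,x)$ and $g(\cdot,x)$ belong to $L^2(k_1,k_2)$ and, for almost every $p\in[k_1,k_2]$, the principal values below exist and $$f(p,x)+\frac{R}{\pi}e^{-2px}\left[\int_{k_1}^{k_2}\frac{f(q,x)}{p+q}\,dq+\mathrm{p.v.}\!\int_{k_1}^{k_2}\frac{g(q,x)}{p-q}\,dq\right]=R\,e^{-2px},$$ $$g(p,x)+\frac{R}{\pi}e^{2px}\left[\mathrm{p.v.}\!\int_{k_1}^{k_2}\frac{f(q,x)}{p-q}\,dq+\int_{k_1}^{k_2}\frac{g(q,x)}{p+q}\,dq\right]=-R\,e^{2px},$$ and such that for every $x\in\mathbb R$ the following derivative exists and $$u(x)=\frac{2}{\pi}\frac{d}{dx}\int_{k_1}^{k_2}\bigl[f(q,x)+g(q,x)\bigr]\,dq .$$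 Then there is exactly one symmetric primitive potential $u$ with constant dressing $R$ on $[k_1,k_2]$; it is real-analytic in a neighbourhood of $x=0$, and its Taylor expansion there is $$u(x)=-4\alpha(k_2^2-k_1^2)+4\alpha(k_2^2-k_1^2)\bigl(4\alpha(k_2^2-k_1^2)-(k_2^2+k_1^2)\bigr)x^2+O(x^4)\qquad(x\to0).$$ -/

import Mathlib

open Filter Topology MeasureTheory

/-- `HasPVIntegral a b φ p I`: the principal value integral over `[a, b]` of a function `φ` with a
singularity at `p` exists and is equal to `I`, i.e. the integral of `φ` over
`{q ∈ [a, b] : |q - p| ≥ ε}` tends to `I` as `ε → 0+`. -/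
def HasPVIntegral (a b : ℝ) (φ : ℝ → ℝ) (p I : ℝ) : Prop :=
  Tendsto (fun ε : ℝ => ∫ q in Set.Icc a b \ Metric.ball p ε, φ q) (𝓝[>] 0) (𝓝 I)

/-- The pair of spectral densities `(f, g)`, square-integrable on `[k₁, k₂]`, solves at the point
`x` (and at time `t = 0`) the system of singular integral equations with dressing functions `R₁`
and `R₂`:
`f(p) + R₁(p)/π e^{-2px} [∫ f(q)/(p+q) dq + p.v.∫ g(q)/(p-q) dq] = R₁(p) e^{-2px}`,
`g(p) + R₂(p)/π e^{2px} [p.v.∫ f(q)/(p-q) dq + ∫ g(q)/(p+q) dq] = -R₂(p) e^{2px}`,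
for almost every `p ∈ [k₁, k₂]`; the existence of the principal values is part of the condition. -/
structure IsDressingSolution (k₁ k₂ : ℝ) (R₁ R₂ : ℝ → ℝ) (x : ℝ) (f g : ℝ → ℝ) : Prop where
  memLp_f : MemLp f 2 (volume.restrict (Set.Icc k₁ k₂))
  memLp_g : MemLp g 2 (volume.restrict (Set.Icc k₁ k₂))
  eq_f : ∀ᵐ p ∂(volume.restrict (Set.Icc k₁ k₂)),
    ∃ I : ℝ, HasPVIntegral k₁ k₂ (fun q => g q / (p - q)) p I ∧
      f p + R₁ p / Real.pi * Real.exp (-2 * p * x) * ((∫ q in k₁..k₂, f q / (p + q)) + I)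
        = R₁ p * Real.exp (-2 * p * x)
  eq_g : ∀ᵐ p ∂(volume.restrict (Set.Icc k₁ k₂)),
    ∃ I : ℝ, HasPVIntegral k₁ k₂ (fun q => f q / (p - q)) p I ∧
      g p + R₂ p / Real.pi * Real.exp (2 * p * x) * (I + ∫ q in k₁..k₂, g q / (p + q))
        = -(R₂ p * Real.exp (2 * p * x))

/-- `u` is a primitive potential with dressing functions `R₁`, `R₂` on `[k₁, k₂]`:
`u(x) = (2/π) d/dx ∫ [f(q, x) + g(q, x)] dq`, where for every real `x` the pair
`(f(·, x), g(·, x))` solves the dressing equations. -/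
def IsPrimitivePotential (k₁ k₂ : ℝ) (R₁ R₂ : ℝ → ℝ) (u : ℝ → ℝ) : Prop :=
  ∃ f g : ℝ → ℝ → ℝ,
    (∀ x, IsDressingSolution k₁ k₂ R₁ R₂ x (fun q => f q x) (fun q => g q x)) ∧
    ∀ x, HasDerivAt (fun y => 2 / Real.pi * ∫ q in k₁..k₂, (f q y + g q y)) (u x) x

/-- `u` is a symmetric primitive potential: the two dressing functions are equal. -/
def IsSymmetricPrimitivePotential (k₁ k₂ : ℝ) (R : ℝ → ℝ) (u : ℝ → ℝ) : Prop :=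
  IsPrimitivePotential k₁ k₂ R R u

/-! Multiply the two equations by `e^{2px}` and `e^{-2px}`. They become one equation `M(x) v = b`
with `M(x) = exp(xQ) + T` for `v = (f, g)` in the Hilbert space of pairs from `L²(k₁, k₂)`. Here `Q
= diag(P, -P)` with `P` multiplication by `2p`, `T = (R/π) [[S, H], [H, S]]` with the Carleman
operator `S` (kernel `1/(p+q)`) and the finite Hilbert transform `H`, and `b = (R, -R)`.

Solvability: `H` is skew, so it drops out of `⟨Tv, v⟩`, and `S` is nonnegative, because `1/(p+q)` is
the Laplace transform composed with its adjoint. Since `exp(xQ)` is positive definite, `M(x)` is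
coercive, hence invertible (`exists_coercive_exp_add`, `isUnit_of_coercive`), with inverse analytic
in `x`. So `Φ(x) = ∫ (f + g)` is uniquely determined and analytic, and `u = (2/π) Φ'`.

Taylor coefficients: with `σ = diag(1, -1)` each `M(x)` is symmetric for the form `⟨v, σw⟩`, and `R
Φ(x) = ⟨M(x)⁻¹ b, σb⟩` is the stationary value of a quadratic functional. A trial vector `v₀ + x v₁`
that is correct to first order therefore gives `Φ` up to `O(x⁴)` (`isBigO_inner_inverse_exp_add`).
The swap `(f, g) ↦ (-g, -f)` exchanges `x` and `-x`, so `Φ` is odd and the remainder is in fact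
`O(x⁵)`, which leaves `O(x⁴)` after differentiation.

Explicit data: `v₀ = (f₀, -f₀)` and `v₁ = (f₁, f₁)`. In the variable `s = p²` the kernel `1/(p+q) -
1/(p-q) = 2q/(q²-p²)` is the Cauchy kernel, and `f₀` is a multiple of `((s - k₁²)/(k₂² - s))^α`,
whose Cauchy integral is elementary (`jacobiCauchy_eq`); the equation holds because `tan(πα) = R`.
The correction `f₁` is `p` times a combination of the weights with exponents `α` and `-α`, and the
required moments are Beta integrals.

The operator `H` is obtained from conjugate Poisson integrals: they converge in `L²` by a convexity
argument, and almost everywhere, together with the truncated integrals, at Lebesgue points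
(`exists_hilbertTransform`). -/

/-! ### Poisson and conjugate Poisson kernels and their product integrals. -/

/-- The Poisson kernel of the half-plane, without the factor `1 / π`. -/
noncomputable def poissonKer (y t : ℝ) : ℝ := y / (t ^ 2 + y ^ 2)

/-- The conjugate Poisson kernel of the half-plane, without the factor `1 / π`. -/
noncomputable def conjPoissonKer (y t : ℝ) : ℝ := t / (t ^ 2 + y ^ 2)

theorem poissonKer_nonneg {y : ℝ} (hy : 0 < y) (t : ℝ) : 0 ≤ poissonKer y t := by
  unfold poissonKer; positivity

theorem poissonKer_neg (y t : ℝ) : poissonKer y (-t) = poissonKer y t := by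
  simp [poissonKer]

theorem conjPoissonKer_neg (y t : ℝ) : conjPoissonKer y (-t) = -conjPoissonKer y t := by
  simp [conjPoissonKer, neg_div]

theorem poissonKer_le {y : ℝ} (hy : 0 < y) (t : ℝ) : poissonKer y t ≤ 1 / y := by
  unfold poissonKer
  rw [div_le_div_iff₀ (by positivity) hy]
  nlinarith [sq_nonneg t]

theorem conjPoissonKer_sq_add {y : ℝ} (hy : 0 < y) (t : ℝ) :
    conjPoissonKer y t ^ 2 + poissonKer y t ^ 2 = poissonKer y t / y := by
  unfold poissonKer conjPoissonKer
  have : t ^ 2 + y ^ 2 ≠ 0 := by positivity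
  field_simp

theorem continuous_poissonKer {y : ℝ} (hy : 0 < y) : Continuous (poissonKer y) := by
  unfold poissonKer
  exact continuous_const.div (by fun_prop) fun t => by positivity

theorem continuous_conjPoissonKer {y : ℝ} (hy : 0 < y) : Continuous (conjPoissonKer y) := by
  unfold conjPoissonKer
  exact continuous_id.div (by fun_prop) fun t => by positivity

theorem poissonKer_eq {y : ℝ} (hy : 0 < y) :
    poissonKer y = fun t => y⁻¹ * (1 + (t / y) ^ 2)⁻¹ := by
  funext t
  unfold poissonKer
  field_simp
  ring

theorem integrable_poissonKer {y : ℝ} (hy : 0 < y) : Integrable (poissonKer y) := by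
  rw [poissonKer_eq hy]
  exact (integrable_inv_one_add_sq.comp_div hy.ne').const_mul _

theorem integral_poissonKer {y : ℝ} (hy : 0 < y) : ∫ t, poissonKer y t = Real.pi := by
  rw [poissonKer_eq hy, integral_const_mul,
    Measure.integral_comp_div (fun t : ℝ => (1 + t ^ 2)⁻¹) y, integral_univ_inv_one_add_sq,
    abs_of_pos hy, smul_eq_mul, ← mul_assoc, inv_mul_cancel₀ hy.ne', one_mul]

theorem memLp_poissonKer {y : ℝ} (hy : 0 < y) : MemLp (poissonKer y) 2 := by
  rw [memLp_two_iff_integrable_sq (continuous_poissonKer hy).aestronglyMeasurable]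
  refine ((integrable_poissonKer hy).div_const y).mono'
    ((continuous_poissonKer hy).pow 2).aestronglyMeasurable (Eventually.of_forall fun t => ?_)
  rw [Real.norm_eq_abs, abs_of_nonneg (sq_nonneg _), ← conjPoissonKer_sq_add hy]
  nlinarith [sq_nonneg (conjPoissonKer y t)]

theorem memLp_conjPoissonKer {y : ℝ} (hy : 0 < y) : MemLp (conjPoissonKer y) 2 := by
  rw [memLp_two_iff_integrable_sq (continuous_conjPoissonKer hy).aestronglyMeasurable]
  refine ((integrable_poissonKer hy).div_const y).mono'
    ((continuous_conjPoissonKer hy).pow 2).aestronglyMeasurable (Eventually.of_forall fun t => ?_)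
  rw [Real.norm_eq_abs, abs_of_nonneg (sq_nonneg _), ← conjPoissonKer_sq_add hy]
  nlinarith [sq_nonneg (poissonKer y t)]

theorem memLp_comp_sub {k : ℝ → ℝ} (hk : MemLp k 2) (d : ℝ) : MemLp (fun t => k (t - d)) 2 :=
  hk.comp_measurePreserving (measurePreserving_sub_right volume d)

theorem memLp_comp_sub_left {k : ℝ → ℝ} (hk : MemLp k 2) (d : ℝ) : MemLp (fun t => k (d - t)) 2 :=
  hk.comp_measurePreserving (Measure.measurePreserving_sub_left volume d)

theorem tendsto_conjPoissonKer_atTop {y : ℝ} (hy : 0 < y) :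
    Tendsto (conjPoissonKer y) atTop (𝓝 0) := by
  refine squeeze_zero_norm' ?_ tendsto_inv_atTop_zero
  filter_upwards [eventually_gt_atTop 0] with t ht
  unfold conjPoissonKer
  rw [Real.norm_eq_abs, abs_of_nonneg (by positivity), div_le_iff₀ (by positivity)]
  field_simp
  nlinarith [sq_nonneg y]

theorem tendsto_poissonKer_atTop {y : ℝ} (hy : 0 < y) :
    Tendsto (poissonKer y) atTop (𝓝 0) := by
  have h : Tendsto (fun t : ℝ => y * (t ^ 2)⁻¹) atTop (𝓝 (y * 0)) :=
    ((tendsto_pow_atTop (by norm_num)).inv_tendsto_atTop).const_mul y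
  rw [mul_zero] at h
  refine squeeze_zero_norm' ?_ h
  filter_upwards [eventually_gt_atTop 0] with t ht
  unfold poissonKer
  rw [Real.norm_eq_abs, abs_of_nonneg (by positivity), div_eq_mul_inv]
  gcongr
  nlinarith [sq_nonneg y]

theorem tendsto_conjPoissonKer_atBot {y : ℝ} (hy : 0 < y) :
    Tendsto (conjPoissonKer y) atBot (𝓝 0) := by
  have := ((tendsto_conjPoissonKer_atTop hy).comp tendsto_neg_atBot_atTop).neg
  simpa [Function.comp_def, conjPoissonKer_neg] using this

theorem tendsto_poissonKer_atBot {y : ℝ} (hy : 0 < y) :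
    Tendsto (poissonKer y) atBot (𝓝 0) := by
  have := (tendsto_poissonKer_atTop hy).comp tendsto_neg_atBot_atTop
  simpa [Function.comp_def, poissonKer_neg] using this

/-- Imaginary part of the partial fraction decomposition of `1 / ((t + ia)(t - d - ib))`, whose
poles lie on opposite sides of the real line; `conj_mul_conj_add` is the real part. -/
theorem conj_mul_poisson_sub {a b : ℝ} (ha : 0 < a) (hb : 0 < b) (d t : ℝ) :
    conjPoissonKer a t * poissonKer b (t - d) - conjPoissonKer b (t - d) * poissonKer a t =
      conjPoissonKer (a + b) d * (poissonKer a t + poissonKer b (t - d)) +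
      poissonKer (a + b) d * (conjPoissonKer a t - conjPoissonKer b (t - d)) := by
  unfold poissonKer conjPoissonKer
  have h1 : t ^ 2 + a ^ 2 ≠ 0 := by positivity
  have h2 : (t - d) ^ 2 + b ^ 2 ≠ 0 := by positivity
  have h3 : d ^ 2 + (a + b) ^ 2 ≠ 0 := by positivity
  field_simp
  ring

theorem conj_mul_conj_add {a b : ℝ} (ha : 0 < a) (hb : 0 < b) (d t : ℝ) :
    conjPoissonKer a t * conjPoissonKer b (t - d) + poissonKer a t * poissonKer b (t - d) =
      poissonKer (a + b) d * (poissonKer a t + poissonKer b (t - d)) -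
      conjPoissonKer (a + b) d * (conjPoissonKer a t - conjPoissonKer b (t - d)) := by
  unfold poissonKer conjPoissonKer
  have h1 : t ^ 2 + a ^ 2 ≠ 0 := by positivity
  have h2 : (t - d) ^ 2 + b ^ 2 ≠ 0 := by positivity
  have h3 : d ^ 2 + (a + b) ^ 2 ≠ 0 := by positivity
  field_simp
  ring

/-- Real part of the decomposition of `1 / ((t + ia)(t - d + ib))`. The poles now lie on the same
side and may coincide, which `h` excludes; `conj_mul_poisson_add` is the imaginary part up to sign.
-/
theorem conj_mul_conj_sub {a b : ℝ} (ha : 0 < a) (hb : 0 < b) (d t : ℝ)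
    (h : d ^ 2 + (a - b) ^ 2 ≠ 0) :
    conjPoissonKer a t * conjPoissonKer b (t - d) - poissonKer a t * poissonKer b (t - d) =
      poissonKer (a - b) d * (poissonKer a t - poissonKer b (t - d)) -
      conjPoissonKer (a - b) d * (conjPoissonKer a t - conjPoissonKer b (t - d)) := by
  unfold poissonKer conjPoissonKer
  have h1 : t ^ 2 + a ^ 2 ≠ 0 := by positivity
  have h2 : (t - d) ^ 2 + b ^ 2 ≠ 0 := by positivity
  field_simp
  ring

theorem conj_mul_poisson_add {a b : ℝ} (ha : 0 < a) (hb : 0 < b) (d t : ℝ)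
    (h : d ^ 2 + (a - b) ^ 2 ≠ 0) :
    -(conjPoissonKer a t * poissonKer b (t - d) + conjPoissonKer b (t - d) * poissonKer a t) =
      conjPoissonKer (a - b) d * (poissonKer a t - poissonKer b (t - d)) +
      poissonKer (a - b) d * (conjPoissonKer a t - conjPoissonKer b (t - d)) := by
  unfold poissonKer conjPoissonKer
  have h1 : t ^ 2 + a ^ 2 ≠ 0 := by positivity
  have h2 : (t - d) ^ 2 + b ^ 2 ≠ 0 := by positivity
  field_simp
  ring

/-- Each conjugate kernel decays only like `1/t`; the difference is integrable because
`conj_mul_poisson_sub` can be solved for it, the other terms being Poisson kernels or products of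
two `L²` functions. -/
theorem integrable_conj_sub_conj {a b : ℝ} (ha : 0 < a) (hb : 0 < b) (d : ℝ) :
    Integrable fun t => conjPoissonKer a t - conjPoissonKer b (t - d) := by
  have hp : poissonKer (a + b) d ≠ 0 := by unfold poissonKer; positivity
  have h1 : Integrable fun t => conjPoissonKer a t * poissonKer b (t - d) :=
    (memLp_conjPoissonKer ha).integrable_mul (memLp_comp_sub (memLp_poissonKer hb) d)
  have h2 : Integrable fun t => conjPoissonKer b (t - d) * poissonKer a t :=
    (memLp_comp_sub (memLp_conjPoissonKer hb) d).integrable_mul (memLp_poissonKer ha)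
  have h3 : Integrable fun t => poissonKer a t + poissonKer b (t - d) :=
    (integrable_poissonKer ha).add ((integrable_poissonKer hb).comp_sub_right d)
  refine (((h1.sub h2).sub (h3.const_mul (conjPoissonKer (a + b) d))).const_mul
    (poissonKer (a + b) d)⁻¹).congr (Eventually.of_forall fun t => ?_)
  simp only [Pi.sub_apply]
  rw [conj_mul_poisson_sub ha hb d t]
  field_simp
  ring

theorem integral_conj_sub_conj {a b : ℝ} (ha : 0 < a) (hb : 0 < b) (d : ℝ) :
    ∫ t, (conjPoissonKer a t - conjPoissonKer b (t - d)) = 0 := by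
  have hd : ∀ t, HasDerivAt (fun t : ℝ => (Real.log (t ^ 2 + a ^ 2)
      - Real.log ((t - d) ^ 2 + b ^ 2)) / 2) (conjPoissonKer a t - conjPoissonKer b (t - d)) t := by
    intro t
    have h1 : HasDerivAt (fun t : ℝ => t ^ 2 + a ^ 2) (2 * t) t := by
      simpa using (hasDerivAt_pow 2 t).add_const (a ^ 2)
    have h2 : HasDerivAt (fun t : ℝ => (t - d) ^ 2 + b ^ 2) (2 * (t - d)) t := by
      simpa using (((hasDerivAt_id t).sub_const d).pow 2).add_const (b ^ 2)
    refine (((h1.log (by positivity)).sub (h2.log (by positivity))).div_const 2).congr_deriv ?_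
    rw [conjPoissonKer, conjPoissonKer]
    ring
  -- The quotient of the two quadratics is `1` plus kernels that vanish at infinity, so the
  -- antiderivative tends to `0` at both ends.
  have key : ∀ t, (Real.log (t ^ 2 + a ^ 2) - Real.log ((t - d) ^ 2 + b ^ 2)) / 2 =
      Real.log (1 + 2 * d * conjPoissonKer b (t - d)
        + (d ^ 2 + a ^ 2 - b ^ 2) / b * poissonKer b (t - d)) / 2 := by
    intro t
    rw [← Real.log_div (by positivity) (by positivity)]
    congr 2
    unfold poissonKer conjPoissonKer
    have h2 : (t - d) ^ 2 + b ^ 2 ≠ 0 := by positivity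
    field_simp
    ring
  have lim : ∀ l : Filter ℝ, Tendsto (conjPoissonKer b) l (𝓝 0) → Tendsto (poissonKer b) l (𝓝 0) →
      Tendsto (fun t => t - d) l l →
      Tendsto (fun t : ℝ => (Real.log (t ^ 2 + a ^ 2) - Real.log ((t - d) ^ 2 + b ^ 2)) / 2) l
        (𝓝 0) := by
    intro l hQ hP hl
    simp_rw [key]
    have h := (((hQ.comp hl).const_mul (2 * d)).const_add 1).add
      ((hP.comp hl).const_mul ((d ^ 2 + a ^ 2 - b ^ 2) / b))
    have h' := (h.log (by simp)).div_const 2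
    simpa using h'
  have := integral_of_hasDerivAt_of_tendsto hd (integrable_conj_sub_conj ha hb d)
    (lim atBot (tendsto_conjPoissonKer_atBot hb) (tendsto_poissonKer_atBot hb)
      (tendsto_atBot_add_const_right _ (-d) tendsto_id))
    (lim atTop (tendsto_conjPoissonKer_atTop hb) (tendsto_poissonKer_atTop hb)
      (tendsto_atTop_add_const_right _ (-d) tendsto_id))
  simpa using this

theorem integral_poisson_combination {a b : ℝ} (ha : 0 < a) (hb : 0 < b) (d r s u : ℝ) :
    ∫ t, (r * poissonKer a t + s * poissonKer b (t - d) +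
      u * (conjPoissonKer a t - conjPoissonKer b (t - d))) = Real.pi * (r + s) := by
  have hA := integrable_conj_sub_conj ha hb d
  have hP := integrable_poissonKer ha
  have hP' := (integrable_poissonKer hb).comp_sub_right d
  have h1 : Integrable fun t => r * poissonKer a t + s * poissonKer b (t - d) :=
    (hP.const_mul r).add (hP'.const_mul s)
  rw [integral_add h1 (hA.const_mul _), integral_add (hP.const_mul r) (hP'.const_mul s),
    integral_const_mul, integral_const_mul, integral_const_mul, integral_conj_sub_conj ha hb d,
    integral_sub_right_eq_self, integral_poissonKer ha, integral_poissonKer hb]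
  ring

/-- Averaging the two decompositions isolates the product. The exclusion `h` is harmless below: for
`d = q - r` it removes at most a null set. -/
theorem integral_conj_mul_conj {a b : ℝ} (ha : 0 < a) (hb : 0 < b) (d : ℝ)
    (h : d ^ 2 + (a - b) ^ 2 ≠ 0) :
    ∫ t, conjPoissonKer a t * conjPoissonKer b (t - d) = Real.pi * poissonKer (a + b) d := by
  have e : ∀ t, conjPoissonKer a t * conjPoissonKer b (t - d) =
      ((poissonKer (a + b) d + poissonKer (a - b) d) / 2) * poissonKer a t +
      ((poissonKer (a + b) d - poissonKer (a - b) d) / 2) * poissonKer b (t - d) +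
      (-(conjPoissonKer (a + b) d + conjPoissonKer (a - b) d) / 2) *
        (conjPoissonKer a t - conjPoissonKer b (t - d)) := by
    intro t
    linarith [conj_mul_conj_add ha hb d t, conj_mul_conj_sub ha hb d t h]
  simp_rw [e]
  rw [integral_poisson_combination ha hb d]
  ring

theorem integral_conj_mul_poisson {a b : ℝ} (ha : 0 < a) (hb : 0 < b) (d : ℝ)
    (h : d ^ 2 + (a - b) ^ 2 ≠ 0) :
    ∫ t, conjPoissonKer a t * poissonKer b (t - d) = Real.pi * conjPoissonKer (a + b) d := by
  have e : ∀ t, conjPoissonKer a t * poissonKer b (t - d) =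
      ((conjPoissonKer (a + b) d - conjPoissonKer (a - b) d) / 2) * poissonKer a t +
      ((conjPoissonKer (a + b) d + conjPoissonKer (a - b) d) / 2) * poissonKer b (t - d) +
      ((poissonKer (a + b) d - poissonKer (a - b) d) / 2) *
        (conjPoissonKer a t - conjPoissonKer b (t - d)) := by
    intro t
    linarith [conj_mul_poisson_sub ha hb d t, conj_mul_poisson_add ha hb d t h]
  simp_rw [e]
  rw [integral_poisson_combination ha hb d]
  ring

/-! ### Convolutions in `L²` and the energy identity. -/

/-- The convolution `∫ g(q) k(p - q) dq`. -/
noncomputable def kerConv (k g : ℝ → ℝ) (p : ℝ) : ℝ := ∫ q, g q * k (p - q)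

theorem abs_conjPoissonKer_le {y : ℝ} (hy : 0 < y) (t : ℝ) : |conjPoissonKer y t| ≤ 1 / y := by
  refine abs_le_of_sq_le_sq ?_ (by positivity)
  have h1 := conjPoissonKer_sq_add hy t
  have h2 : poissonKer y t / y ≤ (1 / y) ^ 2 := by
    rw [sq, div_eq_mul_one_div]
    exact mul_le_mul_of_nonneg_right (poissonKer_le hy t) (by positivity)
  nlinarith [sq_nonneg (poissonKer y t)]

theorem aestronglyMeasurable_kerConv_integrand {k g : ℝ → ℝ} (hg : AEStronglyMeasurable g)
    (hk : Continuous k) :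
    AEStronglyMeasurable (fun z : ℝ × ℝ => g z.2 * k (z.1 - z.2)) (volume.prod volume) :=
  hg.comp_snd.mul (hk.comp (continuous_fst.sub continuous_snd)).aestronglyMeasurable

/-- Fubini; absolute integrability follows from `|k h| ≤ k² + h²` with `k`, `h` square-integrable
and `g` integrable. -/
theorem kerConv_swap {g h k : ℝ → ℝ} (hg : Integrable g) (hh : MemLp h 2) (hk : MemLp k 2)
    (hc : Continuous k) :
    ∫ p, kerConv k g p * h p = ∫ q, g q * ∫ p, k (p - q) * h p := by
  have hint : Integrable (Function.uncurry fun p q => g q * k (p - q) * h p)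
      (volume.prod volume) := by
    have hm : AEStronglyMeasurable (Function.uncurry fun p q => g q * k (p - q) * h p)
        (volume.prod volume) :=
      (aestronglyMeasurable_kerConv_integrand hg.1 hc).mul hh.1.comp_fst
    rw [integrable_prod_iff' hm]
    have hq : ∀ q, Integrable fun p => k (p - q) * h p := fun q =>
      (memLp_comp_sub hk q).integrable_mul hh
    constructor
    · refine Eventually.of_forall fun q => ?_
      simpa [Function.uncurry, mul_assoc] using (hq q).const_mul (g q)
    · refine (hg.norm.mul_const ((∫ p, k p ^ 2) + ∫ p, h p ^ 2)).mono'
        hm.prod_swap.norm.integral_prod_right' (Eventually.of_forall fun q => ?_)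
      have hk2 := (memLp_two_iff_integrable_sq (memLp_comp_sub hk q).1).1 (memLp_comp_sub hk q)
      have hh2 := (memLp_two_iff_integrable_sq hh.1).1 hh
      rw [Real.norm_eq_abs, abs_of_nonneg (integral_nonneg fun p => norm_nonneg _),
        ← integral_sub_right_eq_self (fun t => k t ^ 2) q, ← integral_add hk2 hh2,
        ← integral_const_mul]
      refine integral_mono ?_ ((hk2.add hh2).const_mul _) fun p => ?_
      · simpa [Function.uncurry, mul_assoc] using ((hq q).const_mul (g q)).norm
      · simp only [Function.uncurry, norm_mul, Real.norm_eq_abs]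
        rw [mul_assoc, ← sq_abs (k (p - q)), ← sq_abs (h p)]
        refine mul_le_mul_of_nonneg_left ?_ (abs_nonneg _)
        nlinarith [sq_nonneg (|k (p - q)| - |h p|), sq_nonneg |k (p - q)|, sq_nonneg |h p|]
  simp_rw [kerConv, ← integral_mul_const]
  rw [integral_integral_swap hint]
  simp_rw [← integral_const_mul, mul_assoc]

/-- Cauchy–Schwarz for the measure `|g| dq`, from the discriminant of the nonnegative quadratic `∫
|g| (x - |k|)²`. -/
theorem sq_integral_mul_le {g k : ℝ → ℝ} (hg : Integrable g) (h1 : Integrable fun q => g q * k q)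
    (h2 : Integrable fun q => |g q| * k q ^ 2) :
    (∫ q, g q * k q) ^ 2 ≤ (∫ q, |g q|) * ∫ q, |g q| * k q ^ 2 := by
  have h1' : Integrable fun q => |g q| * |k q| := by simpa [abs_mul] using h1.abs
  have key : ∀ x : ℝ, 0 ≤ (∫ q, |g q|) * (x * x) + (-2 * ∫ q, |g q| * |k q|) * x +
      ∫ q, |g q| * k q ^ 2 := by
    intro x
    have e : (∫ q, |g q|) * (x * x) + (-2 * ∫ q, |g q| * |k q|) * x + ∫ q, |g q| * k q ^ 2 =
        ∫ q, (|g q| * (x * x) + (|g q| * |k q|) * (-2 * x) + |g q| * k q ^ 2) := by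
      have i1 : Integrable fun q => |g q| * (x * x) := hg.abs.mul_const _
      have i2 : Integrable fun q => (|g q| * |k q|) * (-2 * x) := h1'.mul_const _
      have i3 : Integrable fun q => |g q| * (x * x) + (|g q| * |k q|) * (-2 * x) := i1.add i2
      rw [integral_add i3 h2, integral_add i1 i2, integral_mul_const, integral_mul_const]
      ring
    rw [e]
    refine integral_nonneg fun q => ?_
    have : |g q| * (x * x) + (|g q| * |k q|) * (-2 * x) + |g q| * k q ^ 2 =
      |g q| * (x - |k q|) ^ 2 := by rw [← sq_abs (k q)]; ring
    simp only [this]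
    positivity
  have hd := discrim_le_zero key
  rw [discrim] at hd
  have h3 : |∫ q, g q * k q| ≤ ∫ q, |g q| * |k q| := by
    simpa [abs_mul] using abs_integral_le_integral_abs (f := fun q => g q * k q) (μ := volume)
  have h4 := sq_abs (∫ q, g q * k q)
  have h5 := abs_nonneg (∫ q, g q * k q)
  nlinarith

theorem integrable_kerConv_integrand {g k : ℝ → ℝ} {C : ℝ} (hg : Integrable g) (hc : Continuous k)
    (hb : ∀ t, |k t| ≤ C) (p : ℝ) : Integrable fun q => g q * k (p - q) :=
  hg.mul_bdd (hc.comp (continuous_const.sub continuous_id)).aestronglyMeasurable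
    (Eventually.of_forall fun q => hb (p - q))

/-- Young's inequality `L¹ * L² ⊆ L²`: pointwise, the square of the convolution is at most `‖g‖₁`
times the convolution of `|g|` with `k²`, and the latter is integrable. -/
theorem memLp_kerConv {g k : ℝ → ℝ} {C : ℝ} (hg : Integrable g) (hk : MemLp k 2)
    (hc : Continuous k) (hb : ∀ t, |k t| ≤ C) : MemLp (kerConv k g) 2 := by
  have hm : AEStronglyMeasurable (kerConv k g) :=
    (aestronglyMeasurable_kerConv_integrand hg.1 hc).integral_prod_right'
  rw [memLp_two_iff_integrable_sq hm]
  have hk2 : Integrable fun t => k t ^ 2 := (memLp_two_iff_integrable_sq hk.1).1 hk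
  have hi := (hg.abs.convolution_integrand (ContinuousLinearMap.mul ℝ ℝ) hk2).integral_prod_left
  simp only [ContinuousLinearMap.mul_apply'] at hi
  refine (hi.const_mul (∫ q, |g q|)).mono' (hm.pow 2) (Eventually.of_forall fun p => ?_)
  rw [Real.norm_eq_abs, abs_of_nonneg (sq_nonneg _)]
  refine sq_integral_mul_le hg (integrable_kerConv_integrand hg hc hb p) ?_
  refine integrable_kerConv_integrand (k := fun t => k t ^ 2) (C := C ^ 2) hg.abs (hc.pow 2)
    (fun t => ?_) p
  rw [abs_of_nonneg (sq_nonneg _), ← sq_abs]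
  exact pow_le_pow_left₀ (abs_nonneg _) (hb t) 2

theorem kerConv_conj_shift {a b : ℝ} (ha : 0 < a) (hb : 0 < b) {q r : ℝ} (h : q ≠ r) :
    ∫ p, conjPoissonKer b (p - r) * conjPoissonKer a (p - q) =
      Real.pi * poissonKer (a + b) (q - r) := by
  have hd : (q - r) ^ 2 + (b - a) ^ 2 ≠ 0 := by
    have : 0 < (q - r) ^ 2 := by have := sub_ne_zero.2 h; positivity
    positivity
  rw [add_comm a b, ← integral_conj_mul_conj hb ha (q - r) hd, ← integral_sub_right_eq_self
    (fun t => conjPoissonKer b t * conjPoissonKer a (t - (q - r))) r]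
  simp only [sub_sub, add_sub_cancel]

theorem kerConv_conj_poisson_shift {a b : ℝ} (ha : 0 < a) (hb : 0 < b) {p q : ℝ} (h : q ≠ p) :
    ∫ r, conjPoissonKer b (r - q) * poissonKer a (p - r) =
      Real.pi * conjPoissonKer (a + b) (p - q) := by
  have hd : (p - q) ^ 2 + (b - a) ^ 2 ≠ 0 := by
    have : 0 < (p - q) ^ 2 := by have := sub_ne_zero.2 h.symm; positivity
    positivity
  rw [add_comm a b, ← integral_conj_mul_poisson hb ha (p - q) hd,
    ← integral_sub_right_eq_self
      (fun t => conjPoissonKer b t * poissonKer a (t - (p - q))) q]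
  refine integral_congr_ae (Eventually.of_forall fun r => ?_)
  simp only
  rw [← poissonKer_neg, neg_sub, sub_sub_sub_cancel_right]

theorem memLp_kerConv_conj {g : ℝ → ℝ} (hg : Integrable g) {y : ℝ} (hy : 0 < y) :
    MemLp (kerConv (conjPoissonKer y) g) 2 :=
  memLp_kerConv hg (memLp_conjPoissonKer hy) (continuous_conjPoissonKer hy)
    (abs_conjPoissonKer_le hy)

theorem ae_ne (r : ℝ) : ∀ᵐ q : ℝ, q ≠ r := by
  simp [ae_iff]

/-- Two uses of Fubini reduce this to the integral of two shifted conjugate kernels, a Poisson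
kernel of height `a + b`. The right side depends on `a + b` only, which drives the convergence
argument as the heights tend to `0`. -/
theorem integral_kerConv_conj_mul {g : ℝ → ℝ} (hg : Integrable g) {a b : ℝ} (ha : 0 < a)
    (hb : 0 < b) :
    ∫ p, kerConv (conjPoissonKer a) g p * kerConv (conjPoissonKer b) g p =
      Real.pi * ∫ q, g q * kerConv (poissonKer (a + b)) g q := by
  rw [kerConv_swap hg (memLp_kerConv_conj hg hb) (memLp_conjPoissonKer ha)
    (continuous_conjPoissonKer ha), ← integral_const_mul]
  refine integral_congr_ae (Eventually.of_forall fun q => ?_)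
  simp only
  have h1 : ∫ p, conjPoissonKer a (p - q) * kerConv (conjPoissonKer b) g p =
      ∫ p, kerConv (conjPoissonKer b) g p * conjPoissonKer a (p - q) := by simp_rw [mul_comm]
  rw [h1, kerConv_swap hg (memLp_comp_sub (memLp_conjPoissonKer ha) q) (memLp_conjPoissonKer hb)
    (continuous_conjPoissonKer hb)]
  have h2 : ∫ r, g r * ∫ p, conjPoissonKer b (p - r) * conjPoissonKer a (p - q) =
      ∫ r, Real.pi * (g r * poissonKer (a + b) (q - r)) := by
    refine integral_congr_ae ?_
    filter_upwards [ae_ne q] with r hr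
    rw [kerConv_conj_shift ha hb hr.symm]
    ring
  rw [h2, integral_const_mul, kerConv]
  ring

theorem kerConv_poisson_conj {g : ℝ → ℝ} (hg : Integrable g) {a b : ℝ} (ha : 0 < a)
    (hb : 0 < b) (p : ℝ) :
    kerConv (poissonKer a) (kerConv (conjPoissonKer b) g) p =
      Real.pi * kerConv (conjPoissonKer (a + b)) g p := by
  have h := kerConv_swap hg (memLp_comp_sub_left (memLp_poissonKer ha) p)
    (memLp_conjPoissonKer hb) (continuous_conjPoissonKer hb)
  rw [kerConv, h, kerConv, ← integral_const_mul]
  refine integral_congr_ae ?_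
  filter_upwards [ae_ne p] with q hq
  rw [kerConv_conj_poisson_shift ha hb hq]
  ring

/-- Schur's test: `|g(p) g(q)| ≤ (g(p)² + g(q)²) / 2`, and the kernel has total mass `π` in each
variable. -/
theorem integral_mul_kerConv_poisson_le {g : ℝ → ℝ} (hg : Integrable g) (hg2 : MemLp g 2) {y : ℝ}
    (hy : 0 < y) :
    ∫ q, g q * kerConv (poissonKer y) g q ≤ Real.pi * ∫ q, g q ^ 2 := by
  have hP := integrable_poissonKer hy
  have hsq : Integrable fun q => g q ^ 2 := (memLp_two_iff_integrable_sq hg2.1).1 hg2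
  have i1 : Integrable (fun z : ℝ × ℝ => g z.2 ^ 2 * poissonKer y (z.1 - z.2))
      (volume.prod volume) := by
    simpa using hsq.convolution_integrand (ContinuousLinearMap.mul ℝ ℝ) hP
  have i2 : Integrable (fun z : ℝ × ℝ => g z.1 ^ 2 * poissonKer y (z.1 - z.2))
      (volume.prod volume) := by
    refine i1.swap.congr (Eventually.of_forall fun z => ?_)
    simp only [Function.comp_apply, Prod.swap]
    rw [← poissonKer_neg, neg_sub]
  have hm : AEStronglyMeasurable (fun z : ℝ × ℝ => g z.1 * (g z.2 * poissonKer y (z.1 - z.2)))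
      (volume.prod volume) :=
    hg.1.comp_fst.mul (aestronglyMeasurable_kerConv_integrand hg.1 (continuous_poissonKer hy))
  have hle : ∀ z : ℝ × ℝ, |g z.1 * (g z.2 * poissonKer y (z.1 - z.2))| ≤
      1 / 2 * (g z.2 ^ 2 * poissonKer y (z.1 - z.2) + g z.1 ^ 2 * poissonKer y (z.1 - z.2)) := by
    intro z
    have h0 := poissonKer_nonneg hy (z.1 - z.2)
    rw [← mul_assoc, abs_mul, abs_mul, abs_of_nonneg h0, ← add_mul, ← mul_assoc]
    refine mul_le_mul_of_nonneg_right ?_ h0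
    rw [← sq_abs (g z.2), ← sq_abs (g z.1)]
    nlinarith [sq_nonneg (|g z.1| - |g z.2|)]
  have i3 : Integrable (fun z : ℝ × ℝ => g z.1 * (g z.2 * poissonKer y (z.1 - z.2)))
      (volume.prod volume) :=
    ((i1.add i2).const_mul (1 / 2)).mono' hm (Eventually.of_forall hle)
  have e1 : ∫ z, g z.2 ^ 2 * poissonKer y (z.1 - z.2) ∂(volume.prod volume) =
      Real.pi * ∫ q, g q ^ 2 := by
    rw [integral_prod_symm _ i1, mul_comm, ← integral_mul_const]
    simp_rw [integral_const_mul, integral_sub_right_eq_self, integral_poissonKer hy]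
  have e2 : ∫ z, g z.1 ^ 2 * poissonKer y (z.1 - z.2) ∂(volume.prod volume) =
      Real.pi * ∫ q, g q ^ 2 := by
    rw [integral_prod _ i2, mul_comm, ← integral_mul_const]
    simp_rw [integral_const_mul, integral_sub_left_eq_self, integral_poissonKer hy]
  calc ∫ q, g q * kerConv (poissonKer y) g q
      = ∫ z, g z.1 * (g z.2 * poissonKer y (z.1 - z.2)) ∂(volume.prod volume) := by
        rw [integral_prod _ i3]
        simp_rw [kerConv, integral_const_mul]
    _ ≤ ∫ z, 1 / 2 * (g z.2 ^ 2 * poissonKer y (z.1 - z.2) +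
          g z.1 ^ 2 * poissonKer y (z.1 - z.2)) ∂(volume.prod volume) :=
        integral_mono i3 ((i1.add i2).const_mul _) fun z => (le_abs_self _).trans (hle z)
    _ = Real.pi * ∫ q, g q ^ 2 := by
        rw [integral_const_mul, integral_add i1 i2, e1, e2]
        ring

/-! ### Mean-square limit of the conjugate Poisson integrals. -/

/-- A midpoint-convex function that increases somewhere grows at least linearly along a doubling
sequence, which contradicts the upper bound. No continuity is needed. -/
theorem antitoneOn_of_midpoint_of_bddAbove {φ : ℝ → ℝ} {C : ℝ}
    (hmid : ∀ a b, 0 < a → 0 < b → 2 * φ (a + b) ≤ φ (2 * a) + φ (2 * b))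
    (hC : ∀ y, 0 < y → φ y ≤ C) : AntitoneOn φ (Set.Ioi 0) := by
  intro x hx z hz hxz
  rw [Set.mem_Ioi] at hx hz
  by_contra! hlt
  have h : ∀ n : ℕ, φ x + 2 ^ n * (φ z - φ x) ≤ φ (x + 2 ^ n * (z - x)) := by
    intro n
    induction n with
    | zero => simp
    | succ n ih =>
      have hpos : 0 ≤ 2 ^ n * (z - x) := mul_nonneg (by positivity) (sub_nonneg.2 hxz)
      -- These arguments make `x + 2^n (z - x)` the midpoint of `x` and `x + 2^(n+1) (z - x)`, so
      -- the increment over `φ x` at least doubles.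
      have := hmid (x / 2) (x / 2 + 2 ^ n * (z - x)) (by positivity) (by positivity)
      have e1 : x / 2 + (x / 2 + 2 ^ n * (z - x)) = x + 2 ^ n * (z - x) := by ring
      have e2 : 2 * (x / 2 + 2 ^ n * (z - x)) = x + 2 ^ (n + 1) * (z - x) := by ring
      have e3 : 2 * (x / 2) = x := by ring
      rw [e1, e2, e3] at this
      rw [pow_succ]
      rw [pow_succ] at this
      linarith
  have ht : Tendsto (fun n : ℕ => φ x + 2 ^ n * (φ z - φ x)) atTop atTop :=
    tendsto_atTop_add_const_left _ _
      ((tendsto_pow_atTop_atTop_of_one_lt one_lt_two).atTop_mul_const (sub_pos.2 hlt))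
  obtain ⟨n, hn⟩ := (ht.eventually_gt_atTop C).exists
  have hpos : 0 ≤ 2 ^ n * (z - x) := mul_nonneg (by positivity) (sub_nonneg.2 hxz)
  exact absurd (hC _ (by linarith)) (not_le.2 (hn.trans_le (h n)))

theorem integral_sq_kerConv_conj_sub {g : ℝ → ℝ} (hg : Integrable g) {a b : ℝ} (ha : 0 < a)
    (hb : 0 < b) :
    ∫ p, (kerConv (conjPoissonKer a) g p - kerConv (conjPoissonKer b) g p) ^ 2 =
      Real.pi * ((∫ q, g q * kerConv (poissonKer (2 * a)) g q) +
        (∫ q, g q * kerConv (poissonKer (2 * b)) g q) -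
        2 * ∫ q, g q * kerConv (poissonKer (a + b)) g q) := by
  have hA := memLp_kerConv_conj hg ha
  have hB := memLp_kerConv_conj hg hb
  have i1 := hA.integrable_mul hA
  have i2 := hB.integrable_mul hB
  have i3 := hA.integrable_mul hB
  have e : ∀ p, (kerConv (conjPoissonKer a) g p - kerConv (conjPoissonKer b) g p) ^ 2 =
      (kerConv (conjPoissonKer a) g * kerConv (conjPoissonKer a) g) p +
      (kerConv (conjPoissonKer b) g * kerConv (conjPoissonKer b) g) p -
      2 * (kerConv (conjPoissonKer a) g * kerConv (conjPoissonKer b) g) p := by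
    intro p
    simp only [Pi.mul_apply]
    ring
  simp_rw [e]
  have i4 : Integrable fun p => (kerConv (conjPoissonKer a) g * kerConv (conjPoissonKer a) g) p +
      (kerConv (conjPoissonKer b) g * kerConv (conjPoissonKer b) g) p := i1.add i2
  rw [integral_sub i4 (i3.const_mul 2), integral_add i1 i2, integral_const_mul]
  simp only [Pi.mul_apply]
  rw [integral_kerConv_conj_mul hg ha ha, integral_kerConv_conj_mul hg hb hb,
    integral_kerConv_conj_mul hg ha hb, two_mul a, two_mul b]
  ring

theorem eLpNorm_two_eq_ofReal_sqrt {α : Type*} [MeasurableSpace α] {μ : Measure α} {f : α → ℝ}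
    (hf : MemLp f 2 μ) : eLpNorm f 2 μ = ENNReal.ofReal (√(∫ x, f x ^ 2 ∂μ)) := by
  rw [hf.eLpNorm_eq_integral_rpow_norm two_ne_zero ENNReal.ofNat_ne_top]
  simp [Real.sqrt_eq_rpow]

/-- The squared distance in `integral_sq_kerConv_conj_sub` is nonnegative, which is midpoint
convexity of the energy in the height. Being bounded as well, the energy is antitone and has a limit
at `0`. -/
theorem exists_tendsto_energy {g : ℝ → ℝ} (hg : Integrable g) (hg2 : MemLp g 2) :
    ∃ L, Tendsto (fun y => ∫ q, g q * kerConv (poissonKer y) g q) (𝓝[>] 0) (𝓝 L) := by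
  set φ : ℝ → ℝ := fun y => ∫ q, g q * kerConv (poissonKer y) g q with hφ
  have hle : ∀ y, 0 < y → φ y ≤ Real.pi * ∫ q, g q ^ 2 := fun y hy =>
    integral_mul_kerConv_poisson_le hg hg2 hy
  have hanti : AntitoneOn φ (Set.Ioi 0) := by
    refine antitoneOn_of_midpoint_of_bddAbove (fun a b ha hb => ?_) hle
    have h0 := integral_sq_kerConv_conj_sub hg ha hb
    have h1 : 0 ≤ ∫ p, (kerConv (conjPoissonKer a) g p - kerConv (conjPoissonKer b) g p) ^ 2 :=
      integral_nonneg fun p => sq_nonneg _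
    rw [h0] at h1
    have := nonneg_of_mul_nonneg_right h1 Real.pi_pos
    simp only [hφ]
    linarith
  exact ⟨_, hanti.tendsto_nhdsGT ⟨_, by rintro _ ⟨y, hy, rfl⟩; exact hle y hy⟩⟩

/-- The squared distance between heights `a` and `b` is `π` times the energies at `2a` and `2b`
minus twice that at `a + b`. All three tend to the same `L`, so the family is Cauchy. -/
theorem exists_memLp_tendsto_kerConv_conj {g : ℝ → ℝ} (hg : Integrable g) (hg2 : MemLp g 2) :
    ∃ G : ℝ → ℝ, MemLp G 2 ∧
      Tendsto (fun y => eLpNorm (kerConv (conjPoissonKer y) g - G) 2 volume) (𝓝[>] 0) (𝓝 0) := by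
  classical
  obtain ⟨L, hL⟩ := exists_tendsto_energy hg hg2
  -- The value `0` at nonpositive heights only makes `c` total; the filter sees positive `y` alone.
  let c : ℝ → Lp ℝ 2 (volume : Measure ℝ) := fun y =>
    if hy : 0 < y then (memLp_kerConv_conj hg hy).toLp _ else 0
  have hc : ∀ {y} (hy : 0 < y), c y = (memLp_kerConv_conj hg hy).toLp _ := fun hy => dif_pos hy
  have hpos : ∀ᶠ y : ℝ in 𝓝[>] 0, 0 < y := self_mem_nhdsWithin
  have hdist : ∀ a b, 0 < a → 0 < b → dist (c a) (c b) =
      √(Real.pi * ((∫ q, g q * kerConv (poissonKer (2 * a)) g q) +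
        (∫ q, g q * kerConv (poissonKer (2 * b)) g q) -
        2 * ∫ q, g q * kerConv (poissonKer (a + b)) g q)) := by
    intro a b ha hb
    rw [hc ha, hc hb, dist_eq_norm_sub, ← MemLp.toLp_sub, Lp.norm_toLp, eLpNorm_two_eq_ofReal_sqrt
      ((memLp_kerConv_conj hg ha).sub (memLp_kerConv_conj hg hb)),
      ENNReal.toReal_ofReal (Real.sqrt_nonneg _), ← integral_sq_kerConv_conj_sub hg ha hb]
    rfl
  have h0 : Tendsto (fun y : ℝ => 2 * y) (𝓝[>] 0) (𝓝[>] 0) := by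
    refine tendsto_nhdsWithin_iff.2 ⟨?_, hpos.mono fun y hy => by simpa using hy⟩
    exact ((continuous_const.mul continuous_id).tendsto' (0 : ℝ) 0 (by simp)).mono_left
      nhdsWithin_le_nhds
  have hadd : Tendsto (fun z : ℝ × ℝ => z.1 + z.2) (𝓝[>] 0 ×ˢ 𝓝[>] 0) (𝓝[>] 0) := by
    refine tendsto_nhdsWithin_iff.2 ⟨?_, (hpos.prod_mk hpos).mono fun z hz => add_pos hz.1 hz.2⟩
    refine ((continuous_fst.add continuous_snd).tendsto' ((0 : ℝ), (0 : ℝ)) 0 (by simp)).mono_left ?_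
    rw [nhds_prod_eq]
    exact prod_mono nhdsWithin_le_nhds nhdsWithin_le_nhds
  have hcauchy : Cauchy (map c (𝓝[>] 0)) := by
    rw [cauchy_map_iff]
    refine ⟨inferInstance, ?_⟩
    rw [tendsto_uniformity_iff_dist_tendsto_zero]
    have hlim := (((hL.comp (h0.comp tendsto_fst)).add (hL.comp (h0.comp tendsto_snd))).sub
      ((hL.comp hadd).const_mul 2)).const_mul Real.pi |>.sqrt
    have e : √(Real.pi * (L + L - 2 * L)) = 0 := by ring_nf; simp
    rw [e] at hlim
    refine hlim.congr' ?_
    filter_upwards [hpos.prod_mk hpos] with z hz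
    exact (hdist _ _ hz.1 hz.2).symm
  obtain ⟨G, hG⟩ := CompleteSpace.complete hcauchy
  refine ⟨G, Lp.memLp G, ?_⟩
  have := (Lp.tendsto_Lp_iff_tendsto_eLpNorm' c G).1 hG
  refine this.congr' ?_
  filter_upwards [hpos] with y hy
  refine eLpNorm_congr_ae ?_
  rw [hc hy]
  exact (memLp_kerConv_conj hg hy).coeFn_toLp.sub .rfl

theorem tendsto_integral_mul_of_tendsto_eLpNorm {α ι : Type*} [MeasurableSpace α] {μ : Measure α}
    {l : Filter ι} {f : ι → α → ℝ} {G h : α → ℝ} (hf : ∀ᶠ i in l, MemLp (f i) 2 μ)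
    (hG : MemLp G 2 μ) (hh : MemLp h 2 μ)
    (hlim : Tendsto (fun i => eLpNorm (f i - G) 2 μ) l (𝓝 0)) :
    Tendsto (fun i => ∫ x, f i x * h x ∂μ) l (𝓝 (∫ x, G x * h x ∂μ)) := by
  rw [← tendsto_sub_nhds_zero_iff]
  have h1 : Tendsto (fun i => (eLpNorm (f i - G) 2 μ).toReal * (eLpNorm h 2 μ).toReal) l (𝓝 0) := by
    simpa using ((ENNReal.tendsto_toReal ENNReal.zero_ne_top).comp hlim).mul_const
      (eLpNorm h 2 μ).toReal
  refine squeeze_zero_norm' ?_ h1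
  filter_upwards [hf] with i hi
  have e : ∫ x, f i x * h x ∂μ - ∫ x, G x * h x ∂μ = inner ℝ (hh.toLp h) ((hi.sub hG).toLp _) := by
    have hs := integral_sub (hi.integrable_mul hh) (hG.integrable_mul hh)
    simp only [Pi.mul_apply] at hs
    rw [L2.inner_def, ← hs]
    refine integral_congr_ae ?_
    filter_upwards [hh.coeFn_toLp, (hi.sub hG).coeFn_toLp] with x h1 h2
    simp only [h1, h2, Pi.sub_apply, RCLike.inner_apply, conj_trivial]
    ring
  rw [e]
  refine (norm_inner_le_norm _ _).trans ?_
  rw [Lp.norm_toLp, Lp.norm_toLp, mul_comm]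

theorem tendsto_kerConv_conj_add {g : ℝ → ℝ} (hg : Integrable g) {a : ℝ} (ha : 0 < a) (p : ℝ) :
    Tendsto (fun y => kerConv (conjPoissonKer (a + y)) g p) (𝓝[>] 0)
      (𝓝 (kerConv (conjPoissonKer a) g p)) := by
  have hpos : ∀ᶠ y : ℝ in 𝓝[>] 0, 0 < y := self_mem_nhdsWithin
  unfold kerConv
  refine tendsto_integral_filter_of_dominated_convergence (fun q => |g q| * (1 / a)) ?_ ?_
    (hg.abs.mul_const _) (Eventually.of_forall fun q => ?_)
  · filter_upwards [hpos] with y hy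
    exact (integrable_kerConv_integrand hg (continuous_conjPoissonKer (add_pos ha hy))
      (abs_conjPoissonKer_le (add_pos ha hy)) p).1
  · filter_upwards [hpos] with y hy
    refine Eventually.of_forall fun q => ?_
    rw [norm_mul, Real.norm_eq_abs, Real.norm_eq_abs]
    refine mul_le_mul_of_nonneg_left
      ((abs_conjPoissonKer_le (add_pos ha hy) _).trans ?_) (abs_nonneg _)
    exact one_div_le_one_div_of_le ha (by linarith)
  · refine Tendsto.const_mul _ ?_
    unfold conjPoissonKer
    have h : ContinuousAt (fun y : ℝ => (p - q) / ((p - q) ^ 2 + (a + y) ^ 2)) 0 := by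
      refine continuousAt_const.div (by fun_prop) ?_
      positivity
    have := h.tendsto
    rw [add_zero] at this
    exact this.mono_left nhdsWithin_le_nhds

/-- Let `b → 0` in the semigroup law `kerConv_poisson_conj`: the conjugate Poisson integral of `g`
is, up to `π`, the Poisson integral of the limit `G`, so pointwise convergence becomes a statement
about Poisson integrals. -/
theorem kerConv_poisson_eq_of_tendsto {g G : ℝ → ℝ} (hg : Integrable g) (hG : MemLp G 2)
    (hlim : Tendsto (fun y => eLpNorm (kerConv (conjPoissonKer y) g - G) 2 volume) (𝓝[>] 0) (𝓝 0))
    {a : ℝ} (ha : 0 < a) (p : ℝ) :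
    kerConv (poissonKer a) G p = Real.pi * kerConv (conjPoissonKer a) g p := by
  have hpos : ∀ᶠ y : ℝ in 𝓝[>] 0, 0 < y := self_mem_nhdsWithin
  have h1 := tendsto_integral_mul_of_tendsto_eLpNorm
    (hpos.mono fun y hy => memLp_kerConv_conj hg hy) hG
    (memLp_comp_sub_left (memLp_poissonKer ha) p) hlim
  refine tendsto_nhds_unique h1 (((tendsto_kerConv_conj_add hg ha p).const_mul Real.pi).congr' ?_)
  filter_upwards [hpos] with y hy
  exact (kerConv_poisson_conj hg ha hy p).symm

/-! ### Pointwise limits at Lebesgue points. -/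

/-- Layer-cake form: the kernel is a superposition of indicators of intervals `|t| < r` with weight
minus its radial derivative, so averages over balls control Poisson integrals. -/
theorem ofReal_poissonKer_eq_lintegral {y : ℝ} (hy : 0 < y) (t : ℝ) :
    ENNReal.ofReal (poissonKer y t) =
      ∫⁻ r in Set.Ioi |t|, ENNReal.ofReal (2 * r * y / (r ^ 2 + y ^ 2) ^ 2) := by
  have hd : ∀ r ∈ Set.Ici |t|, HasDerivAt (fun r => -poissonKer y r)
      (2 * r * y / (r ^ 2 + y ^ 2) ^ 2) r := by
    intro r _
    have h1 : HasDerivAt (fun r : ℝ => r ^ 2 + y ^ 2) (2 * r) r := by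
      simpa using (hasDerivAt_pow 2 r).add_const (y ^ 2)
    refine ((hasDerivAt_const r y).div h1 (by positivity)).neg.congr_deriv ?_
    field_simp
    ring
  have hpos : ∀ r ∈ Set.Ioi |t|, 0 ≤ 2 * r * y / (r ^ 2 + y ^ 2) ^ 2 := by
    intro r hr
    have : 0 < r := (abs_nonneg t).trans_lt hr
    positivity
  have hlim : Tendsto (fun r => -poissonKer y r) atTop (𝓝 0) := by
    simpa using (tendsto_poissonKer_atTop hy).neg
  have hint := integrableOn_Ioi_deriv_of_nonneg' hd hpos hlim
  rw [← ofReal_integral_eq_lintegral_ofReal hint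
    ((ae_restrict_iff' measurableSet_Ioi).2 (Eventually.of_forall hpos)),
    integral_Ioi_of_hasDerivAt_of_nonneg' hd hpos hlim]
  simp [poissonKer]

/-- Insert the layer-cake formula and exchange integrals. The inner integral is at most `η r`, and
`r` times the weight is at most twice the Poisson kernel, of mass `π`. -/
theorem lintegral_mul_poissonKer_closedBall_le {u : ℝ → ENNReal} (hu : AEMeasurable u)
    {p δ η y : ℝ} (hη : 0 ≤ η) (hδ : 0 < δ) (hy : 0 < y)
    (h : ∀ r, 0 < r → r ≤ δ → ∫⁻ s in Metric.closedBall p r, u s ≤ ENNReal.ofReal (η * r)) :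
    ∫⁻ s in Metric.closedBall p δ, u s * ENNReal.ofReal (poissonKer y (p - s)) ≤
      ENNReal.ofReal (2 * η * Real.pi) := by
  set K : ℝ → ENNReal := fun r => ENNReal.ofReal (2 * r * y / (r ^ 2 + y ^ 2) ^ 2) with hK
  have hKm : Measurable K := by
    refine ENNReal.measurable_ofReal.comp ?_
    fun_prop
  let A : Set (ℝ × ℝ) := {z | |p - z.1| < z.2}
  have hA : MeasurableSet A :=
    measurableSet_lt (continuous_const.sub continuous_fst).abs.measurable measurable_snd
  calc ∫⁻ s in Metric.closedBall p δ, u s * ENNReal.ofReal (poissonKer y (p - s))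
      = ∫⁻ s in Metric.closedBall p δ, ∫⁻ r in Set.Ioi 0,
          u s * A.indicator (fun z => K z.2) (s, r) := by
        refine lintegral_congr fun s => ?_
        have hm : Measurable fun r => A.indicator (fun z => K z.2) (s, r) :=
          ((hKm.comp measurable_snd).indicator hA).comp measurable_prodMk_left
        rw [lintegral_const_mul _ hm, ofReal_poissonKer_eq_lintegral hy]
        congr 1
        have e : (fun r => A.indicator (fun z => K z.2) (s, r)) =
            (Set.Ioi |p - s|).indicator K := by
          funext r
          simp [A, Set.indicator]
        rw [e, setLIntegral_indicator measurableSet_Ioi, Set.inter_eq_left.2]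
        exact Set.Ioi_subset_Ioi (abs_nonneg _)
    _ = ∫⁻ r in Set.Ioi 0, ∫⁻ s in Metric.closedBall p δ,
          u s * A.indicator (fun z => K z.2) (s, r) := by
        refine lintegral_lintegral_swap ?_
        exact (hu.restrict.comp_fst).mul ((hKm.comp measurable_snd).indicator hA).aemeasurable
    _ ≤ ∫⁻ r in Set.Ioi 0, ENNReal.ofReal (2 * η * poissonKer y r) := by
        refine setLIntegral_mono' measurableSet_Ioi fun r hr => ?_
        rw [Set.mem_Ioi] at hr
        have e : ∀ s, u s * A.indicator (fun z => K z.2) (s, r) ≤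
            (Metric.closedBall p r).indicator u s * K r := by
          intro s
          by_cases hs : |p - s| < r
          · have h1 : s ∈ Metric.closedBall p r := by
              rw [Metric.mem_closedBall, dist_comm, Real.dist_eq]
              exact hs.le
            simp [A, hs, h1]
          · simp [A, hs]
        have hmin : 0 < min r δ := lt_min hr hδ
        calc ∫⁻ s in Metric.closedBall p δ, u s * A.indicator (fun z => K z.2) (s, r)
            ≤ ∫⁻ s in Metric.closedBall p δ, (Metric.closedBall p r).indicator u s * K r :=
              lintegral_mono e
          _ = (∫⁻ s in Metric.closedBall p (min r δ), u s) * K r := by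
              rw [lintegral_mul_const'' _ (hu.restrict.indicator Metric.isClosed_closedBall.measurableSet),
                setLIntegral_indicator Metric.isClosed_closedBall.measurableSet]
              congr 3
              ext s
              simp
          _ ≤ ENNReal.ofReal (η * r) * K r := by
              refine mul_le_mul_left ((h _ hmin (min_le_right _ _)).trans ?_) _
              exact ENNReal.ofReal_le_ofReal (mul_le_mul_of_nonneg_left (min_le_left _ _) hη)
          _ ≤ ENNReal.ofReal (2 * η * poissonKer y r) := by
              rw [hK, ← ENNReal.ofReal_mul (by positivity)]
              refine ENNReal.ofReal_le_ofReal ?_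
              have h1 : η * r * (2 * r * y / (r ^ 2 + y ^ 2) ^ 2) =
                  2 * η * (r ^ 2 / (r ^ 2 + y ^ 2)) * poissonKer y r := by
                unfold poissonKer
                have : r ^ 2 + y ^ 2 ≠ 0 := by positivity
                field_simp
              rw [h1]
              refine mul_le_mul_of_nonneg_right ?_ (poissonKer_nonneg hy r)
              refine mul_le_of_le_one_right (by positivity) ?_
              rw [div_le_one (by positivity)]
              nlinarith [sq_nonneg y]
    _ ≤ ∫⁻ r, ENNReal.ofReal (2 * η * poissonKer y r) := setLIntegral_le_lintegral _ _
    _ = ENNReal.ofReal (2 * η * Real.pi) := by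
        rw [← ofReal_integral_eq_lintegral_ofReal ((integrable_poissonKer hy).const_mul _)
          (Eventually.of_forall fun r => mul_nonneg (by positivity) (poissonKer_nonneg hy r)),
          integral_const_mul, integral_poissonKer hy]

/-- Away from the origin the kernel is `O(y)` relative to the kernel of height `1`, so the far part
of a Poisson integral vanishes as `y → 0`. -/
theorem poissonKer_le_of_lt_abs {δ y t : ℝ} (hδ : 0 < δ) (hy : 0 < y) (ht : δ < |t|) :
    poissonKer y t ≤ y * ((1 + δ ^ 2) / δ ^ 2) * poissonKer 1 t := by
  have h1 : δ ^ 2 < t ^ 2 := by rw [← sq_abs t]; gcongr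
  unfold poissonKer
  rw [mul_assoc, div_mul_div_comm, ← mul_div_assoc, div_le_div_iff₀ (by positivity) (by positivity),
    mul_assoc]
  refine mul_le_mul_of_nonneg_left ?_ hy.le
  nlinarith [mul_nonneg (sq_nonneg δ) (sq_nonneg y), sq_nonneg y]

theorem enorm_mul_ofReal_poissonKer_lintegral_lt_top {h : ℝ → ℝ} (hh : MemLp h 2) (c p : ℝ) {y : ℝ}
    (hy : 0 < y) :
    ∫⁻ s, ‖h s - c‖ₑ * ENNReal.ofReal (poissonKer y (p - s)) < ⊤ := by
  have h1 : Integrable fun s => (h s - c) * poissonKer y (p - s) := by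
    have i1 : Integrable fun s => h s * poissonKer y (p - s) :=
      hh.integrable_mul (memLp_comp_sub_left (memLp_poissonKer hy) p)
    have i2 : Integrable fun s => c * poissonKer y (p - s) :=
      ((integrable_poissonKer hy).comp_sub_left p).const_mul c
    simp only [sub_mul]
    exact i1.sub i2
  refine lt_of_le_of_lt (le_of_eq ?_) h1.2
  refine lintegral_congr fun s => ?_
  rw [enorm_mul, Real.enorm_of_nonneg (poissonKer_nonneg hy _)]

theorem ae_tendsto_lintegral_poissonKer {h : ℝ → ℝ} (hh : MemLp h 2) :
    ∀ᵐ p, Tendsto (fun y => ∫⁻ s, ‖h s - h p‖ₑ * ENNReal.ofReal (poissonKer y (p - s)))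
      (𝓝[>] 0) (𝓝 0) := by
  filter_upwards [(Besicovitch.vitaliFamily volume).ae_tendsto_lintegral_enorm_sub_div
    (hh.locallyIntegrable one_le_two)] with p hp
  have hpos : ∀ᶠ y : ℝ in 𝓝[>] 0, 0 < y := self_mem_nhdsWithin
  have hp' := hp.comp (Besicovitch.tendsto_filterAt volume p)
  rw [ENNReal.tendsto_nhds_zero]
  intro ε hε
  obtain ⟨n, hn0, hn⟩ := ENNReal.lt_iff_exists_nnreal_btwn.1 (ENNReal.half_pos hε.ne')
  have hn0' : 0 < (n : ℝ) := by exact_mod_cast hn0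
  -- Chosen so that the near part, bounded by `2ηπ`, is at most `n < ε/2`. The `η / 2` used below
  -- reflects that a ball of radius `r` has length `2r`.
  set η : ℝ := n / (2 * Real.pi) with hη
  have hηpos : 0 < η := by positivity
  have hev := (ENNReal.tendsto_nhds_zero.1 hp') (ENNReal.ofReal (η / 2))
    (ENNReal.ofReal_pos.2 (by positivity))
  obtain ⟨δ, hδ, hδ'⟩ := mem_nhdsGT_iff_exists_Ioc_subset.1 hev
  rw [Set.mem_Ioi] at hδ
  have hball : ∀ r, 0 < r → r ≤ δ →
      ∫⁻ s in Metric.closedBall p r, ‖h s - h p‖ₑ ≤ ENNReal.ofReal (η * r) := by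
    intro r hr hrδ
    have h1 := hδ' ⟨hr, hrδ⟩
    simp only [Set.mem_ofPred_eq, Function.comp_apply] at h1
    rw [ENNReal.div_le_iff (by simp [Real.volume_closedBall, hr])
        (by rw [Real.volume_closedBall]; exact ENNReal.ofReal_ne_top),
      Real.volume_closedBall, ← ENNReal.ofReal_mul (by positivity)] at h1
    refine h1.trans (le_of_eq ?_)
    congr 1
    ring
  have hm : AEMeasurable fun s => ‖h s - h p‖ₑ :=
    (hh.1.sub aestronglyMeasurable_const).enorm
  set J := ∫⁻ s, ‖h s - h p‖ₑ * ENNReal.ofReal (poissonKer 1 (p - s)) with hJ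
  have hJtop : J ≠ ⊤ := (enorm_mul_ofReal_poissonKer_lintegral_lt_top hh _ _ one_pos).ne
  have hfar : Tendsto (fun y : ℝ => ENNReal.ofReal (y * ((1 + δ ^ 2) / δ ^ 2)) * J) (𝓝[>] 0)
      (𝓝 0) := by
    have h1 : Tendsto (fun y : ℝ => y * ((1 + δ ^ 2) / δ ^ 2)) (𝓝[>] 0) (𝓝 0) :=
      ((continuous_id.mul continuous_const).tendsto' 0 0 (by simp)).mono_left nhdsWithin_le_nhds
    have h2 := ENNReal.Tendsto.mul_const (ENNReal.tendsto_ofReal h1) (Or.inr hJtop)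
    simpa using h2
  filter_upwards [hpos, ENNReal.tendsto_nhds_zero.1 hfar (ε / 2) (ENNReal.half_pos hε.ne')]
    with y hy hyfar
  rw [← lintegral_add_compl _ (Metric.isClosed_closedBall (x := p) (ε := δ)).measurableSet,
    ← ENNReal.add_halves ε]
  refine add_le_add ?_ ?_
  · refine (lintegral_mul_poissonKer_closedBall_le hm hηpos.le hδ hy hball).trans ?_
    have e : 2 * η * Real.pi = n := by rw [hη]; field_simp
    rw [e, ENNReal.ofReal_coe_nnreal]
    exact hn.le
  · refine le_trans ?_ hyfar
    rw [hJ, ← lintegral_const_mul' _ _ ENNReal.ofReal_ne_top]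
    refine le_trans (setLIntegral_mono' Metric.isClosed_closedBall.measurableSet.compl ?_)
      (setLIntegral_le_lintegral (Metric.closedBall p δ)ᶜ _)
    intro s hs
    rw [mul_left_comm, ← ENNReal.ofReal_mul (by positivity)]
    refine mul_le_mul_right (ENNReal.ofReal_le_ofReal (poissonKer_le_of_lt_abs hδ hy ?_)) _
    rw [Set.mem_compl_iff, Metric.mem_closedBall, dist_comm, Real.dist_eq] at hs
    exact not_le.1 hs

/-- At a Lebesgue point, an integral against a kernel that is dominated by the Poisson kernel
and has mean value `m` tends to `m` times the value of the function. -/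
theorem tendsto_integral_of_abs_le_poissonKer {h : ℝ → ℝ} (hh : MemLp h 2) {p : ℝ}
    (hp : Tendsto (fun y => ∫⁻ s, ‖h s - h p‖ₑ * ENNReal.ofReal (poissonKer y (p - s)))
      (𝓝[>] 0) (𝓝 0)) {D : ℝ → ℝ → ℝ} {m : ℝ} (hDm : ∀ y, Measurable (D y))
    (hD : ∀ y t, 0 < y → |D y t| ≤ poissonKer y t) (hm : ∀ y, 0 < y → ∫ t, D y t = m) :
    Tendsto (fun y => kerConv (D y) h p) (𝓝[>] 0) (𝓝 (m * h p)) := by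
  have hpos : ∀ᶠ y : ℝ in 𝓝[>] 0, 0 < y := self_mem_nhdsWithin
  rw [← tendsto_sub_nhds_zero_iff]
  have hp' := (ENNReal.tendsto_toReal ENNReal.zero_ne_top).comp hp
  refine squeeze_zero_norm' ?_ hp'
  filter_upwards [hpos] with y hy
  have hP := integrable_poissonKer hy
  have hDi : Integrable (D y) := hP.mono' (hDm y).aestronglyMeasurable
    (Eventually.of_forall fun t => hD y t hy)
  have hD2 : MemLp (D y) 2 := (memLp_poissonKer hy).mono (hDm y).aestronglyMeasurable
    (Eventually.of_forall fun t => (hD y t hy).trans (le_abs_self _))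
  have i1 : Integrable fun s => h s * D y (p - s) := hh.integrable_mul (memLp_comp_sub_left hD2 p)
  have i2 : Integrable fun s => h p * D y (p - s) := (hDi.comp_sub_left p).const_mul _
  have e : kerConv (D y) h p - m * h p = ∫ s, (h s - h p) * D y (p - s) := by
    simp_rw [sub_mul]
    rw [integral_sub i1 i2, integral_const_mul, integral_sub_left_eq_self, hm y hy, kerConv]
    ring
  rw [e]
  refine (norm_integral_le_lintegral_norm _).trans ?_
  refine ENNReal.toReal_mono
    (enorm_mul_ofReal_poissonKer_lintegral_lt_top hh _ _ hy).ne (lintegral_mono fun s => ?_)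
  rw [ofReal_norm, enorm_mul]
  refine mul_le_mul_right ?_ _
  rw [Real.enorm_eq_ofReal_abs]
  exact ENNReal.ofReal_le_ofReal (hD y _ hy)

/-! ### Principal values and the Hilbert transform. -/

/-- The truncation `1_{|t| ≥ ε} / t` of the Hilbert kernel. -/
noncomputable def truncKer (ε t : ℝ) : ℝ := if ε ≤ |t| then t⁻¹ else 0

theorem measurable_truncKer_sub (ε : ℝ) :
    Measurable fun t => truncKer ε t - conjPoissonKer ε t := by
  unfold truncKer conjPoissonKer
  refine (Measurable.ite (measurableSet_le measurable_const measurable_id.abs) measurable_inv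
    measurable_const).sub ?_
  fun_prop

/-- For `|t| ≥ ε` the difference is `ε² / (t (t² + ε²))`; for `|t| < ε` it is the conjugate kernel
itself. With the oddness in `integral_truncKer_sub`, truncation and conjugate Poisson regularisation
have the same limit at Lebesgue points. -/
theorem abs_truncKer_sub_le {ε : ℝ} (hε : 0 < ε) (t : ℝ) :
    |truncKer ε t - conjPoissonKer ε t| ≤ poissonKer ε t := by
  have hs : 0 < t ^ 2 + ε ^ 2 := by positivity
  unfold truncKer conjPoissonKer poissonKer
  split_ifs with h
  · have ht : t ≠ 0 := by
      rintro rfl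
      simp at h
      linarith
    have e : t⁻¹ - t / (t ^ 2 + ε ^ 2) = ε ^ 2 / (t * (t ^ 2 + ε ^ 2)) := by
      field_simp
      ring
    have ht' : 0 < |t| := abs_pos.2 ht
    rw [e, abs_div, abs_mul, abs_of_pos hs, abs_of_nonneg (sq_nonneg ε),
      div_le_div_iff₀ (by positivity) hs]
    nlinarith [mul_le_mul_of_nonneg_left h (mul_nonneg hε.le hs.le)]
  · rw [zero_sub, abs_neg, abs_div, abs_of_pos hs]
    exact div_le_div_of_nonneg_right (not_le.1 h).le hs.le

theorem integral_truncKer_sub (ε : ℝ) :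
    ∫ t, (truncKer ε t - conjPoissonKer ε t) = 0 := by
  have h := integral_neg_eq_self (fun t => truncKer ε t - conjPoissonKer ε t) volume
  have e : ∀ t, truncKer ε (-t) - conjPoissonKer ε (-t) =
      -(truncKer ε t - conjPoissonKer ε t) := by
    intro t
    rw [conjPoissonKer_neg]
    unfold truncKer
    rw [abs_neg]
    split_ifs <;> ring
  simp_rw [e] at h
  rw [integral_neg] at h
  linarith

theorem integrable_div_compl_ball {g : ℝ → ℝ} (hg : Integrable g) {ε : ℝ} (hε : 0 < ε) (p : ℝ) :
    Integrable fun q => g q * truncKer ε (p - q) := by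
  refine hg.mul_bdd (c := 1 / ε) ?_ (Eventually.of_forall fun q => ?_)
  · have h : Measurable (truncKer ε) := by
      unfold truncKer
      exact Measurable.ite (measurableSet_le measurable_const measurable_id.abs) measurable_inv
        measurable_const
    exact (h.comp (measurable_const.sub measurable_id)).aestronglyMeasurable
  · unfold truncKer
    split_ifs with h
    · rw [norm_inv, Real.norm_eq_abs, ← one_div]
      exact one_div_le_one_div_of_le hε h
    · simpa using hε.le

theorem setIntegral_compl_ball_eq_kerConv (g : ℝ → ℝ) (ε p : ℝ) :
    ∫ q in (Metric.ball p ε)ᶜ, g q / (p - q) = kerConv (truncKer ε) g p := by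
  rw [← integral_indicator Metric.isOpen_ball.measurableSet.compl, kerConv]
  refine integral_congr_ae (Eventually.of_forall fun q => ?_)
  simp only [truncKer, Set.indicator, Set.mem_compl_iff, Metric.mem_ball, not_lt, dist_comm q p,
    Real.dist_eq]
  split_ifs <;> simp [div_eq_mul_inv]

/-- The energy identity with `a = b = y` and Schur's bound give norm at most `π ‖g‖` at every
height, and the bound passes to the limit. -/
theorem eLpNorm_le_of_tendsto_kerConv_conj {g G : ℝ → ℝ} (hg : Integrable g) (hg2 : MemLp g 2)
    (hG : MemLp G 2)
    (hlim : Tendsto (fun y => eLpNorm (kerConv (conjPoissonKer y) g - G) 2 volume) (𝓝[>] 0)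
      (𝓝 0)) :
    eLpNorm G 2 volume ≤ ENNReal.ofReal Real.pi * eLpNorm g 2 volume := by
  have hpos : ∀ᶠ y : ℝ in 𝓝[>] 0, 0 < y := self_mem_nhdsWithin
  have h1 : Tendsto (fun y => ENNReal.ofReal Real.pi * eLpNorm g 2 volume +
      eLpNorm (kerConv (conjPoissonKer y) g - G) 2 volume) (𝓝[>] 0)
      (𝓝 (ENNReal.ofReal Real.pi * eLpNorm g 2 volume + 0)) := hlim.const_add _
  rw [add_zero] at h1
  refine ge_of_tendsto h1 ?_
  filter_upwards [hpos] with y hy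
  have hc := memLp_kerConv_conj hg hy
  have h2 : eLpNorm (kerConv (conjPoissonKer y) g) 2 volume ≤
      ENNReal.ofReal Real.pi * eLpNorm g 2 volume := by
    rw [eLpNorm_two_eq_ofReal_sqrt hc, eLpNorm_two_eq_ofReal_sqrt hg2,
      ← ENNReal.ofReal_mul Real.pi_pos.le]
    refine ENNReal.ofReal_le_ofReal ?_
    rw [← Real.sqrt_sq Real.pi_pos.le, ← Real.sqrt_mul (sq_nonneg _)]
    refine Real.sqrt_le_sqrt ?_
    have h3 := integral_kerConv_conj_mul hg hy hy
    simp_rw [← sq] at h3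
    rw [h3, sq Real.pi, mul_assoc]
    exact mul_le_mul_of_nonneg_left (integral_mul_kerConv_poisson_le hg hg2 (add_pos hy hy))
      Real.pi_pos.le
  have e : G = kerConv (conjPoissonKer y) g - (kerConv (conjPoissonKer y) g - G) := by
    rw [sub_sub_cancel]
  calc eLpNorm G 2 volume
      = eLpNorm (kerConv (conjPoissonKer y) g - (kerConv (conjPoissonKer y) g - G)) 2 volume := by
        rw [← e]
    _ ≤ _ := (eLpNorm_sub_le hc.1 (hc.sub hG).1 one_le_two).trans (by gcongr)

/-- The Hilbert transform of a function in `L¹ ∩ L²` exists in the mean square sense, as the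
boundary value of the conjugate Poisson integral, and as a principal value almost everywhere. -/
theorem exists_hilbertTransform {g : ℝ → ℝ} (hg : Integrable g) (hg2 : MemLp g 2) :
    ∃ G : ℝ → ℝ, MemLp G 2 ∧ eLpNorm G 2 volume ≤ ENNReal.ofReal Real.pi * eLpNorm g 2 volume ∧
      Tendsto (fun y => eLpNorm (kerConv (conjPoissonKer y) g - G) 2 volume) (𝓝[>] 0) (𝓝 0) ∧
      (∀ᵐ p, Tendsto (fun y => kerConv (conjPoissonKer y) g p) (𝓝[>] 0) (𝓝 (G p))) ∧
      ∀ᵐ p, Tendsto (fun ε => ∫ q in (Metric.ball p ε)ᶜ, g q / (p - q)) (𝓝[>] 0) (𝓝 (G p)) := by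
  obtain ⟨G, hG, hlim⟩ := exists_memLp_tendsto_kerConv_conj hg hg2
  have hpos : ∀ᶠ y : ℝ in 𝓝[>] 0, 0 < y := self_mem_nhdsWithin
  have h1 : ∀ᵐ p, Tendsto (fun y => kerConv (conjPoissonKer y) g p) (𝓝[>] 0) (𝓝 (G p)) := by
    filter_upwards [ae_tendsto_lintegral_poissonKer hG] with p hp
    have h2 := (tendsto_integral_of_abs_le_poissonKer hG hp (D := poissonKer) (m := Real.pi)
      (fun y => by unfold poissonKer; fun_prop)
      (fun y t hy => (abs_of_nonneg (poissonKer_nonneg hy t)).le)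
      (fun y hy => integral_poissonKer hy)).const_mul Real.pi⁻¹
    rw [inv_mul_cancel_left₀ Real.pi_ne_zero] at h2
    refine h2.congr' ?_
    filter_upwards [hpos] with y hy
    rw [kerConv_poisson_eq_of_tendsto hg hG hlim hy p, inv_mul_cancel_left₀ Real.pi_ne_zero]
  refine ⟨G, hG, eLpNorm_le_of_tendsto_kerConv_conj hg hg2 hG hlim, hlim, h1, ?_⟩
  filter_upwards [h1, ae_tendsto_lintegral_poissonKer hg2] with p hp1 hp2
  have h2 := tendsto_integral_of_abs_le_poissonKer hg2 hp2
    (D := fun ε t => truncKer ε t - conjPoissonKer ε t) (m := 0) measurable_truncKer_sub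
    (fun y t hy => abs_truncKer_sub_le hy t) (fun y _ => integral_truncKer_sub y)
  have h3 := h2.add hp1
  rw [zero_mul, zero_add] at h3
  refine h3.congr' ?_
  filter_upwards [hpos] with ε hε
  have i1 := integrable_div_compl_ball hg hε p
  have i2 := integrable_kerConv_integrand hg (continuous_conjPoissonKer hε)
    (abs_conjPoissonKer_le hε) p
  rw [setIntegral_compl_ball_eq_kerConv, kerConv, kerConv, kerConv]
  simp_rw [mul_sub]
  rw [integral_sub i1 i2, sub_add_cancel]

theorem integral_kerConv_conj_mul_eq_neg {f g : ℝ → ℝ} (hf : Integrable f) (hg2 : MemLp g 2)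
    {y : ℝ} (hy : 0 < y) :
    ∫ p, kerConv (conjPoissonKer y) f p * g p = -∫ p, kerConv (conjPoissonKer y) g p * f p := by
  rw [kerConv_swap hf hg2 (memLp_conjPoissonKer hy) (continuous_conjPoissonKer hy),
    ← integral_neg]
  refine integral_congr_ae (Eventually.of_forall fun q => ?_)
  simp only [kerConv]
  rw [mul_comm, neg_mul_eq_neg_mul, ← integral_neg]
  congr 1
  refine integral_congr_ae (Eventually.of_forall fun p => ?_)
  simp only
  rw [← neg_sub q p, conjPoissonKer_neg]
  ring

/-! ### The Hilbert and Carleman operators on an interval. -/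

/-- A bounded operator on `L²` from a pointwise rule that is linear almost everywhere. -/
theorem exists_clm_of_ae {α : Type*} [MeasurableSpace α] {μ : Measure α}
    (A : Lp ℝ 2 μ → α → ℝ) {C : ENNReal} (hC : C ≠ ⊤)
    (hadd : ∀ f g, A (f + g) =ᵐ[μ] A f + A g) (hsmul : ∀ (c : ℝ) f, A (c • f) =ᵐ[μ] c • A f)
    (hmem : ∀ f, MemLp (A f) 2 μ) (hbd : ∀ f, eLpNorm (A f) 2 μ ≤ C * eLpNorm f 2 μ) :
    ∃ T : Lp ℝ 2 μ →L[ℝ] Lp ℝ 2 μ, ∀ f, T f =ᵐ[μ] A f := by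
  let T : Lp ℝ 2 μ →ₗ[ℝ] Lp ℝ 2 μ :=
    { toFun := fun f => (hmem f).toLp _
      map_add' := fun f g => by
        rw [← MemLp.toLp_add, MemLp.toLp_eq_toLp_iff]
        exact hadd f g
      map_smul' := fun c f => by
        rw [RingHom.id_apply, ← MemLp.toLp_const_smul, MemLp.toLp_eq_toLp_iff]
        exact hsmul c f }
  refine ⟨T.mkContinuous C.toReal fun f => ?_, fun f => (hmem f).coeFn_toLp⟩
  change ‖(hmem f).toLp _‖ ≤ _
  rw [Lp.norm_toLp, Lp.norm_def, ← ENNReal.toReal_mul]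
  exact ENNReal.toReal_mono (ENNReal.mul_ne_top hC (Lp.eLpNorm_ne_top f)) (hbd f)

theorem memLp_indicator_Icc {a b : ℝ} {f : ℝ → ℝ}
    (hf : MemLp f 2 (volume.restrict (Set.Icc a b))) : MemLp ((Set.Icc a b).indicator f) 2 :=
  (memLp_indicator_iff_restrict measurableSet_Icc).2 hf

theorem integrable_indicator_Icc {a b : ℝ} {f : ℝ → ℝ}
    (hf : MemLp f 2 (volume.restrict (Set.Icc a b))) : Integrable ((Set.Icc a b).indicator f) :=
  (integrable_indicator_iff measurableSet_Icc).2 (hf.integrable one_le_two)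

theorem kerConv_indicator (k f : ℝ → ℝ) (a b p : ℝ) :
    kerConv k ((Set.Icc a b).indicator f) p = ∫ q in Set.Icc a b, f q * k (p - q) := by
  rw [kerConv, ← integral_indicator measurableSet_Icc]
  refine integral_congr_ae (Eventually.of_forall fun q => ?_)
  by_cases hq : q ∈ Set.Icc a b <;> simp [hq]

theorem setIntegral_indicator_div (f : ℝ → ℝ) (a b p ε : ℝ) :
    ∫ q in (Metric.ball p ε)ᶜ, (Set.Icc a b).indicator f q / (p - q) =
      ∫ q in Set.Icc a b \ Metric.ball p ε, f q / (p - q) := by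
  rw [Set.sdiff_eq, Set.inter_comm, ← setIntegral_indicator measurableSet_Icc]
  refine integral_congr_ae (Eventually.of_forall fun q => ?_)
  by_cases hq : q ∈ Set.Icc a b <;> simp [hq]

/-- The finite Hilbert transform as a bounded skew-adjoint operator on `L²(a, b)`. -/
theorem exists_hilbertOperator (a b : ℝ) :
    ∃ H : Lp ℝ 2 (volume.restrict (Set.Icc a b)) →L[ℝ] Lp ℝ 2 (volume.restrict (Set.Icc a b)),
      (∀ f g, inner ℝ (H f) g = -inner ℝ (H g) f) ∧
      ∀ f : Lp ℝ 2 (volume.restrict (Set.Icc a b)), ∀ᵐ p ∂(volume.restrict (Set.Icc a b)),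
        HasPVIntegral a b (fun q => f q / (p - q)) p (H f p) ∧
        Tendsto (fun y => ∫ q in Set.Icc a b, f q * conjPoissonKer y (p - q)) (𝓝[>] 0)
          (𝓝 (H f p)) := by
  set μ : Measure ℝ := volume.restrict (Set.Icc a b) with hμ
  have hpos : ∀ᶠ y : ℝ in 𝓝[>] 0, 0 < y := self_mem_nhdsWithin
  have h1 : ∀ f : Lp ℝ 2 μ, Integrable ((Set.Icc a b).indicator f) := fun f =>
    integrable_indicator_Icc (Lp.memLp f)
  have h2 : ∀ f : Lp ℝ 2 μ, MemLp ((Set.Icc a b).indicator f) 2 := fun f =>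
    memLp_indicator_Icc (Lp.memLp f)
  choose A hA hAn hAlim hAq hApv using fun f : Lp ℝ 2 μ => exists_hilbertTransform (h1 f) (h2 f)
  have hAq' : ∀ f : Lp ℝ 2 μ, ∀ᵐ p ∂μ, Tendsto (fun y => ∫ q, f q * conjPoissonKer y (p - q) ∂μ)
      (𝓝[>] 0) (𝓝 (A f p)) := fun f => by
    filter_upwards [ae_restrict_of_ae (hAq f)] with p hp
    simpa only [kerConv_indicator] using hp
  have hi : ∀ (f : Lp ℝ 2 μ) {y : ℝ}, 0 < y → ∀ p,
      Integrable (fun q => f q * conjPoissonKer y (p - q)) μ := fun f y hy p =>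
    ((Lp.memLp f).integrable one_le_two).mul_bdd
      ((continuous_conjPoissonKer hy).comp
        (continuous_const.sub continuous_id)).aestronglyMeasurable
      (Eventually.of_forall fun q => abs_conjPoissonKer_le hy (p - q))
  -- The chosen limits `A f` are linear almost everywhere by uniqueness of limits, since the
  -- regularised integrals are linear in `f`.
  obtain ⟨H, hH⟩ := exists_clm_of_ae A (C := ENNReal.ofReal Real.pi) ENNReal.ofReal_ne_top
    (fun f g => by
      filter_upwards [hAq' f, hAq' g, hAq' (f + g)] with p hf hg hfg
      refine tendsto_nhds_unique hfg ((hf.add hg).congr' ?_)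
      filter_upwards [hpos] with y hy
      rw [← integral_add (hi f hy p) (hi g hy p)]
      refine integral_congr_ae ?_
      filter_upwards [Lp.coeFn_add f g] with q hq
      rw [hq, Pi.add_apply]
      ring)
    (fun c f => by
      filter_upwards [hAq' f, hAq' (c • f)] with p hf hcf
      refine tendsto_nhds_unique hcf ((hf.const_mul c).congr' ?_)
      filter_upwards [hpos] with y hy
      rw [← integral_const_mul]
      refine integral_congr_ae ?_
      filter_upwards [Lp.coeFn_smul c f] with q hq
      rw [hq, Pi.smul_apply, smul_eq_mul]
      ring)
    (fun f => (hA f).restrict _)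
    (fun f => (eLpNorm_restrict_le _ _ _ _).trans ((hAn f).trans
      (by rw [eLpNorm_indicator_eq_eLpNorm_restrict measurableSet_Icc])))
  have hinner : ∀ f g : Lp ℝ 2 μ,
      inner ℝ (H f) g = ∫ p, A f p * (Set.Icc a b).indicator g p := by
    intro f g
    rw [L2.inner_def]
    have e : ∀ p, A f p * (Set.Icc a b).indicator g p =
        (Set.Icc a b).indicator (fun p => A f p * g p) p := by
      intro p
      by_cases hp : p ∈ Set.Icc a b <;> simp [hp]
    simp_rw [e]
    rw [integral_indicator measurableSet_Icc]
    refine integral_congr_ae ?_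
    filter_upwards [hH f] with p hp
    simp [hp, mul_comm]
  refine ⟨H, fun f g => ?_, fun f => ?_⟩
  · rw [hinner, hinner]
    -- The regularised operators are skew because the conjugate kernel is odd, and skewness survives
    -- the `L²` limit.
    have l1 := tendsto_integral_mul_of_tendsto_eLpNorm
      (hpos.mono fun y hy => memLp_kerConv_conj (h1 f) hy) (hA f) (h2 g) (hAlim f)
    have l2 := tendsto_integral_mul_of_tendsto_eLpNorm
      (hpos.mono fun y hy => memLp_kerConv_conj (h1 g) hy) (hA g) (h2 f) (hAlim g)
    refine tendsto_nhds_unique l1 (l2.neg.congr' ?_)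
    filter_upwards [hpos] with y hy
    exact (integral_kerConv_conj_mul_eq_neg (h1 f) (h2 g) hy).symm
  · filter_upwards [hAq' f, ae_restrict_of_ae (hApv f), hH f] with p hp1 hp2 hp3
    rw [hp3]
    refine ⟨?_, hp1⟩
    simp only [setIntegral_indicator_div] at hp2
    exact hp2

theorem integral_exp_neg_add_mul {p q : ℝ} (h : 0 < p + q) :
    ∫ t in Set.Ioi (0 : ℝ), Real.exp (-p * t) * Real.exp (-q * t) = 1 / (p + q) := by
  have e : ∀ t : ℝ, Real.exp (-p * t) * Real.exp (-q * t) = Real.exp (-(p + q) * t) := by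
    intro t
    rw [← Real.exp_add]
    congr 1
    ring
  simp_rw [e]
  rw [integral_exp_mul_Ioi (by linarith)]
  rw [mul_zero, Real.exp_zero, neg_div_neg_eq]

/-- The Carleman operator with kernel `1 / (p + q)` on `L²(a, b)`, `a > 0`, is bounded, symmetric
and nonnegative. -/
theorem exists_carlemanOperator {a b : ℝ} (ha : 0 < a) :
    ∃ S : Lp ℝ 2 (volume.restrict (Set.Icc a b)) →L[ℝ] Lp ℝ 2 (volume.restrict (Set.Icc a b)),
      (∀ f g, inner ℝ (S f) g = inner ℝ (S g) f) ∧ (∀ f, 0 ≤ inner ℝ (S f) f) ∧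
      ∀ f : Lp ℝ 2 (volume.restrict (Set.Icc a b)),
        S f =ᵐ[volume.restrict (Set.Icc a b)] fun p => ∫ q in Set.Icc a b, f q / (p + q) := by
  set μ : Measure ℝ := volume.restrict (Set.Icc a b) with hμ
  set ν : Measure ℝ := volume.restrict (Set.Ioi 0) with hν
  have hmem : ∀ᵐ p ∂μ, p ∈ Set.Icc a b := ae_restrict_mem measurableSet_Icc
  have hf1 : ∀ f : Lp ℝ 2 μ, Integrable f μ := fun f => (Lp.memLp f).integrable one_le_two
  have hexp : Integrable (fun t : ℝ => Real.exp (-a * t)) ν :=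
    integrableOn_exp_mul_Ioi (by linarith) 0
  have hmem2 : ∀ᵐ z ∂(μ.prod ν), z.1 ∈ Set.Icc a b ∧ z.2 ∈ Set.Ioi (0 : ℝ) :=
    (Measure.quasiMeasurePreserving_fst.ae hmem).and
      (Measure.quasiMeasurePreserving_snd.ae (ae_restrict_mem measurableSet_Ioi))
  have hlap : ∀ f : Lp ℝ 2 μ, Integrable (fun z : ℝ × ℝ => f z.1 * Real.exp (-z.1 * z.2))
      (μ.prod ν) := by
    intro f
    refine ((hf1 f).norm.mul_prod hexp).mono'
      ((hf1 f).1.comp_fst.mul (by fun_prop)) ?_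
    filter_upwards [hmem2] with z hz
    rw [norm_mul, Real.norm_eq_abs (Real.exp _), Real.abs_exp]
    refine mul_le_mul_of_nonneg_left (Real.exp_le_exp.2 ?_) (norm_nonneg _)
    nlinarith [hz.1.1, le_of_lt (Set.mem_Ioi.1 hz.2)]
  have hker : ∀ (f : Lp ℝ 2 μ) (p : ℝ), p ∈ Set.Icc a b → Integrable (fun q => f q / (p + q)) μ := by
    intro f p hp
    simp only [div_eq_mul_inv]
    refine (hf1 f).mul_bdd (c := 1 / a) (by fun_prop) ?_
    filter_upwards [hmem] with q hq
    rw [norm_inv, Real.norm_eq_abs, abs_of_pos (by linarith [hp.1, hq.1]), ← one_div]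
    exact one_div_le_one_div_of_le ha (by linarith [hp.1, hq.1])
  have hbound : ∀ (f : Lp ℝ 2 μ), ∀ᵐ p ∂μ,
      ‖∫ q, f q / (p + q) ∂μ‖ ≤ 1 / a * ∫ q, ‖f q‖ ∂μ := by
    intro f
    filter_upwards [hmem] with p hp
    rw [← integral_const_mul]
    refine norm_integral_le_of_norm_le ((hf1 f).norm.const_mul _) ?_
    filter_upwards [hmem] with q hq
    rw [norm_div, Real.norm_eq_abs (p + q), abs_of_pos (by linarith [hp.1, hq.1]), mul_comm,
      mul_one_div]
    exact div_le_div_of_nonneg_left (norm_nonneg _) ha (by linarith [hp.1, hq.1])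
  have hmeas : ∀ f : Lp ℝ 2 μ, AEStronglyMeasurable (fun p => ∫ q, f q / (p + q) ∂μ) μ := by
    intro f
    refine AEStronglyMeasurable.integral_prod_right' (f := fun z : ℝ × ℝ => f z.2 / (z.1 + z.2)) ?_
    simp only [div_eq_mul_inv]
    exact (hf1 f).1.comp_snd.mul (by fun_prop : Measurable _).aestronglyMeasurable
  -- The kernel is at most `1/a`, so the constant comes from comparing the `L²` norm with the
  -- supremum, then `L¹` with `L²`, on a finite measure space.
  obtain ⟨S, hS⟩ := exists_clm_of_ae (μ := μ) (fun f p => ∫ q, f q / (p + q) ∂μ)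
    (C := μ Set.univ ^ (2 : ENNReal).toReal⁻¹ * ENNReal.ofReal (1 / a) *
      μ Set.univ ^ (1 / (1 : ENNReal).toReal - 1 / (2 : ENNReal).toReal))
    (by
      refine ENNReal.mul_ne_top (ENNReal.mul_ne_top ?_ ENNReal.ofReal_ne_top) ?_ <;>
      exact ENNReal.rpow_ne_top_of_nonneg (by norm_num) (measure_ne_top μ _))
    (fun f g => by
      filter_upwards [hmem] with p hp
      rw [Pi.add_apply, ← integral_add (hker f p hp) (hker g p hp)]
      refine integral_congr_ae ?_
      filter_upwards [Lp.coeFn_add f g] with q hq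
      rw [hq, Pi.add_apply, add_div])
    (fun c f => by
      filter_upwards with p
      rw [Pi.smul_apply, smul_eq_mul, ← integral_const_mul]
      refine integral_congr_ae ?_
      filter_upwards [Lp.coeFn_smul c f] with q hq
      rw [hq, Pi.smul_apply, smul_eq_mul, mul_div_assoc])
    (fun f => MemLp.of_bound (hmeas f) _ (hbound f))
    (fun f => by
      refine (eLpNorm_le_of_ae_bound (hbound f)).trans ?_
      rw [ENNReal.ofReal_mul (by positivity), ofReal_integral_norm_eq_lintegral_enorm (hf1 f),
        ← eLpNorm_one_eq_lintegral_enorm, ← mul_assoc, mul_assoc _ (μ Set.univ ^ (_ : ℝ)),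
        mul_comm (μ Set.univ ^ (_ : ℝ)) (eLpNorm f 2 μ)]
      gcongr
      exact eLpNorm_le_eLpNorm_mul_rpow_measure_univ one_le_two (Lp.aestronglyMeasurable f))
  -- Laplace transform: `1/(p+q) = ∫ e^{-pt} e^{-qt} dt` factors the form of `S` as `⟨Lf, Lg⟩`,
  -- which shows symmetry and nonnegativity together.
  let L : Lp ℝ 2 μ → ℝ → ℝ := fun f t => ∫ q, f q * Real.exp (-q * t) ∂μ
  have hLm : ∀ f, AEStronglyMeasurable (L f) ν := fun f =>
    (hlap f).1.prod_swap.integral_prod_right'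
  have hLb : ∀ f, ∀ᵐ t ∂ν, ‖L f t‖ ≤ ∫ q, ‖f q‖ ∂μ := by
    intro f
    filter_upwards [ae_restrict_mem measurableSet_Ioi] with t ht
    refine norm_integral_le_of_norm_le (hf1 f).norm ?_
    filter_upwards [hmem] with q hq
    rw [norm_mul, Real.norm_eq_abs (Real.exp _), Real.abs_exp]
    refine mul_le_of_le_one_right (norm_nonneg _) (Real.exp_le_one_iff.2 ?_)
    have : 0 ≤ q * t := mul_nonneg (ha.le.trans hq.1) (le_of_lt ht)
    linarith
  have hform : ∀ f g : Lp ℝ 2 μ, inner ℝ (S f) g = ∫ t, L f t * L g t ∂ν := by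
    intro f g
    have e1 : ∀ᵐ p ∂μ, inner ℝ (S f p) (g p) = ∫ t, L f t * (g p * Real.exp (-p * t)) ∂ν := by
      filter_upwards [hS f, hmem] with p hp hpI
      have hint : Integrable (Function.uncurry fun q t =>
          f q * Real.exp (-q * t) * (g p * Real.exp (-p * t))) (μ.prod ν) := by
        refine (hlap f).mul_bdd (c := |g p|) (by fun_prop) ?_
        filter_upwards [hmem2] with z hz
        rw [norm_mul, Real.norm_eq_abs (Real.exp _), Real.abs_exp]
        refine mul_le_of_le_one_right (norm_nonneg _) (Real.exp_le_one_iff.2 ?_)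
        have : 0 ≤ p * z.2 := mul_nonneg (ha.le.trans hpI.1) (le_of_lt hz.2)
        linarith
      have hsw := integral_integral_swap hint
      simp_rw [integral_mul_const] at hsw
      rw [hp, ← hsw, RCLike.inner_apply, conj_trivial, ← integral_const_mul]
      refine integral_congr_ae ?_
      filter_upwards [hmem] with q hq
      have h0 := integral_exp_neg_add_mul (p := q) (q := p) (by linarith [hpI.1, hq.1])
      have e2 : ∀ t, f q * Real.exp (-q * t) * (g p * Real.exp (-p * t)) =
          f q * g p * (Real.exp (-q * t) * Real.exp (-p * t)) := fun t => by ring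
      simp_rw [e2]
      rw [integral_const_mul, h0, add_comm q p]
      ring
    have hint2 : Integrable (Function.uncurry fun p t => L f t * (g p * Real.exp (-p * t)))
        (μ.prod ν) := by
      have := (hlap g).mul_bdd (hLm f).comp_snd (Measure.quasiMeasurePreserving_snd.ae (hLb f))
      refine this.congr (Eventually.of_forall fun z => ?_)
      simp [Function.uncurry, mul_comm]
    rw [L2.inner_def, integral_congr_ae e1, integral_integral_swap hint2]
    simp_rw [integral_const_mul]
    rfl
  refine ⟨S, fun f g => ?_, fun f => ?_, hS⟩
  · rw [hform, hform]
    simp_rw [mul_comm]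
  · rw [hform]
    exact integral_nonneg fun t => mul_self_nonneg _

/-! ### Exponentials of operators, coercivity and analyticity. -/

section Factorial

open scoped Nat

theorem hasSum_exp_apply {E : Type*} [NormedAddCommGroup E] [NormedSpace ℝ E] [CompleteSpace E]
    (X : E →L[ℝ] E) (v : E) :
    HasSum (fun n : ℕ => (n ! : ℝ)⁻¹ • (X ^ n) v) (NormedSpace.exp X v) := by
  have h := NormedSpace.exp_series_hasSum_exp' (𝕂 := ℝ) X
  simpa using (ContinuousLinearMap.apply ℝ E v).hasSum h

/-- An intertwiner passes through powers and hence through the exponential series. It serves for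
block components, for `σ` and for the reflection `J`. -/
theorem map_exp_apply_of_intertwine {E F : Type*} [NormedAddCommGroup E] [NormedSpace ℝ E]
    [CompleteSpace E] [NormedAddCommGroup F] [NormedSpace ℝ F] [CompleteSpace F]
    {X : E →L[ℝ] E} {Y : F →L[ℝ] F} {L : E →L[ℝ] F} (h : ∀ v, L (X v) = Y (L v)) (v : E) :
    L (NormedSpace.exp X v) = NormedSpace.exp Y (L v) := by
  have hn : ∀ (n : ℕ) (v : E), L ((X ^ n) v) = (Y ^ n) (L v) := by
    intro n
    induction n with
    | zero => simp
    | succ n ih =>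
      intro v
      rw [pow_succ, pow_succ, mul_apply_eq_comp, mul_apply_eq_comp, ih, h]
  refine (L.hasSum (hasSum_exp_apply X v)).unique ?_
  simp only [map_smul, hn]
  exact hasSum_exp_apply Y (L v)

theorem exists_mulOperator {α : Type*} [MeasurableSpace α] {μ : Measure α} {m : α → ℝ} {C : ℝ}
    (hm : AEStronglyMeasurable m μ) (hb : ∀ᵐ p ∂μ, |m p| ≤ C) :
    ∃ P : Lp ℝ 2 μ →L[ℝ] Lp ℝ 2 μ, ∀ f : Lp ℝ 2 μ, P f =ᵐ[μ] fun p => m p * f p := by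
  have hle : ∀ f : Lp ℝ 2 μ, ∀ᵐ p ∂μ, ‖m p * f p‖ ≤ C * ‖f p‖ := fun f => by
    filter_upwards [hb] with p hp
    rw [norm_mul]
    exact mul_le_mul_of_nonneg_right hp (norm_nonneg _)
  refine exists_clm_of_ae (μ := μ) (fun f p => m p * f p) (C := ENNReal.ofReal C)
    ENNReal.ofReal_ne_top (fun f g => ?_) (fun c f => ?_)
    (fun f => (Lp.memLp f).of_le_mul (hm.mul (Lp.aestronglyMeasurable f)) (hle f))
    (fun f => eLpNorm_le_mul_eLpNorm_of_ae_le_mul (hle f) 2)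
  · filter_upwards [Lp.coeFn_add f g] with p hp
    rw [hp, Pi.add_apply, Pi.add_apply, mul_add]
  · filter_upwards [Lp.coeFn_smul c f] with p hp
    rw [hp, Pi.smul_apply, Pi.smul_apply, smul_eq_mul, smul_eq_mul]
    ring

/-- The exponential series converges in `L²`, so a subsequence of partial sums converges almost
everywhere; the same partial sums converge pointwise to the scalar exponential. -/
theorem exp_mulOperator_apply {α : Type*} [MeasurableSpace α] {μ : Measure α} {m : α → ℝ}
    {P : Lp ℝ 2 μ →L[ℝ] Lp ℝ 2 μ} (hP : ∀ f : Lp ℝ 2 μ, P f =ᵐ[μ] fun p => m p * f p)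
    (x : ℝ) (f : Lp ℝ 2 μ) :
    NormedSpace.exp (x • P) f =ᵐ[μ] fun p => Real.exp (x * m p) * f p := by
  have hn : ∀ n : ℕ, ((x • P) ^ n) f =ᵐ[μ] fun p => (x * m p) ^ n * f p := by
    intro n
    induction n with
    | zero => simp
    | succ n ih =>
      have e : ((x • P) ^ (n + 1)) f = x • P (((x • P) ^ n) f) := by
        rw [pow_succ']
        simp
      rw [e]
      filter_upwards [ih, hP (((x • P) ^ n) f), Lp.coeFn_smul x (P (((x • P) ^ n) f))]
        with p h1 h2 h3
      rw [h3, Pi.smul_apply, h2, h1, smul_eq_mul, pow_succ]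
      ring
  have hsum := (hasSum_exp_apply (x • P) f).tendsto_sum_nat
  have hpart : ∀ N : ℕ, (∑ n ∈ Finset.range N, ((n ! : ℝ)⁻¹ • ((x • P) ^ n) f) : Lp ℝ 2 μ) =ᵐ[μ]
      fun p => (∑ n ∈ Finset.range N, (x * m p) ^ n / n !) * f p := by
    intro N
    induction N with
    | zero =>
      simp only [Finset.range_zero, Finset.sum_empty, zero_mul]
      exact Lp.coeFn_zero ℝ 2 μ
    | succ N ih =>
      rw [Finset.sum_range_succ]
      filter_upwards [Lp.coeFn_add (∑ n ∈ Finset.range N, ((n ! : ℝ)⁻¹ • ((x • P) ^ n) f))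
        ((N ! : ℝ)⁻¹ • ((x • P) ^ N) f), Lp.coeFn_smul (N ! : ℝ)⁻¹ (((x • P) ^ N) f), ih, hn N]
        with p h1 h2 h3 h4
      rw [h1, Pi.add_apply, h2, Pi.smul_apply, h3, h4, Finset.sum_range_succ, smul_eq_mul]
      ring
  obtain ⟨ns, hns, hlim⟩ := (tendstoInMeasure_of_tendsto_Lp hsum).exists_seq_tendsto_ae
  filter_upwards [hlim, ae_all_iff.2 hpart] with p h1 h2
  refine tendsto_nhds_unique h1 ?_
  simp_rw [h2]
  have h3 : HasSum (fun n : ℕ => (x * m p) ^ n / n !) (Real.exp (x * m p)) := by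
    rw [Real.exp_eq_exp_ℝ]
    exact NormedSpace.expSeries_div_hasSum_exp (x * m p)
  exact ((h3.tendsto_sum_nat.comp hns.tendsto_atTop)).mul_const _

section Abstract

variable {V : Type*} [NormedAddCommGroup V] [InnerProductSpace ℝ V] [CompleteSpace V]

theorem inner_exp_smul_comm {Q : V →L[ℝ] V} (hQ : ∀ v w, inner ℝ (Q v) w = inner ℝ v (Q w)) (x : ℝ)
    (v w : V) :
    inner ℝ (NormedSpace.exp (x • Q) v) w = inner ℝ v (NormedSpace.exp (x • Q) w) := by
  have h1 : ∀ (n : ℕ) (v w : V), inner ℝ (((x • Q) ^ n) v) w = inner ℝ v (((x • Q) ^ n) w) := by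
    intro n
    induction n with
    | zero => simp
    | succ n ih =>
      intro v w
      have hX : ∀ v w, inner ℝ ((x • Q) v) w = inner ℝ v ((x • Q) w) := fun v w => by
        simp [real_inner_smul_left, real_inner_smul_right, hQ]
      rw [pow_succ, mul_apply_eq_comp, ih, hX, ← mul_apply_eq_comp, ← pow_succ', pow_succ]
  have h2 := (innerSL ℝ w).hasSum (hasSum_exp_apply (x • Q) v)
  have h3 := (innerSL ℝ v).hasSum (hasSum_exp_apply (x • Q) w)
  rw [real_inner_comm]
  refine h2.unique (h3.congr_fun fun n => ?_)
  simp only [innerSL_apply_apply, real_inner_smul_right]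
  rw [real_inner_comm, h1]

/-- `exp(xQ)` is the square of the self-adjoint invertible `A = exp(xQ/2)`, so its form is `‖Av‖²`,
bounded below through the inverse of `A`; `T` only adds a nonnegative term. -/
theorem exists_coercive_exp_add {Q T : V →L[ℝ] V}
    (hQ : ∀ v w, inner ℝ (Q v) w = inner ℝ v (Q w)) (hT : ∀ v, 0 ≤ inner ℝ (T v) v) (x : ℝ) :
    ∃ C : ℝ, 0 < C ∧ ∀ v, C * ‖v‖ * ‖v‖ ≤ inner ℝ ((NormedSpace.exp (x • Q) + T) v) v := by
  let +nondep : NormedAlgebra ℚ (V →L[ℝ] V) := .restrictScalars ℚ ℝ _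
  set A := NormedSpace.exp ((x / 2) • Q)
  set A' := NormedSpace.exp (-((x / 2) • Q))
  have hAA : NormedSpace.exp (x • Q) = A * A := by
    rw [← NormedSpace.exp_add_of_commute (Commute.refl _), ← add_smul, add_halves]
  have hA'A : A' * A = 1 := by
    have h := NormedSpace.exp_add_of_commute (x := -((x / 2) • Q)) (y := (x / 2) • Q)
      (Commute.neg_left (Commute.refl _))
    rw [neg_add_cancel, NormedSpace.exp_zero] at h
    exact h.symm
  -- The `+ 1` keeps the constant meaningful when the space is trivial and `‖A'‖ = 0`.
  refine ⟨((‖A'‖ + 1) ^ 2)⁻¹, by positivity, fun v => ?_⟩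
  have h1 : ‖v‖ ≤ (‖A'‖ + 1) * ‖A v‖ := by
    have e : v = A' (A v) := by
      rw [← mul_apply_eq_comp, hA'A, one_apply_eq_self]
    calc ‖v‖ = ‖A' (A v)‖ := by rw [← e]
      _ ≤ ‖A'‖ * ‖A v‖ := A'.le_opNorm _
      _ ≤ _ := mul_le_mul_of_nonneg_right (by linarith) (norm_nonneg _)
  have h2 : inner ℝ (NormedSpace.exp (x • Q) v) v = ‖A v‖ ^ 2 := by
    rw [hAA, mul_apply_eq_comp, inner_exp_smul_comm hQ, real_inner_self_eq_norm_sq]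
  rw [add_apply, inner_add_left, h2]
  have h3 : ((‖A'‖ + 1) ^ 2)⁻¹ * ‖v‖ * ‖v‖ ≤ ‖A v‖ ^ 2 := by
    rw [mul_assoc, inv_mul_le_iff₀ (by positivity), ← sq, ← mul_pow]
    exact pow_le_pow_left₀ (norm_nonneg _) h1 2
  linarith [hT v]

/-- Lax–Milgram. -/
theorem isUnit_of_coercive {M : V →L[ℝ] V} {C : ℝ} (hC : 0 < C)
    (h : ∀ v, C * ‖v‖ * ‖v‖ ≤ inner ℝ (M v) v) : IsUnit M := by
  have hco : IsCoercive ((innerSL ℝ).comp M) := ⟨C, hC, fun v => by simpa using h v⟩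
  have e : M = hco.continuousLinearEquivOfBilin := by
    ext v
    refine ext_inner_right ℝ fun w => ?_
    simp
  rw [e]
  exact (ContinuousLinearEquiv.toUnit hco.continuousLinearEquivOfBilin).isUnit

theorem analyticAt_exp_smul_add (Q T : V →L[ℝ] V) (x : ℝ) :
    AnalyticAt ℝ (fun x : ℝ => NormedSpace.exp (x • Q) + T) x := by
  have h : AnalyticAt ℝ (fun x : ℝ => x • Q) x := analyticAt_id.smul analyticAt_const
  have h1 : AnalyticAt ℝ (NormedSpace.exp : (V →L[ℝ] V) → (V →L[ℝ] V)) (x • Q) :=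
    NormedSpace.exp_analytic (x • Q)
  exact (AnalyticAt.fun_comp (f := fun x : ℝ => x • Q) h1 h).add analyticAt_const

theorem analyticAt_inverse_apply {Q T : V →L[ℝ] V} {x : ℝ}
    (hu : IsUnit (NormedSpace.exp (x • Q) + T)) (b : V) :
    AnalyticAt ℝ (fun x : ℝ => Ring.inverse (NormedSpace.exp (x • Q) + T) b) x := by
  have h1 : AnalyticAt ℝ (fun x : ℝ => Ring.inverse (NormedSpace.exp (x • Q) + T)) x :=
    AnalyticAt.fun_comp (by exact analyticAt_inverse (𝕜 := ℝ) hu.unit) (analyticAt_exp_smul_add Q T x)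
  exact ((ContinuousLinearMap.apply ℝ V b).analyticAt _).fun_comp h1

theorem isBigO_exp_smul_sub (Q : V →L[ℝ] V) (n : ℕ) :
    (fun x : ℝ => NormedSpace.exp (x • Q) - ∑ k ∈ Finset.range n, ((x ^ k / k !) • Q ^ k))
      =O[𝓝 0] fun x => x ^ n := by
  have h := (NormedSpace.exp_hasFPowerSeriesAt_zero (𝕂 := ℝ) (𝔸 := V →L[ℝ] V)).isBigO_sub_partialSum_pow n
  have ht : Tendsto (fun x : ℝ => x • Q) (𝓝 0) (𝓝 0) :=
    (continuous_id.smul continuous_const).tendsto' _ _ (by simp)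
  have h2 := h.comp_tendsto ht
  refine (h2.trans ?_).congr_left fun x => ?_
  · refine Asymptotics.IsBigO.of_bound (‖Q‖ ^ n) (Eventually.of_forall fun x => ?_)
    simp [norm_smul, mul_pow, mul_comm]
  · simp only [Function.comp_apply, zero_add, FormalMultilinearSeries.partialSum,
      NormedSpace.expSeries_apply_eq, smul_pow, smul_smul]
    congr 1
    refine Finset.sum_congr rfl fun k _ => ?_
    congr 1
    rw [mul_comm, div_eq_mul_inv]

end Abstract

/-! ### Third-order expansion of the quadratic form, and the reflection symmetry. -/

theorem isBigO_inner {V : Type*} [NormedAddCommGroup V] [InnerProductSpace ℝ V]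
    {f g : ℝ → V} {u v : ℝ → ℝ} (hf : f =O[𝓝 0] u) (hg : g =O[𝓝 0] v) :
    (fun x => (inner ℝ (f x) (g x) : ℝ)) =O[𝓝 0] fun x => u x * v x := by
  refine Asymptotics.IsBigO.trans ?_ (hf.norm_left.mul hg.norm_left)
  exact Asymptotics.IsBigO.of_norm_le fun x => by
    simpa using norm_inner_le_norm (𝕜 := ℝ) (f x) (g x)

theorem isBigO_clm_apply {V : Type*} [NormedAddCommGroup V] [NormedSpace ℝ V]
    {A : ℝ → V →L[ℝ] V} {f : ℝ → V} {u v : ℝ → ℝ} (hA : A =O[𝓝 0] u)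
    (hf : f =O[𝓝 0] v) : (fun x => A x (f x)) =O[𝓝 0] fun x => u x * v x := by
  refine Asymptotics.IsBigO.trans ?_ (hA.norm_left.mul hf.norm_left)
  exact Asymptotics.IsBigO.of_norm_le fun x => by simpa using (A x).le_opNorm (f x)

theorem Ring.inverse_apply_self {V : Type*} [NormedAddCommGroup V] [NormedSpace ℝ V]
    {M : V →L[ℝ] V} (hM : IsUnit M) (v : V) :
    Ring.inverse M (M v) = v := by
  rw [← mul_apply_eq_comp, Ring.inverse_mul_cancel _ hM, one_apply_eq_self]

theorem Ring.apply_inverse_self {V : Type*} [NormedAddCommGroup V] [NormedSpace ℝ V]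
    {M : V →L[ℝ] V} (hM : IsUnit M) (v : V) :
    M (Ring.inverse M v) = v := by
  rw [← mul_apply_eq_comp, Ring.mul_inverse_cancel _ hM, one_apply_eq_self]

section Abstract

variable {V : Type*} [NormedAddCommGroup V] [InnerProductSpace ℝ V] [CompleteSpace V]

/-- Third order expansion of the quadratic form `⟨M(x)⁻¹ b, σ b⟩` for `M(x) = exp (x Q) + T`
symmetric with respect to the form `⟨v, σ w⟩`, from the first order expansion of `M(x)⁻¹ b`. -/
theorem isBigO_inner_inverse_exp_add {Q T σ : V →L[ℝ] V}
    (hQ : ∀ v w, inner ℝ (Q v) w = inner ℝ v (Q w))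
    (hσ : ∀ v w, inner ℝ (σ v) w = inner ℝ v (σ w)) (hσQ : ∀ v, σ (Q v) = Q (σ v))
    (hTσ : ∀ v w, inner ℝ (T v) (σ w) = inner ℝ (T w) (σ v))
    (hu : ∀ x : ℝ, IsUnit (NormedSpace.exp (x • Q) + T)) {b v₀ v₁ : V} (h₀ : v₀ + T v₀ = b)
    (h₁ : v₁ + T v₁ = -Q v₀) :
    (fun x : ℝ => inner ℝ (Ring.inverse (NormedSpace.exp (x • Q) + T) b) (σ b) -
      (inner ℝ v₀ (σ b) - x * inner ℝ (Q v₀) (σ v₀)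
        - x ^ 2 * (1 / 2 * inner ℝ (Q (Q v₀)) (σ v₀) + inner ℝ (Q v₀) (σ v₁))
        - x ^ 3 * (1 / 6 * inner ℝ (Q (Q (Q v₀))) (σ v₀) + inner ℝ (Q (Q v₀)) (σ v₁) +
            inner ℝ (Q v₁) (σ v₁)))) =O[𝓝 0] fun x => x ^ 4 := by
  let D : ℝ → V →L[ℝ] V := fun x => NormedSpace.exp (x • Q)
  let M : ℝ → V →L[ℝ] V := fun x => D x + T
  let R : ℕ → ℝ → V →L[ℝ] V := fun n x => D x - ∑ k ∈ Finset.range n, ((x ^ k / k !) • Q ^ k)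
  have hR : ∀ n, R n =O[𝓝 0] fun x => x ^ n := isBigO_exp_smul_sub Q
  let w : ℝ → V := fun x => v₀ + x • v₁
  let S : ℝ → V := fun x => Ring.inverse (M x) b
  have hMS : ∀ x, M x (S x) = b := fun x => Ring.apply_inverse_self (hu x) b
  have symm : ∀ v w, (inner ℝ v (σ w) : ℝ) = inner ℝ w (σ v) := fun v w => by
    rw [← hσ, real_inner_comm]
  have hDσ : ∀ x v, σ (D x v) = D x (σ v) := fun x v =>
    map_exp_apply_of_intertwine (fun v => by simp [hσQ]) v
  have hMσ : ∀ x v w, (inner ℝ (M x v) (σ w) : ℝ) = inner ℝ (M x w) (σ v) := by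
    intro x v w
    simp only [M, add_apply, inner_add_left, hTσ v w]
    rw [inner_exp_smul_comm hQ, ← hDσ, symm]
  have hQσ : ∀ v w, (inner ℝ (Q v) (σ w) : ℝ) = inner ℝ (Q w) (σ v) := fun v w => by
    rw [hQ, ← hσQ, symm]
  have hQQσ : ∀ v w, (inner ℝ (Q (Q v)) (σ w) : ℝ) = inner ℝ (Q (Q w)) (σ v) := fun v w => by
    rw [hQ, hQ, ← hσQ, ← hσQ, symm]
  -- Stationarity: since `M x` is symmetric for the form, replacing the exact solution `S x` by the
  -- trial vector `w x` costs only a term quadratic in the error.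
  have hid : ∀ x, (inner ℝ (S x) (σ b) : ℝ) = (2 * inner ℝ (w x) (σ b) -
      inner ℝ (M x (w x)) (σ (w x))) + inner ℝ (M x (S x - w x)) (σ (S x - w x)) := by
    intro x
    simp only [map_sub, inner_sub_left, inner_sub_right, hMσ x (w x) (S x), hMS]
    rw [symm (S x) b, symm (w x) b]
    ring
  have hwb : ∀ x, w x + T (w x) = b - x • Q v₀ := by
    intro x
    simp only [w, map_add, map_smul, ← h₀]
    rw [add_add_add_comm, ← smul_add, h₁, smul_neg, ← sub_eq_add_neg]
  -- The equations for `v₀` and `v₁` cancel orders `0` and `1` of the residual, so the residual and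
  -- the error are `O(x²)` and the quadratic term in `hid` is `O(x⁴)`.
  have hres : ∀ x, M x (S x - w x) = -(R 2 x v₀ + x • R 1 x v₁) := by
    intro x
    have e1 : M x (w x) = b + (R 2 x v₀ + x • R 1 x v₁) := by
      have e2 : M x (w x) = D x (w x) + T (w x) := rfl
      have e3 : D x (w x) = R 2 x v₀ + x • R 1 x v₁ + x • Q v₀ + w x := by
        simp only [R, w, Finset.sum_range_succ, Finset.sum_range_zero, map_add, map_smul]
        simp
        module
      rw [e2, e3, add_assoc, hwb]
      abel
    rw [map_sub, hMS, e1]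
    abel
  have hconst : ∀ v : V, (fun _ : ℝ => v) =O[𝓝 0] fun _ => (1 : ℝ) := fun v =>
    Asymptotics.isBigO_const_const v one_ne_zero _
  have hresO : (fun x => M x (S x - w x)) =O[𝓝 0] fun x : ℝ => x ^ 2 := by
    simp_rw [hres]
    have o1 := isBigO_clm_apply (hR 2) (hconst v₀)
    have o2 := (Asymptotics.isBigO_refl (fun x : ℝ => x) (𝓝 0)).smul
      (isBigO_clm_apply (hR 1) (hconst v₁))
    simp only [mul_one, pow_one, smul_eq_mul, ← sq] at o1 o2
    exact (o1.add o2).neg_left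
  have herrO : (fun x => S x - w x) =O[𝓝 0] fun x : ℝ => x ^ 2 := by
    have hc : ContinuousAt (fun x => Ring.inverse (M x)) 0 :=
      ContinuousAt.comp (g := Ring.inverse) (f := M)
        (NormedRing.inverse_continuousAt (hu 0).unit) (analyticAt_exp_smul_add Q T 0).continuousAt
    have o1 := isBigO_clm_apply (hc.norm.isBoundedUnder_le.isBigO_one ℝ) hresO
    simpa only [Ring.inverse_apply_self (hu _), one_mul, M, D] using o1
  have hwO : w =O[𝓝 0] fun _ => (1 : ℝ) := by
    have hc : ContinuousAt w 0 := by fun_prop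
    exact hc.norm.isBoundedUnder_le.isBigO_one ℝ
  have hσO : ∀ {f : ℝ → V} {u : ℝ → ℝ}, f =O[𝓝 0] u → (fun x => σ (f x)) =O[𝓝 0] u :=
    fun h => (σ.isBigO_comp _ _).trans h
  have hb0 : (inner ℝ b (σ v₀) : ℝ) = inner ℝ v₀ (σ b) := symm _ _
  have hb1' : (inner ℝ b (σ v₁) : ℝ) = inner ℝ v₁ (σ b) := symm _ _
  have hb1 : (inner ℝ v₁ (σ b) : ℝ) = -inner ℝ (Q v₀) (σ v₀) := by
    rw [← h₀, map_add, inner_add_right, symm v₁ (T v₀), hTσ, ← inner_add_left, h₁, inner_neg_left]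
  -- Evaluation of the functional at the trial vector with `exp(xQ)` expanded to third order; the
  -- remainder of order four is kept as `R 4`.
  have hB : ∀ x : ℝ, 2 * inner ℝ (w x) (σ b) - inner ℝ (M x (w x)) (σ (w x)) =
      (inner ℝ v₀ (σ b) - x * inner ℝ (Q v₀) (σ v₀)
        - x ^ 2 * (1 / 2 * inner ℝ (Q (Q v₀)) (σ v₀) + inner ℝ (Q v₀) (σ v₁))
        - x ^ 3 * (1 / 6 * inner ℝ (Q (Q (Q v₀))) (σ v₀) + inner ℝ (Q (Q v₀)) (σ v₁) +
            inner ℝ (Q v₁) (σ v₁))) -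
      x ^ 4 * (1 / 2 * inner ℝ (Q (Q v₁)) (σ v₁) + 1 / 6 * inner ℝ (Q (Q (Q v₀))) (σ v₁) +
        1 / 6 * inner ℝ (Q (Q (Q v₁))) (σ v₀) + x * (1 / 6 * inner ℝ (Q (Q (Q v₁))) (σ v₁))) -
      inner ℝ (R 4 x (w x)) (σ (w x)) := by
    intro x
    have e2 : M x (w x) = D x (w x) + T (w x) := rfl
    have e3 : D x (w x) = R 4 x (w x) + w x + x • Q (w x) + (x ^ 2 / 2) • Q (Q (w x)) +
        (x ^ 3 / 6) • Q (Q (Q (w x))) := by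
      simp only [R, Finset.sum_range_succ, Finset.sum_range_zero]
      simp [Nat.factorial, pow_succ]
      abel
    have e4 : M x (w x) = R 4 x (w x) + (b + x ^ 2 • Q v₁ + (x ^ 2 / 2) • Q (Q (w x)) +
        (x ^ 3 / 6) • Q (Q (Q (w x)))) := by
      have e5 : Q (w x) = Q v₀ + x • Q v₁ := by simp [w]
      have e6 : T (w x) = b - x • Q v₀ - w x := by rw [← hwb]; abel
      rw [e2, e3, e6, e5]
      module
    rw [e4, inner_add_left (R 4 x (w x))]
    simp only [w, map_add, map_smul, inner_add_left, inner_add_right, real_inner_smul_left,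
      real_inner_smul_right]
    rw [hb0, hb1', hb1, hQσ v₁ v₀, hQQσ v₁ v₀]
    ring
  have hfin : ∀ x : ℝ, inner ℝ (Ring.inverse (NormedSpace.exp (x • Q) + T) b) (σ b) -
      (inner ℝ v₀ (σ b) - x * inner ℝ (Q v₀) (σ v₀)
        - x ^ 2 * (1 / 2 * inner ℝ (Q (Q v₀)) (σ v₀) + inner ℝ (Q v₀) (σ v₁))
        - x ^ 3 * (1 / 6 * inner ℝ (Q (Q (Q v₀))) (σ v₀) + inner ℝ (Q (Q v₀)) (σ v₁) +
            inner ℝ (Q v₁) (σ v₁))) =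
      inner ℝ (M x (S x - w x)) (σ (S x - w x)) -
      x ^ 4 * (1 / 2 * inner ℝ (Q (Q v₁)) (σ v₁) + 1 / 6 * inner ℝ (Q (Q (Q v₀))) (σ v₁) +
        1 / 6 * inner ℝ (Q (Q (Q v₁))) (σ v₀) + x * (1 / 6 * inner ℝ (Q (Q (Q v₁))) (σ v₁))) -
      inner ℝ (R 4 x (w x)) (σ (w x)) := by
    intro x
    have h1 := hid x
    have h2 := hB x
    simp only [S, M, D] at h1 h2 ⊢
    linarith
  simp_rw [hfin]
  refine Asymptotics.IsBigO.sub (Asymptotics.IsBigO.sub ?_ ?_) ?_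
  · simpa only [← pow_add] using isBigO_inner hresO (hσO herrO)
  · have hc : ContinuousAt (fun x : ℝ => 1 / 2 * inner ℝ (Q (Q v₁)) (σ v₁) +
        1 / 6 * inner ℝ (Q (Q (Q v₀))) (σ v₁) + 1 / 6 * inner ℝ (Q (Q (Q v₁))) (σ v₀) +
        x * (1 / 6 * inner ℝ (Q (Q (Q v₁))) (σ v₁))) 0 := by fun_prop
    simpa using (Asymptotics.isBigO_refl (fun x : ℝ => x ^ 4) (𝓝 0)).mul
      (hc.norm.isBoundedUnder_le.isBigO_one ℝ)
  · simpa using isBigO_inner (isBigO_clm_apply (hR 4) hwO) (hσO hwO)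

/-- `J` intertwines `exp(xQ) + T` with `exp(-xQ) + T` and fixes `b`, so it carries the solution at
`x` to the solution at `-x`. -/
theorem inverse_exp_add_neg {Q T J : V →L[ℝ] V} {b : V} (hJb : J b = b)
    (hJT : ∀ v, J (T v) = T (J v)) (hJQ : ∀ v, J (Q v) = -Q (J v))
    (hu : ∀ x : ℝ, IsUnit (NormedSpace.exp (x • Q) + T)) (x : ℝ) :
    Ring.inverse (NormedSpace.exp ((-x) • Q) + T) b =
      J (Ring.inverse (NormedSpace.exp (x • Q) + T) b) := by
  set v := Ring.inverse (NormedSpace.exp (x • Q) + T) b with hv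
  have h1 : (NormedSpace.exp ((-x) • Q) + T) (J v) = b := by
    have h2 := Ring.apply_inverse_self (hu x) b
    rw [← hv, add_apply] at h2
    rw [add_apply, ← map_exp_apply_of_intertwine (X := x • Q) (L := J) (fun v => by simp [hJQ]),
      ← hJT, ← map_add, h2, hJb]
  rw [← h1, Ring.inverse_apply_self (hu (-x))]

end Abstract

/-! ### Differentiation of asymptotic expansions of analytic functions. -/

/-- If the order of vanishing were `m < n`, the cofactor of `x^m` would be nonzero at `0` and yet
`O(x^(n-m))`. -/
theorem exists_analyticAt_eq_pow_mul_of_isBigO {g : ℝ → ℝ} (hg : AnalyticAt ℝ g 0) {n : ℕ}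
    (h : g =O[𝓝 0] fun x => x ^ n) :
    ∃ k : ℝ → ℝ, AnalyticAt ℝ k 0 ∧ ∀ᶠ x in 𝓝 0, g x = x ^ n * k x := by
  suffices hle : (n : ℕ∞) ≤ analyticOrderAt g 0 by
    obtain ⟨k, hk, hk'⟩ := (natCast_le_analyticOrderAt hg).1 hle
    exact ⟨k, hk, by simpa using hk'⟩
  by_contra! hlt
  obtain ⟨m, hm⟩ := ENat.ne_top_iff_exists.1 hlt.ne_top
  rw [← hm] at hlt
  have hmn : m < n := by exact_mod_cast hlt
  obtain ⟨k, hk, hk0, hk'⟩ := (hg.analyticOrderAt_eq_natCast).1 hm.symm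
  refine hk0 (tendsto_nhds_unique (hk.continuousAt.tendsto.mono_left
    (nhdsWithin_le_nhds (s := {0}ᶜ))) ?_)
  have h2 : k =O[𝓝[≠] 0] fun x => x ^ (n - m) := by
    have h3 := (h.mono (nhdsWithin_le_nhds (s := {0}ᶜ))).mul
      (Asymptotics.isBigO_refl (fun x : ℝ => (x ^ m)⁻¹) (𝓝[≠] 0))
    have hne : ∀ᶠ x : ℝ in 𝓝[≠] 0, x ≠ 0 := self_mem_nhdsWithin
    refine (h3.congr' ?_ ?_)
    · filter_upwards [hk'.filter_mono nhdsWithin_le_nhds, hne] with x hx hx0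
      rw [hx, sub_zero, smul_eq_mul, mul_comm, inv_mul_cancel_left₀ (pow_ne_zero _ hx0)]
    · filter_upwards [hne] with x hx0
      rw [pow_sub₀ x hx0 hmn.le]
  refine h2.trans_tendsto ?_
  have : Tendsto (fun x : ℝ => x ^ (n - m)) (𝓝 0) (𝓝 (0 ^ (n - m))) := (continuous_pow _).tendsto 0
  rw [zero_pow (Nat.sub_ne_zero_of_lt hmn)] at this
  exact this.mono_left nhdsWithin_le_nhds

/-- The remainder is `x⁴ k(x)` with `k` analytic; oddness forces `k 0 = 0`, so the remainder is
really `O(x⁵)` and differentiation loses nothing from the stated order. -/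
theorem deriv_isBigO_of_odd_of_isBigO {f : ℝ → ℝ} {c d : ℝ} (hf : AnalyticAt ℝ f 0)
    (hodd : ∀ x, f (-x) = -f x)
    (h : (fun x => f x - (c * x + d * x ^ 3)) =O[𝓝 0] fun x => x ^ 4) :
    (fun x => deriv f x - (c + 3 * d * x ^ 2)) =O[𝓝 0] fun x => x ^ 4 := by
  have hg : AnalyticAt ℝ (fun x => f x - (c * x + d * x ^ 3)) 0 := by
    refine hf.sub ?_
    fun_prop
  obtain ⟨k, hk, hk'⟩ := exists_analyticAt_eq_pow_mul_of_isBigO hg h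
  have hneg : Tendsto (fun x : ℝ => -x) (𝓝 0) (𝓝 0) := continuous_neg.tendsto' 0 0 neg_zero
  have hne : ∀ᶠ x : ℝ in 𝓝[≠] 0, x ≠ 0 := self_mem_nhdsWithin
  have hk0 : k 0 = 0 := by
    have h1 : Tendsto (fun x => k (-x)) (𝓝[≠] 0) (𝓝 (k 0)) :=
      (hk.continuousAt.tendsto.comp hneg).mono_left nhdsWithin_le_nhds
    have h2 : Tendsto (fun x => -k x) (𝓝[≠] 0) (𝓝 (-k 0)) :=
      hk.continuousAt.tendsto.neg.mono_left nhdsWithin_le_nhds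
    have h3 := tendsto_nhds_unique (h1.congr' ?_) h2
    · linarith
    · filter_upwards [hk'.filter_mono nhdsWithin_le_nhds,
        (hneg.eventually hk').filter_mono nhdsWithin_le_nhds, hne] with x h4 h5 h6
      rw [hodd] at h5
      have h7 : x ^ 4 * k (-x) = x ^ 4 * -k x := by linear_combination -h4 - h5
      exact mul_left_cancel₀ (pow_ne_zero _ h6) h7
  have hkO : k =O[𝓝 0] fun x => x := by
    simpa [hk0] using hk.differentiableAt.isBigO_sub
  have hk1 : deriv k =O[𝓝 0] fun _ => (1 : ℝ) := hk.deriv.continuousAt.norm.isBoundedUnder_le.isBigO_one ℝ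
  have e : (fun x => deriv f x - (c + 3 * d * x ^ 2)) =ᶠ[𝓝 0]
      fun x => 4 * (x ^ 3 * k x) + x ^ 4 * deriv k x := by
    filter_upwards [hk'.eventually_nhds, hf.eventually_analyticAt, hk.eventually_analyticAt]
      with x h1 h2 h3
    have d1 : HasDerivAt (fun x => f x - (c * x + d * x ^ 3)) (deriv f x - (c + 3 * d * x ^ 2)) x := by
      refine h2.differentiableAt.hasDerivAt.sub ?_
      refine (((hasDerivAt_id x).const_mul c).add ((hasDerivAt_pow 3 x).const_mul d)).congr_deriv ?_
      simp
      ring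
    have d2 := ((hasDerivAt_pow 4 x).mul h3.differentiableAt.hasDerivAt)
    rw [d1.unique (d2.congr_of_eventuallyEq h1)]
    simp
    ring
  refine Asymptotics.IsBigO.congr' ?_ e.symm .rfl
  refine Asymptotics.IsBigO.add ?_ ?_
  · refine Asymptotics.IsBigO.const_mul_left ?_ 4
    refine ((Asymptotics.isBigO_refl (fun x : ℝ => x ^ 3) (𝓝 0)).mul hkO).congr_right fun x => ?_
    ring
  · simpa using (Asymptotics.isBigO_refl (fun x : ℝ => x ^ 4) (𝓝 0)).mul hk1

end Factorial

/-! ### The power weight and its Cauchy integral. -/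

/-- The weight `((t - a) / (b - t)) ^ γ` on the interval `(a, b)`. -/
noncomputable def jacobiWeight (a b γ t : ℝ) : ℝ := ((t - a) / (b - t)) ^ γ

theorem measurable_jacobiWeight (a b γ : ℝ) : Measurable (jacobiWeight a b γ) := by
  unfold jacobiWeight
  fun_prop

theorem jacobiWeight_pos {a b γ t : ℝ} (ht : t ∈ Set.Ioo a b) : 0 < jacobiWeight a b γ t :=
  Real.rpow_pos_of_pos (div_pos (sub_pos.2 ht.1) (sub_pos.2 ht.2)) _

theorem jacobiWeight_add {a b t : ℝ} (ht : t ∈ Set.Ioo a b) (γ δ : ℝ) :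
    jacobiWeight a b (γ + δ) t = jacobiWeight a b γ t * jacobiWeight a b δ t :=
  Real.rpow_add (div_pos (sub_pos.2 ht.1) (sub_pos.2 ht.2)) _ _

theorem jacobiWeight_eq {a b t : ℝ} (ht : t ∈ Set.Ioo a b) (γ : ℝ) :
    jacobiWeight a b γ t = (t - a) ^ γ * (b - t) ^ (-γ) := by
  rw [jacobiWeight, Real.div_rpow (sub_pos.2 ht.1).le (sub_pos.2 ht.2).le,
    Real.rpow_neg (sub_pos.2 ht.2).le, div_eq_mul_inv]

theorem integrableOn_sub_rpow_Ioo (a b : ℝ) {r : ℝ} (hr : -1 < r) :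
    IntegrableOn (fun t : ℝ => (t - a) ^ r) (Set.Ioo a b) := by
  rcases le_or_gt a b with hab | hab
  · have h := (intervalIntegral.intervalIntegrable_rpow' hr (a := 0) (b := b - a)).comp_sub_right a
    simp only [zero_add, sub_add_cancel] at h
    exact (intervalIntegrable_iff_integrableOn_Ioo_of_le hab).1 h
  · simp [Set.Ioo_eq_empty hab.not_gt]

theorem integrableOn_rpow_sub_Ioo (a b : ℝ) {r : ℝ} (hr : -1 < r) :
    IntegrableOn (fun t : ℝ => (b - t) ^ r) (Set.Ioo a b) := by
  rcases le_or_gt a b with hab | hab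
  · have h := (intervalIntegral.intervalIntegrable_rpow' hr (a := 0) (b := b - a)).comp_sub_left b
    simp only [sub_zero, sub_sub_cancel] at h
    exact (intervalIntegrable_iff_integrableOn_Ioo_of_le hab).1 h.symm
  · simp [Set.Ioo_eq_empty hab.not_gt]

theorem integrableOn_jacobiWeight (a b : ℝ) {γ : ℝ} (h1 : -1 < γ) (h2 : γ < 1) :
    IntegrableOn (jacobiWeight a b γ) (Set.Ioo a b) := by
  rcases le_or_gt 0 γ with h0 | h0
  · refine ((integrableOn_rpow_sub_Ioo a b (r := -γ) (by linarith)).const_mul ((b - a) ^ γ)).mono'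
      (measurable_jacobiWeight a b γ).aestronglyMeasurable ?_
    filter_upwards [ae_restrict_mem measurableSet_Ioo] with t ht
    rw [Real.norm_eq_abs, abs_of_pos (jacobiWeight_pos ht), jacobiWeight_eq ht]
    refine mul_le_mul_of_nonneg_right ?_ (Real.rpow_nonneg (sub_pos.2 ht.2).le _)
    exact Real.rpow_le_rpow (sub_pos.2 ht.1).le (by linarith [ht.2]) h0
  · refine ((integrableOn_sub_rpow_Ioo a b (r := γ) h1).mul_const ((b - a) ^ (-γ))).mono'
      (measurable_jacobiWeight a b γ).aestronglyMeasurable ?_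
    filter_upwards [ae_restrict_mem measurableSet_Ioo] with t ht
    rw [Real.norm_eq_abs, abs_of_pos (jacobiWeight_pos ht), jacobiWeight_eq ht]
    refine mul_le_mul_of_nonneg_left ?_ (Real.rpow_nonneg (sub_pos.2 ht.1).le _)
    exact Real.rpow_le_rpow (sub_pos.2 ht.2).le (by linarith [ht.1]) (by linarith)

/-- After scaling to `(0, 1)` this is the Beta integral `B(1 + γ, 1 - γ)`, evaluated by the
reflection formula for the Gamma function. -/
theorem integral_jacobiWeight {a b γ : ℝ} (hab : a < b) (h1 : -1 < γ) (h2 : γ < 1) (h0 : γ ≠ 0) :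
    ∫ t in Set.Ioo a b, jacobiWeight a b γ t =
      (b - a) * (γ * (Real.pi / Real.sin (Real.pi * γ))) := by
  have hb : ∫ x in (0 : ℝ)..1, x ^ γ * (1 - x) ^ (-γ) = γ * (Real.pi / Real.sin (Real.pi * γ)) := by
    have e1 := ProbabilityTheory.beta_eq_betaIntegralReal (1 + γ) (1 - γ) (by linarith)
      (by linarith)
    have e2 : Complex.betaIntegral (1 + γ : ℝ) (1 - γ : ℝ) =
        ((∫ x in (0 : ℝ)..1, x ^ γ * (1 - x) ^ (-γ) : ℝ) : ℂ) := by
      rw [Complex.betaIntegral, ← intervalIntegral.integral_ofReal]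
      refine intervalIntegral.integral_congr fun x hx => ?_
      rw [Set.uIcc_of_le zero_le_one] at hx
      push_cast
      rw [Complex.ofReal_cpow hx.1, Complex.ofReal_cpow (by linarith [hx.2])]
      push_cast
      congr 2 <;> ring
    rw [e2, Complex.ofReal_re, ProbabilityTheory.beta, add_comm 1 γ, Real.Gamma_add_one h0,
      show γ + 1 + (1 - γ) = 2 by ring, Real.Gamma_two, div_one, mul_assoc,
      Real.Gamma_mul_Gamma_one_sub] at e1
    exact e1.symm
  rw [← integral_Ioc_eq_integral_Ioo, ← intervalIntegral.integral_of_le hab.le]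
  have hs := intervalIntegral.smul_integral_comp_mul_add (jacobiWeight a b γ) (b - a) a
    (a := 0) (b := 1)
  rw [show (b - a) * 0 + a = a by ring, show (b - a) * 1 + a = b by ring] at hs
  rw [← hs, ← hb, smul_eq_mul]
  congr 1
  refine intervalIntegral.integral_congr_ae ?_
  filter_upwards [ae_ne 1] with x hx1 hx
  rw [Set.uIoc_of_le zero_le_one] at hx
  have hx' : x < 1 := lt_of_le_of_ne hx.2 hx1
  have hpos : 0 < b - a := sub_pos.2 hab
  rw [jacobiWeight, Real.rpow_neg (by linarith), ← div_eq_mul_inv,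
    ← Real.div_rpow hx.1.le (by linarith)]
  congr 1
  have : 1 - x ≠ 0 := by linarith
  have h3 : b - ((b - a) * x + a) = (b - a) * (1 - x) := by ring
  rw [h3, add_sub_cancel_right, mul_div_mul_left _ _ hpos.ne']

theorem integrable_jacobiWeight_smul {E : Type*} [NormedAddCommGroup E] [NormedSpace ℝ E]
    {a b γ : ℝ} (h1 : -1 < γ) (h2 : γ < 1) {φ : ℝ → E} (hφ : Continuous φ) :
    IntegrableOn (fun t => jacobiWeight a b γ t • φ t) (Set.Ioo a b) := by
  obtain ⟨C, hC⟩ := (isCompact_Icc (a := a) (b := b)).exists_bound_of_continuousOn hφ.continuousOn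
  refine (integrableOn_jacobiWeight a b h1 h2).smul_bdd C hφ.aestronglyMeasurable ?_
  filter_upwards [ae_restrict_mem measurableSet_Ioo] with t ht
  exact hC t (Set.Ioo_subset_Icc_self ht)

/-- The integrand is the derivative of `(t - a)^(1+γ) (b - t)^(1-γ) φ(t)`, which vanishes at both
ends. Taking `φ = 1` gives the first moment, and `φ = 1/(t - z)` the differential equation of the
Cauchy integral. -/
theorem integral_jacobiWeight_deriv {E : Type*} [NormedAddCommGroup E] [NormedSpace ℝ E]
    [CompleteSpace E] {a b γ : ℝ} (hab : a ≤ b) (h1 : -1 < γ) (h2 : γ < 1) {φ φ' : ℝ → E}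
    (hφ : ∀ t, HasDerivAt φ (φ' t) t) (hφ' : Continuous φ') :
    ∫ t in Set.Ioo a b, jacobiWeight a b γ t •
      ((γ * (b - a) + a + b - 2 * t) • φ t + ((t - a) * (b - t)) • φ' t) = 0 := by
  have hc : Continuous φ := continuous_iff_continuousAt.2 fun t => (hφ t).continuousAt
  have hint := integrable_jacobiWeight_smul (a := a) (b := b) h1 h2
    (φ := fun t => (γ * (b - a) + a + b - 2 * t) • φ t + ((t - a) * (b - t)) • φ' t) (by fun_prop)
  rw [← integral_Ioc_eq_integral_Ioo, ← intervalIntegral.integral_of_le hab]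
  rw [intervalIntegral.integral_eq_sub_of_hasDerivAt_of_le
    (f := fun t => ((t - a) ^ (1 + γ) * (b - t) ^ (1 - γ)) • φ t) hab ?_ ?_
    ((intervalIntegrable_iff_integrableOn_Ioo_of_le hab).2 hint)]
  · rw [sub_self, sub_self, Real.zero_rpow (by linarith), Real.zero_rpow (by linarith)]
    simp
  · refine Continuous.continuousOn ?_
    refine (Continuous.mul ?_ ?_).smul hc
    · exact (continuous_id.sub continuous_const).rpow_const fun t => Or.inr (by linarith)
    · exact (continuous_const.sub continuous_id).rpow_const fun t => Or.inr (by linarith)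
  · intro t ht
    have p1 : 0 < t - a := sub_pos.2 ht.1
    have p2 : 0 < b - t := sub_pos.2 ht.2
    have d1 : HasDerivAt (fun t => (t - a) ^ (1 + γ)) ((1 + γ) * (t - a) ^ γ) t := by
      refine (((hasDerivAt_id t).sub_const a).rpow_const (Or.inl p1.ne')).congr_deriv ?_
      simp
    have d2 : HasDerivAt (fun t => (b - t) ^ (1 - γ)) (-((1 - γ) * (b - t) ^ (-γ))) t := by
      refine (((hasDerivAt_id t).const_sub b).rpow_const (Or.inl p2.ne')).congr_deriv ?_
      simp
      ring
    refine ((d1.mul d2).smul (hφ t)).congr_deriv ?_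
    have e1 : (t - a) ^ (1 + γ) = (t - a) * (t - a) ^ γ := by rw [Real.rpow_add p1, Real.rpow_one]
    have e2 : (b - t) ^ (1 - γ) = (b - t) * (b - t) ^ (-γ) := by
      rw [sub_eq_add_neg 1 γ, Real.rpow_add p2, Real.rpow_one]
    simp only [Pi.mul_apply]
    rw [jacobiWeight_eq ht, e1, e2]
    module

theorem integral_mul_jacobiWeight {a b γ : ℝ} (hab : a ≤ b) (h1 : -1 < γ) (h2 : γ < 1) :
    ∫ t in Set.Ioo a b, t * jacobiWeight a b γ t =
      (γ * (b - a) + a + b) / 2 * ∫ t in Set.Ioo a b, jacobiWeight a b γ t := by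
  have h := integral_jacobiWeight_deriv hab h1 h2 (φ := fun _ => (1 : ℝ)) (φ' := fun _ => 0)
    (fun t => hasDerivAt_const t 1) continuous_const
  have i1 := integrableOn_jacobiWeight a b h1 h2
  have i2 := integrable_jacobiWeight_smul (a := a) (b := b) h1 h2 (φ := fun t => t) continuous_id
  have e : ∀ t, jacobiWeight a b γ t • ((γ * (b - a) + a + b - 2 * t) • (1 : ℝ) +
      ((t - a) * (b - t)) • (0 : ℝ)) = (γ * (b - a) + a + b) * jacobiWeight a b γ t -
      2 * (jacobiWeight a b γ t • t) := by
    intro t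
    simp only [smul_eq_mul]
    ring
  simp_rw [e] at h
  rw [integral_sub (i1.const_mul _) (i2.const_mul _), integral_const_mul, integral_const_mul] at h
  simp_rw [smul_eq_mul, mul_comm (jacobiWeight a b γ _)] at h
  linarith

theorem ofReal_sub_ne_zero_of_im_pos {z : ℂ} (hz : 0 < z.im) (t : ℝ) : (t : ℂ) - z ≠ 0 := by
  intro h
  have := congrArg Complex.im h
  simp at this
  exact hz.ne' this

theorem im_le_norm_ofReal_sub {z : ℂ} (hz : 0 < z.im) (t : ℝ) : z.im ≤ ‖(t : ℂ) - z‖ := by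
  have := Complex.abs_im_le_norm ((t : ℂ) - z)
  simp only [Complex.sub_im, Complex.ofReal_im, zero_sub, abs_neg] at this
  rwa [abs_of_pos hz] at this

/-- The Cauchy integral of the weight `((t - a) / (b - t)) ^ γ`. -/
noncomputable def jacobiCauchy (a b γ : ℝ) (z : ℂ) : ℂ :=
  ∫ t in Set.Ioo a b, jacobiWeight a b γ t • ((t : ℂ) - z)⁻¹

theorem continuous_ofReal_sub_inv {z : ℂ} (hz : 0 < z.im) :
    Continuous fun t : ℝ => ((t : ℂ) - z)⁻¹ :=
  (Complex.continuous_ofReal.sub continuous_const).inv₀ (ofReal_sub_ne_zero_of_im_pos hz)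

theorem hasDerivAt_jacobiCauchy {a b γ : ℝ} (h1 : -1 < γ) (h2 : γ < 1) {z : ℂ} (hz : 0 < z.im) :
    HasDerivAt (jacobiCauchy a b γ)
      (∫ t in Set.Ioo a b, jacobiWeight a b γ t • (((t : ℂ) - z)⁻¹) ^ 2) z := by
  have hs : {w : ℂ | z.im / 2 < w.im} ∈ 𝓝 z :=
    (isOpen_lt continuous_const Complex.continuous_im).mem_nhds (by simp; linarith)
  have hpos : ∀ w ∈ {w : ℂ | z.im / 2 < w.im}, 0 < w.im := fun w hw => by
    have : z.im / 2 < w.im := hw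
    linarith
  refine (hasDerivAt_integral_of_dominated_loc_of_deriv_le
    (F := fun z t => jacobiWeight a b γ t • ((t : ℂ) - z)⁻¹)
    (F' := fun z t => jacobiWeight a b γ t • (((t : ℂ) - z)⁻¹) ^ 2)
    (bound := fun t => jacobiWeight a b γ t * ((z.im / 2)⁻¹) ^ 2) hs ?_ ?_ ?_ ?_ ?_ ?_).2
  · filter_upwards [hs] with w hw
    exact (integrable_jacobiWeight_smul h1 h2 (continuous_ofReal_sub_inv (hpos w hw))).1
  · exact integrable_jacobiWeight_smul h1 h2 (continuous_ofReal_sub_inv hz)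
  · exact (integrable_jacobiWeight_smul h1 h2 ((continuous_ofReal_sub_inv hz).pow 2)).1
  · filter_upwards [ae_restrict_mem measurableSet_Ioo] with t ht w hw
    have hw' : z.im / 2 < w.im := hw
    rw [norm_smul, Real.norm_eq_abs, abs_of_pos (jacobiWeight_pos ht), norm_pow, norm_inv]
    refine mul_le_mul_of_nonneg_left ?_ (jacobiWeight_pos ht).le
    refine pow_le_pow_left₀ (by positivity) ?_ 2
    exact inv_anti₀ (by linarith) (hw'.le.trans (im_le_norm_ofReal_sub (hpos w hw) t))
  · exact (integrableOn_jacobiWeight a b h1 h2).mul_const _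
  · filter_upwards with t w hw
    have hd := ((hasDerivAt_id w).const_sub (t : ℂ)).inv
      (ofReal_sub_ne_zero_of_im_pos (hpos w hw) t)
    refine (hd.const_smul (jacobiWeight a b γ t)).congr_deriv ?_
    simp

theorem jacobiCauchy_ode {a b γ : ℝ} (hab : a ≤ b) (h1 : -1 < γ) (h2 : γ < 1) {z : ℂ}
    (hz : 0 < z.im) :
    (z - a) * (b - z) * ∫ t in Set.Ioo a b, jacobiWeight a b γ t • (((t : ℂ) - z)⁻¹) ^ 2 =
      γ * (b - a) * jacobiCauchy a b γ z - ((∫ t in Set.Ioo a b, jacobiWeight a b γ t : ℝ) : ℂ) := by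
  have hne := ofReal_sub_ne_zero_of_im_pos hz
  have hd : ∀ t : ℝ, HasDerivAt (fun t : ℝ => ((t : ℂ) - z)⁻¹) (-(((t : ℂ) - z)⁻¹) ^ 2) t := by
    intro t
    have h := ((hasDerivAt_id (t : ℂ)).sub_const z).inv (hne t)
    refine (h.comp_ofReal).congr_deriv ?_
    simp [neg_div]
  have h := integral_jacobiWeight_deriv hab h1 h2 hd ((continuous_ofReal_sub_inv hz).pow 2).neg
  have i1 := integrable_jacobiWeight_smul (a := a) (b := b) h1 h2 (continuous_ofReal_sub_inv hz)
  have i2 : IntegrableOn (fun t => jacobiWeight a b γ t • (((t : ℂ) - z)⁻¹) ^ 2) (Set.Ioo a b) :=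
    integrable_jacobiWeight_smul h1 h2 ((continuous_ofReal_sub_inv hz).pow 2)
  have i3 : IntegrableOn (fun t => (jacobiWeight a b γ t : ℂ)) (Set.Ioo a b) :=
    (integrableOn_jacobiWeight a b h1 h2).ofReal (𝕜 := ℂ)
  have e : ∀ t : ℝ, jacobiWeight a b γ t • ((γ * (b - a) + a + b - 2 * t) • ((t : ℂ) - z)⁻¹ +
      ((t - a) * (b - t)) • (-(((t : ℂ) - z)⁻¹) ^ 2)) =
      γ * (b - a) * (jacobiWeight a b γ t • ((t : ℂ) - z)⁻¹) - (jacobiWeight a b γ t : ℂ) -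
      (z - a) * (b - z) * (jacobiWeight a b γ t • (((t : ℂ) - z)⁻¹) ^ 2) := by
    intro t
    simp only [Complex.real_smul]
    have := hne t
    push_cast
    field_simp
    ring
  simp_rw [e] at h
  have i4 : IntegrableOn (fun t : ℝ => (γ : ℂ) * (b - a) * (jacobiWeight a b γ t • ((t : ℂ) - z)⁻¹) -
    (jacobiWeight a b γ t : ℂ)) (Set.Ioo a b) := (i1.const_mul _).sub i3
  rw [integral_sub i4 (i2.const_mul _), integral_sub (i1.const_mul _) i3, integral_const_mul,
    integral_const_mul] at h
  have e3 : ∫ t in Set.Ioo a b, (jacobiWeight a b γ t : ℂ) =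
      ((∫ t in Set.Ioo a b, jacobiWeight a b γ t : ℝ) : ℂ) := integral_ofReal
  rw [e3] at h
  rw [jacobiCauchy]
  exact (sub_eq_zero.1 h).symm

/-- Keeps the Möbius quotient off the branch cut, so its principal powers are holomorphic on the
upper half-plane. -/
theorem im_moebius_neg {a b : ℝ} (hab : a < b) {z : ℂ} (hz : 0 < z.im) :
    ((z - a) / (z - b)).im < 0 := by
  have hb : z - b ≠ 0 := fun h => by
    have := congrArg Complex.im h
    simp at this
    exact hz.ne' this
  have hn : 0 < Complex.normSq (z - b) := Complex.normSq_pos.2 hb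
  rw [Complex.div_im]
  simp only [Complex.sub_im, Complex.sub_re, Complex.ofReal_im, Complex.ofReal_re, sub_zero]
  rw [← sub_div, div_neg_iff]
  right
  refine ⟨?_, hn⟩
  nlinarith

theorem norm_jacobiCauchy_le {a b γ : ℝ} (h1 : -1 < γ) (h2 : γ < 1) {z : ℂ} (hz : 0 < z.im) :
    ‖jacobiCauchy a b γ z‖ ≤ (∫ t in Set.Ioo a b, jacobiWeight a b γ t) * z.im⁻¹ := by
  rw [← integral_mul_const]
  refine norm_integral_le_of_norm_le ((integrableOn_jacobiWeight a b h1 h2).mul_const _) ?_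
  filter_upwards [ae_restrict_mem measurableSet_Ioo] with t ht
  rw [norm_smul, Real.norm_eq_abs, abs_of_pos (jacobiWeight_pos ht), norm_inv]
  exact mul_le_mul_of_nonneg_left (inv_anti₀ hz (im_le_norm_ofReal_sub hz t)) (jacobiWeight_pos ht).le

/-- Write `κ = π / sin(πγ)`. The mass of the weight is `γ (b - a) κ`, so the differential equation
is homogeneous in `jacobiCauchy - κ`. Hence that difference times the power `-γ` of the Möbius
quotient is constant, and letting `z → i∞` gives the constant `-κ`. -/
theorem jacobiCauchy_eq {a b γ : ℝ} (hab : a < b) (h1 : -1 < γ) (h2 : γ < 1) (h0 : γ ≠ 0) {z : ℂ}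
    (hz : 0 < z.im) :
    jacobiCauchy a b γ z = (Real.pi / Real.sin (Real.pi * γ) : ℝ) *
      (1 - ((z - a) / (z - b)) ^ (γ : ℂ)) := by
  set κ : ℝ := Real.pi / Real.sin (Real.pi * γ) with hκ
  have hba : ((b : ℂ) - a) ≠ 0 := by exact_mod_cast (sub_pos.2 hab).ne'
  have hsub : ∀ {w : ℂ} (c : ℝ), 0 < w.im → w - c ≠ 0 := fun {w} c hw h => by
    have := congrArg Complex.im h
    simp at this
    exact hw.ne' this
  let n : ℂ → ℂ := fun w => (w - a) / (w - b)
  let U : Set ℂ := {w | 0 < w.im}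
  have hUo : IsOpen U := isOpen_lt continuous_const Complex.continuous_im
  have hUc : Convex ℝ U := convex_halfSpace_im_gt 0
  let G : ℂ → ℂ := fun w => (jacobiCauchy a b γ w - κ) * n w ^ (-γ : ℂ)
  have hslit : ∀ w ∈ U, n w ∈ Complex.slitPlane := fun w hw =>
    Complex.mem_slitPlane_iff.2 (Or.inr (im_moebius_neg hab hw).ne)
  have hn0 : ∀ w ∈ U, n w ≠ 0 := fun w hw => Complex.slitPlane_ne_zero (hslit w hw)
  have hG : ∀ w ∈ U, HasDerivAt G 0 w := by
    intro w hw
    have dC := hasDerivAt_jacobiCauchy (a := a) (b := b) h1 h2 hw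
    have ode := jacobiCauchy_ode hab.le h1 h2 hw
    rw [integral_jacobiWeight hab h1 h2 h0, ← hκ] at ode
    have dn : HasDerivAt n ((a - b) / (w - b) ^ 2) w := by
      refine (((hasDerivAt_id w).sub_const (a : ℂ)).div ((hasDerivAt_id w).sub_const (b : ℂ))
        (hsub b hw)).congr_deriv ?_
      simp
    have dp := dn.cpow_const (c := (-γ : ℂ)) (hslit w hw)
    refine ((dC.sub_const (κ : ℂ)).mul dp).congr_deriv ?_
    have e1 : n w ^ (-γ - 1 : ℂ) = n w ^ (-γ : ℂ) * ((w - b) / (w - a)) := by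
      rw [Complex.cpow_sub _ _ (hn0 w hw), Complex.cpow_one, div_eq_mul_inv, inv_div]
    rw [e1]
    have ha' := hsub a hw
    have hb' := hsub b hw
    have hbw : (b : ℂ) - w ≠ 0 := by rw [← neg_sub]; exact neg_ne_zero.2 hb'
    have e2 : ∫ t in Set.Ioo a b, jacobiWeight a b γ t • (((t : ℂ) - w)⁻¹) ^ 2 =
        γ * (b - a) * (jacobiCauchy a b γ w - κ) / ((w - a) * (b - w)) := by
      rw [eq_div_iff (mul_ne_zero ha' hbw), mul_comm, ode]
      push_cast
      ring
    rw [e2]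
    have e3 : (b : ℂ) - w = -(w - b) := by ring
    rw [e3]
    field_simp
    ring
  have hconst : ∀ w ∈ U, G w = G z := by
    intro w hw
    refine hUc.is_const_of_fderivWithin_eq_zero (𝕜 := ℂ)
      (fun x hx => (hG x hx).differentiableAt.differentiableWithinAt) (fun x hx => ?_) hw hz
    rw [fderivWithin_of_isOpen hUo hx, (hG x hx).hasFDerivAt.fderiv]
    ext
    simp
  have hI : ∀ y : ℝ, 0 < y → (y * Complex.I : ℂ) ∈ U := fun y hy => by simpa [U] using hy
  have hlimC : Tendsto (fun y : ℝ => jacobiCauchy a b γ (y * Complex.I)) atTop (𝓝 0) := by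
    have hz0 : Tendsto (fun y : ℝ => (∫ t in Set.Ioo a b, jacobiWeight a b γ t) * y⁻¹) atTop
        (𝓝 0) := by
      simpa using tendsto_inv_atTop_zero.const_mul (∫ t in Set.Ioo a b, jacobiWeight a b γ t)
    refine squeeze_zero_norm' ?_ hz0
    filter_upwards [eventually_gt_atTop 0] with y hy
    simpa using norm_jacobiCauchy_le (a := a) (b := b) h1 h2 (hI y hy)
  have hlimn : Tendsto (fun y : ℝ => n (y * Complex.I)) atTop (𝓝 1) := by
    have hz0 : Tendsto (fun y : ℝ => ((b : ℂ) - a) / (y * Complex.I - b)) atTop (𝓝 0) := by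
      have hz1 : Tendsto (fun y : ℝ => ‖(b : ℂ) - a‖ * y⁻¹) atTop (𝓝 0) := by
        simpa using tendsto_inv_atTop_zero.const_mul ‖(b : ℂ) - a‖
      refine squeeze_zero_norm' ?_ hz1
      filter_upwards [eventually_gt_atTop 0] with y hy
      rw [norm_div, div_eq_mul_inv]
      refine mul_le_mul_of_nonneg_left (inv_anti₀ hy ?_) (norm_nonneg _)
      rw [norm_sub_rev]
      simpa using im_le_norm_ofReal_sub (hI y hy) b
    have hz2 := hz0.const_add 1
    rw [add_zero] at hz2
    refine hz2.congr' ?_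
    filter_upwards [eventually_gt_atTop 0] with y hy
    have := hsub b (hI y hy)
    simp only [n]
    field_simp
    ring
  have hlimG : Tendsto (fun y : ℝ => G (y * Complex.I)) atTop (𝓝 (-κ)) := by
    have hc : ContinuousAt (fun x : ℂ => x ^ (-γ : ℂ)) 1 :=
      continuousAt_cpow_const (by simp)
    have h3 := (hlimC.sub_const (κ : ℂ)).mul (hc.tendsto.comp hlimn)
    simpa using h3
  have hGz : G z = -κ := by
    refine tendsto_nhds_unique (tendsto_const_nhds.congr' ?_) hlimG
    filter_upwards [eventually_gt_atTop 0] with y hy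
    exact (hconst _ (hI y hy)).symm
  have hprod : n z ^ (-γ : ℂ) * n z ^ (γ : ℂ) = 1 := by
    rw [← Complex.cpow_add _ _ (hn0 z hz), neg_add_cancel, Complex.cpow_zero]
  have : (jacobiCauchy a b γ z - κ) * (n z ^ (-γ : ℂ) * n z ^ (γ : ℂ)) = -κ * n z ^ (γ : ℂ) := by
    rw [← mul_assoc, ← hGz]
  rw [hprod, mul_one] at this
  rw [sub_eq_iff_eq_add] at this
  rw [this]
  ring

/-- From above, the Möbius quotient is `-m` with `m` in the upper half-plane and `arg(-m) = arg m -
π`, so its power acquires the phase `e^{-iπγ}`. The real part of the phase produces the cotangent.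
-/
theorem tendsto_re_jacobiCauchy {a b γ s : ℝ} (h1 : -1 < γ) (h2 : γ < 1) (h0 : γ ≠ 0)
    (hs : s ∈ Set.Ioo a b) {ι : Type*} {l : Filter ι} {z : ι → ℂ} (hz : ∀ᶠ i in l, 0 < (z i).im)
    (hlim : Tendsto z l (𝓝 s)) :
    ∃ c : ℂ, Tendsto (fun i => jacobiCauchy a b γ (z i)) l (𝓝 c) ∧
      c.re = Real.pi / Real.sin (Real.pi * γ) -
        Real.pi * Real.cot (Real.pi * γ) * jacobiWeight a b γ s := by
  have hab : a < b := hs.1.trans hs.2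
  have hbs : (b : ℂ) - s ≠ 0 := by exact_mod_cast (sub_pos.2 hs.2).ne'
  have hm : Tendsto (fun i => (z i - a) / (b - z i)) l (𝓝 (((s - a) / (b - s) : ℝ) : ℂ)) := by
    have := (hlim.sub_const (a : ℂ)).div (hlim.const_sub (b : ℂ)) hbs
    push_cast
    exact this
  have hpos : 0 < (s - a) / (b - s) := div_pos (sub_pos.2 hs.1) (sub_pos.2 hs.2)
  have hm2 := (continuousAt_cpow_const (b := (γ : ℂ))
    (Complex.ofReal_mem_slitPlane.2 hpos)).tendsto.comp hm
  rw [← Complex.ofReal_cpow hpos.le] at hm2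
  refine ⟨_, (((hm2.mul_const (Complex.exp (-(Real.pi * γ) * Complex.I))).const_sub 1).const_mul
    ((Real.pi / Real.sin (Real.pi * γ) : ℝ) : ℂ)).congr' ?_, ?_⟩
  · filter_upwards [hz] with i hi
    rw [jacobiCauchy_eq hab h1 h2 h0 hi]
    congr 2
    set m := (z i - a) / (b - z i) with hmdef
    have e : (z i - a) / (z i - b) = -m := by
      rw [hmdef, ← neg_sub (z i) (b : ℂ), div_neg, neg_neg]
    have hneg : (-m).im < 0 := by rw [← e]; exact im_moebius_neg hab hi
    have him : 0 < m.im := by simpa using hneg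
    have hm0 : m ≠ 0 := fun h => by simp [h] at him
    rw [Function.comp_apply, e, Complex.cpow_def_of_ne_zero hm0,
      Complex.cpow_def_of_ne_zero (neg_ne_zero.2 hm0), ← Complex.exp_add]
    congr 1
    rw [Complex.log, Complex.log, norm_neg, Complex.arg_neg_eq_arg_sub_pi_of_im_pos him]
    push_cast
    ring
  · have e1 : Complex.exp (-(Real.pi * γ) * Complex.I) =
        Real.cos (Real.pi * γ) - Real.sin (Real.pi * γ) * Complex.I := by
      have : -((Real.pi : ℂ) * γ) * Complex.I = ((-(Real.pi * γ) : ℝ) : ℂ) * Complex.I := by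
        push_cast
        ring
      rw [this, Complex.exp_mul_I, ← Complex.ofReal_cos, ← Complex.ofReal_sin, Real.cos_neg,
        Real.sin_neg]
      push_cast
      ring
    rw [e1, Complex.re_ofReal_mul, jacobiWeight, Real.cot_eq_cos_div_sin]
    simp only [Complex.sub_re, Complex.one_re, Complex.mul_re,
      Complex.ofReal_re, Complex.ofReal_im, Complex.I_re, Complex.I_im]
    ring

/-! ### The substitution `s = p²` and boundary values. -/

theorem image_sq_Ioo {k₁ k₂ : ℝ} (hk₁ : 0 < k₁) (hk₂ : 0 < k₂) :
    (fun p : ℝ => p ^ 2) '' Set.Ioo k₁ k₂ = Set.Ioo (k₁ ^ 2) (k₂ ^ 2) := by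
  ext s
  constructor
  · rintro ⟨p, hp, rfl⟩
    exact ⟨pow_lt_pow_left₀ hp.1 hk₁.le two_ne_zero,
      pow_lt_pow_left₀ hp.2 (hk₁.trans hp.1).le two_ne_zero⟩
  · rintro ⟨h1, h2⟩
    have hs : 0 ≤ s := (sq_nonneg _).trans h1.le
    have hk₂' : Real.sqrt s ^ 2 = s := Real.sq_sqrt hs
    refine ⟨Real.sqrt s, ⟨Real.lt_sqrt_of_sq_lt h1, ?_⟩, hk₂'⟩
    exact (Real.sqrt_lt' hk₂).2 h2

theorem injOn_sq_Ioo {k₁ k₂ : ℝ} (hk₁ : 0 < k₁) :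
    Set.InjOn (fun p : ℝ => p ^ 2) (Set.Ioo k₁ k₂) := fun _ hp _ hq h =>
  (pow_left_inj₀ (hk₁.trans hp.1).le (hk₁.trans hq.1).le two_ne_zero).1 h

theorem hasDerivWithinAt_sq (s : Set ℝ) (p : ℝ) :
    HasDerivWithinAt (fun p : ℝ => p ^ 2) (2 * p) s p := by
  simpa using (hasDerivAt_pow 2 p).hasDerivWithinAt

theorem setIntegral_Ioo_sq {E : Type*} [NormedAddCommGroup E] [NormedSpace ℝ E] {k₁ k₂ : ℝ}
    (hk₁ : 0 < k₁) (hk : k₁ < k₂) (φ : ℝ → E) :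
    ∫ p in Set.Icc k₁ k₂, (2 * p) • φ (p ^ 2) = ∫ s in Set.Ioo (k₁ ^ 2) (k₂ ^ 2), φ s := by
  rw [← image_sq_Ioo hk₁ (hk₁.trans hk), integral_image_eq_integral_abs_deriv_smul measurableSet_Ioo
    (fun p _ => hasDerivWithinAt_sq _ p) (injOn_sq_Ioo hk₁), integral_Icc_eq_integral_Ioo]
  refine setIntegral_congr_fun measurableSet_Ioo fun p hp => ?_
  rw [abs_of_pos (mul_pos two_pos (hk₁.trans hp.1))]

theorem integrableOn_Icc_sq {E : Type*} [NormedAddCommGroup E] [NormedSpace ℝ E] {k₁ k₂ : ℝ}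
    (hk₁ : 0 < k₁) (hk : k₁ < k₂) {φ : ℝ → E} (hφ : IntegrableOn φ (Set.Ioo (k₁ ^ 2) (k₂ ^ 2))) :
    IntegrableOn (fun p => (2 * p) • φ (p ^ 2)) (Set.Icc k₁ k₂) := by
  rw [← image_sq_Ioo hk₁ (hk₁.trans hk), integrableOn_image_iff_integrableOn_abs_deriv_smul measurableSet_Ioo
    (fun p _ => hasDerivWithinAt_sq _ p) (injOn_sq_Ioo hk₁)] at hφ
  rw [integrableOn_Icc_iff_integrableOn_Ioo]
  refine hφ.congr_fun (fun p hp => ?_) measurableSet_Ioo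
  simp only
  rw [abs_of_pos (mul_pos two_pos (hk₁.trans hp.1))]

theorem ae_restrict_Icc_mem_Ioo (k₁ k₂ : ℝ) :
    ∀ᵐ p ∂(volume.restrict (Set.Icc k₁ k₂)), p ∈ Set.Ioo k₁ k₂ := by
  filter_upwards [ae_restrict_mem measurableSet_Icc, ae_restrict_of_ae (ae_ne k₁),
    ae_restrict_of_ae (ae_ne k₂)] with p hp h1 h2
  exact ⟨lt_of_le_of_ne hp.1 h1.symm, lt_of_le_of_ne hp.2 h2⟩

theorem sq_mem_Ioo {k₁ k₂ p : ℝ} (hk₁ : 0 < k₁) (hp : p ∈ Set.Ioo k₁ k₂) :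
    p ^ 2 ∈ Set.Ioo (k₁ ^ 2) (k₂ ^ 2) := by
  rw [← image_sq_Ioo hk₁ ((hk₁.trans hp.1).trans hp.2)]
  exact Set.mem_image_of_mem _ hp

/-- The square has exponent `2γ`, integrable exactly because `|γ| < 1/2`; the Jacobian `2p` is at
least `2k₁`. -/
theorem memLp_jacobiWeight_sq {k₁ k₂ γ : ℝ} (hk₁ : 0 < k₁) (hk : k₁ < k₂) (h1 : -(1 / 2) < γ) (h2 : γ < 1 / 2) :
    MemLp (fun p => jacobiWeight (k₁ ^ 2) (k₂ ^ 2) γ (p ^ 2)) 2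
      (volume.restrict (Set.Icc k₁ k₂)) := by
  have hm : Measurable fun p : ℝ => jacobiWeight (k₁ ^ 2) (k₂ ^ 2) γ (p ^ 2) :=
    (measurable_jacobiWeight _ _ _).comp (by fun_prop)
  rw [memLp_two_iff_integrable_sq hm.aestronglyMeasurable]
  have hi := integrableOn_Icc_sq hk₁ hk (integrableOn_jacobiWeight (k₁ ^ 2) (k₂ ^ 2)
    (γ := γ + γ) (by linarith) (by linarith))
  refine (hi.const_mul (2 * k₁)⁻¹).mono' (hm.pow_const 2).aestronglyMeasurable ?_
  filter_upwards [ae_restrict_Icc_mem_Ioo k₁ k₂] with p hp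
  have hw := jacobiWeight_pos (γ := γ) (sq_mem_Ioo hk₁ hp)
  rw [Real.norm_eq_abs, abs_of_nonneg (sq_nonneg _), jacobiWeight_add (sq_mem_Ioo hk₁ hp),
    smul_eq_mul, ← mul_assoc, ← sq]
  refine le_mul_of_one_le_left (sq_nonneg _) ?_
  rw [inv_mul_eq_div, one_le_div (by positivity)]
  linarith [hp.1]

theorem memLp_id_mul {k₁ k₂ : ℝ} {f : ℝ → ℝ} (hf : MemLp f 2 (volume.restrict (Set.Icc k₁ k₂))) :
    MemLp (fun p => p * f p) 2 (volume.restrict (Set.Icc k₁ k₂)) := by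
  refine hf.of_le_mul (c := max |k₁| |k₂|) (aestronglyMeasurable_id.mul hf.1) ?_
  filter_upwards [ae_restrict_mem measurableSet_Icc] with p hp
  rw [norm_mul]
  exact mul_le_mul_of_nonneg_right (abs_le_max_abs_abs hp.1 hp.2) (norm_nonneg _)

theorem integrable_mul_conjPoissonKer {k₁ k₂ : ℝ} {f : ℝ → ℝ}
    (hf : MemLp f 2 (volume.restrict (Set.Icc k₁ k₂))) {y : ℝ} (hy : 0 < y) {σ : ℝ → ℝ}
    (hσ : Continuous σ) :
    Integrable (fun q => f q * conjPoissonKer y (σ q)) (volume.restrict (Set.Icc k₁ k₂)) :=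
  (hf.integrable one_le_two).mul_bdd
    ((continuous_conjPoissonKer hy).comp hσ).aestronglyMeasurable
    (Eventually.of_forall fun q => abs_conjPoissonKer_le hy (σ q))

theorem tendsto_integral_conjPoissonKer_add {k₁ k₂ p : ℝ} {f : ℝ → ℝ} (hk₁ : 0 < k₁) (hp : 0 < p)
    (hf : MemLp f 2 (volume.restrict (Set.Icc k₁ k₂))) :
    Tendsto (fun y => ∫ q in Set.Icc k₁ k₂, f q * conjPoissonKer y (p + q)) (𝓝[>] 0)
      (𝓝 (∫ q in Set.Icc k₁ k₂, f q / (p + q))) := by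
  have hpos : ∀ᶠ y : ℝ in 𝓝[>] 0, 0 < y := self_mem_nhdsWithin
  refine tendsto_integral_filter_of_dominated_convergence (fun q => |f q| * p⁻¹) ?_ ?_
    ((hf.integrable one_le_two).abs.mul_const _) ?_
  · filter_upwards [hpos] with y hy
    exact (integrable_mul_conjPoissonKer hf hy (by fun_prop)).1
  · filter_upwards [hpos] with y hy
    filter_upwards [ae_restrict_mem measurableSet_Icc] with q hq
    have hq0 : 0 < q := hk₁.trans_le hq.1
    rw [norm_mul, Real.norm_eq_abs, Real.norm_eq_abs]
    refine mul_le_mul_of_nonneg_left ?_ (abs_nonneg _)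
    unfold conjPoissonKer
    rw [abs_of_nonneg (by positivity), ← one_div, div_le_div_iff₀ (by positivity) hp]
    nlinarith [mul_pos hp hq0, sq_nonneg q, sq_nonneg y]
  · filter_upwards [ae_restrict_mem measurableSet_Icc] with q hq
    have hq0 : 0 < q := hk₁.trans_le hq.1
    rw [div_eq_mul_inv]
    refine Tendsto.const_mul _ ?_
    unfold conjPoissonKer
    have h : ContinuousAt (fun y : ℝ => (p + q) / ((p + q) ^ 2 + y ^ 2)) 0 := by
      refine continuousAt_const.div (by fun_prop) ?_
      positivity
    have h2 := h.tendsto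
    have e : (p + q) / ((p + q) ^ 2 + 0 ^ 2) = (p + q)⁻¹ := by
      have : p + q ≠ 0 := by positivity
      field_simp
      ring
    rw [e] at h2
    exact h2.mono_left nhdsWithin_le_nhds

theorem re_inv_add_mul_I (t y : ℝ) : (((t : ℂ) + y * Complex.I)⁻¹).re = conjPoissonKer y t := by
  rw [Complex.inv_re, Complex.normSq_apply, conjPoissonKer]
  simp [sq]

theorem jacobiCauchy_sq {k₁ k₂ γ : ℝ} (hk₁ : 0 < k₁) (hk : k₁ < k₂) (z : ℂ) :
    jacobiCauchy (k₁ ^ 2) (k₂ ^ 2) γ (z ^ 2) = ∫ q in Set.Icc k₁ k₂,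
      (2 * q) • (jacobiWeight (k₁ ^ 2) (k₂ ^ 2) γ (q ^ 2) • ((q : ℂ) ^ 2 - z ^ 2)⁻¹) := by
  rw [jacobiCauchy, ← setIntegral_Ioo_sq hk₁ hk]
  simp

theorem sq_add_mul_I_im_pos {p y : ℝ} (hp : 0 < p) (hy : 0 < y) :
    0 < (((p : ℂ) + y * Complex.I) ^ 2).im := by
  have h : (((p : ℂ) + y * Complex.I) ^ 2).im = 2 * (p * y) := by
    simp [sq]
    ring
  rw [h]
  positivity

theorem add_mul_I_add_ne_zero {y : ℝ} (hy : 0 < y) (p q : ℝ) :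
    (p : ℂ) + y * Complex.I + q ≠ 0 := fun h => by
  have := congrArg Complex.im h
  simp at this
  exact hy.ne' this

/-- `2q/(q² - z²) = 1/(z+q) - 1/(z-q)` with `z = p + iy`: the Cauchy kernel in the squared variable
is the regularised kernel of `S - H`. The variant below, multiplied by `z`, yields `S + H` acting on
`q` times the weight. -/
theorem two_smul_smul_inv_sq_sub {y : ℝ} (hy : 0 < y) (p q w : ℝ) :
    (2 * q) • (w • ((q : ℂ) ^ 2 - ((p : ℂ) + y * Complex.I) ^ 2)⁻¹) =
      w * ((((p + q : ℝ) : ℂ) + y * Complex.I)⁻¹ - (((p - q : ℝ) : ℂ) + y * Complex.I)⁻¹) := by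
  have e1 : ((p + q : ℝ) : ℂ) + y * Complex.I = (p : ℂ) + y * Complex.I + q := by
    push_cast; ring
  have e2 : ((p - q : ℝ) : ℂ) + y * Complex.I = (p : ℂ) + y * Complex.I - q := by
    push_cast; ring
  have h1 := add_mul_I_add_ne_zero hy p q
  have h2 := add_mul_I_add_ne_zero hy p (-q)
  rw [Complex.ofReal_neg, ← sub_eq_add_neg] at h2
  rw [e1, e2, Complex.real_smul, Complex.real_smul]
  generalize (p : ℂ) + y * Complex.I = z at h1 h2
  have h3 : (q : ℂ) ^ 2 - z ^ 2 ≠ 0 := by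
    have : (q : ℂ) ^ 2 - z ^ 2 = -((z + q) * (z - q)) := by ring
    rw [this]
    exact neg_ne_zero.2 (mul_ne_zero h1 h2)
  push_cast
  field_simp
  ring

theorem mul_two_smul_smul_inv_sq_sub {y : ℝ} (hy : 0 < y) (p q w : ℝ) :
    ((p : ℂ) + y * Complex.I) *
        ((2 * q) • (w • ((q : ℂ) ^ 2 - ((p : ℂ) + y * Complex.I) ^ 2)⁻¹)) =
      -(((q * w : ℝ) : ℂ) * ((((p + q : ℝ) : ℂ) + y * Complex.I)⁻¹ +
        (((p - q : ℝ) : ℂ) + y * Complex.I)⁻¹)) := by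
  have e1 : ((p + q : ℝ) : ℂ) + y * Complex.I = (p : ℂ) + y * Complex.I + q := by
    push_cast; ring
  have e2 : ((p - q : ℝ) : ℂ) + y * Complex.I = (p : ℂ) + y * Complex.I - q := by
    push_cast; ring
  have h1 := add_mul_I_add_ne_zero hy p q
  have h2 := add_mul_I_add_ne_zero hy p (-q)
  rw [Complex.ofReal_neg, ← sub_eq_add_neg] at h2
  rw [e1, e2, Complex.real_smul, Complex.real_smul]
  generalize (p : ℂ) + y * Complex.I = z at h1 h2
  have h3 : (q : ℂ) ^ 2 - z ^ 2 ≠ 0 := by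
    have : (q : ℂ) ^ 2 - z ^ 2 = -((z + q) * (z - q)) := by ring
    rw [this]
    exact neg_ne_zero.2 (mul_ne_zero h1 h2)
  push_cast
  field_simp
  ring

theorem integrable_jacobiCauchy_sq {k₁ k₂ γ : ℝ} (hk₁ : 0 < k₁) (hk : k₁ < k₂) (h1 : -1 < γ)
    (h2 : γ < 1) {p y : ℝ} (hp : 0 < p) (hy : 0 < y) :
    IntegrableOn (fun q : ℝ => (2 * q) • (jacobiWeight (k₁ ^ 2) (k₂ ^ 2) γ (q ^ 2) •
      ((q : ℂ) ^ 2 - ((p : ℂ) + y * Complex.I) ^ 2)⁻¹)) (Set.Icc k₁ k₂) := by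
  have h := integrableOn_Icc_sq hk₁ hk (integrable_jacobiWeight_smul (a := k₁ ^ 2) (b := k₂ ^ 2)
    h1 h2 (continuous_ofReal_sub_inv (sq_add_mul_I_im_pos hp hy)))
  simpa using h

theorem re_jacobiCauchy_sq {k₁ k₂ γ : ℝ} (hk₁ : 0 < k₁) (hk : k₁ < k₂) (h1 : -(1 / 2) < γ)
    (h2 : γ < 1 / 2) {p y : ℝ} (hp : 0 < p) (hy : 0 < y) :
    (jacobiCauchy (k₁ ^ 2) (k₂ ^ 2) γ (((p : ℂ) + y * Complex.I) ^ 2)).re =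
      (∫ q in Set.Icc k₁ k₂, jacobiWeight (k₁ ^ 2) (k₂ ^ 2) γ (q ^ 2) * conjPoissonKer y (p + q)) -
      ∫ q in Set.Icc k₁ k₂, jacobiWeight (k₁ ^ 2) (k₂ ^ 2) γ (q ^ 2) * conjPoissonKer y (p - q) := by
  have hw := memLp_jacobiWeight_sq hk₁ hk h1 h2
  rw [jacobiCauchy_sq hk₁ hk, ← RCLike.re_eq_complex_re, ← integral_re
    (integrable_jacobiCauchy_sq hk₁ hk (by linarith) (by linarith) hp hy),
    ← integral_sub (integrable_mul_conjPoissonKer hw hy (by fun_prop))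
      (integrable_mul_conjPoissonKer hw hy (by fun_prop))]
  refine integral_congr_ae (Eventually.of_forall fun q => ?_)
  simp only
  rw [two_smul_smul_inv_sq_sub hy, RCLike.re_eq_complex_re, Complex.re_ofReal_mul, Complex.sub_re,
    re_inv_add_mul_I, re_inv_add_mul_I, mul_sub]

theorem re_mul_jacobiCauchy_sq {k₁ k₂ γ : ℝ} (hk₁ : 0 < k₁) (hk : k₁ < k₂) (h1 : -(1 / 2) < γ)
    (h2 : γ < 1 / 2) {p y : ℝ} (hp : 0 < p) (hy : 0 < y) :
    (((p : ℂ) + y * Complex.I) *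
        jacobiCauchy (k₁ ^ 2) (k₂ ^ 2) γ (((p : ℂ) + y * Complex.I) ^ 2)).re =
      -((∫ q in Set.Icc k₁ k₂,
          (q * jacobiWeight (k₁ ^ 2) (k₂ ^ 2) γ (q ^ 2)) * conjPoissonKer y (p + q)) +
        ∫ q in Set.Icc k₁ k₂,
          (q * jacobiWeight (k₁ ^ 2) (k₂ ^ 2) γ (q ^ 2)) * conjPoissonKer y (p - q)) := by
  have hw := memLp_id_mul (memLp_jacobiWeight_sq hk₁ hk h1 h2)
  rw [jacobiCauchy_sq hk₁ hk, ← integral_const_mul, ← RCLike.re_eq_complex_re, ← integral_re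
    ((integrable_jacobiCauchy_sq hk₁ hk (by linarith) (by linarith) hp hy).const_mul _),
    ← integral_add (integrable_mul_conjPoissonKer hw hy (by fun_prop))
      (integrable_mul_conjPoissonKer hw hy (by fun_prop)), ← integral_neg]
  refine integral_congr_ae (Eventually.of_forall fun q => ?_)
  simp only
  rw [mul_two_smul_smul_inv_sq_sub hy, RCLike.re_eq_complex_re, Complex.neg_re,
    Complex.re_ofReal_mul, Complex.add_re, re_inv_add_mul_I, re_inv_add_mul_I, mul_add]

theorem tendsto_add_mul_I (p : ℝ) :
    Tendsto (fun y : ℝ => (p : ℂ) + y * Complex.I) (𝓝[>] 0) (𝓝 p) := by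
  have h : Continuous fun y : ℝ => (p : ℂ) + y * Complex.I := by fun_prop
  have h0 := h.tendsto 0
  simp only [Complex.ofReal_zero, zero_mul, add_zero] at h0
  exact h0.mono_left nhdsWithin_le_nhds

/-- The boundary values of the Cauchy integral, on the level of the Carleman and Hilbert
operators on `[k₁, k₂]`. -/
theorem tendsto_conjPoissonKer_jacobiWeight {k₁ k₂ γ p h h' : ℝ} (hk₁ : 0 < k₁) (hk : k₁ < k₂)
    (h1 : -(1 / 2) < γ) (h2 : γ < 1 / 2) (h0 : γ ≠ 0) (hp : p ∈ Set.Ioo k₁ k₂)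
    (hh : Tendsto (fun y => ∫ q in Set.Icc k₁ k₂,
      jacobiWeight (k₁ ^ 2) (k₂ ^ 2) γ (q ^ 2) * conjPoissonKer y (p - q)) (𝓝[>] 0) (𝓝 h))
    (hh' : Tendsto (fun y => ∫ q in Set.Icc k₁ k₂,
      (q * jacobiWeight (k₁ ^ 2) (k₂ ^ 2) γ (q ^ 2)) * conjPoissonKer y (p - q)) (𝓝[>] 0) (𝓝 h')) :
    (∫ q in Set.Icc k₁ k₂, jacobiWeight (k₁ ^ 2) (k₂ ^ 2) γ (q ^ 2) / (p + q)) - h =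
      Real.pi / Real.sin (Real.pi * γ) -
        Real.pi * Real.cot (Real.pi * γ) * jacobiWeight (k₁ ^ 2) (k₂ ^ 2) γ (p ^ 2) ∧
    (∫ q in Set.Icc k₁ k₂, (q * jacobiWeight (k₁ ^ 2) (k₂ ^ 2) γ (q ^ 2)) / (p + q)) + h' =
      -(Real.pi / Real.sin (Real.pi * γ)) * p +
        Real.pi * Real.cot (Real.pi * γ) * (p * jacobiWeight (k₁ ^ 2) (k₂ ^ 2) γ (p ^ 2)) := by
  have hp0 : 0 < p := hk₁.trans hp.1
  have hw := memLp_jacobiWeight_sq hk₁ hk h1 h2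
  have hpos : ∀ᶠ y : ℝ in 𝓝[>] 0, 0 < y := self_mem_nhdsWithin
  have hz : Tendsto (fun y : ℝ => ((p : ℂ) + y * Complex.I) ^ 2) (𝓝[>] 0) (𝓝 ((p ^ 2 : ℝ) : ℂ)) := by
    simpa using (tendsto_add_mul_I p).pow 2
  obtain ⟨c, hc, hcre⟩ := tendsto_re_jacobiCauchy (by linarith) (by linarith) h0
    (sq_mem_Ioo hk₁ hp) (hpos.mono fun y hy => sq_add_mul_I_im_pos hp0 hy) hz
  rw [← hcre]
  have hpc := (tendsto_add_mul_I p).mul hc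
  constructor
  · refine tendsto_nhds_unique_of_eventuallyEq
      ((tendsto_integral_conjPoissonKer_add hk₁ hp0 hw).sub hh)
      ((Complex.continuous_re.tendsto c).comp hc) (hpos.mono fun y hy => ?_)
    exact (re_jacobiCauchy_sq hk₁ hk h1 h2 hp0 hy).symm
  · have e : -(Real.pi / Real.sin (Real.pi * γ)) * p + Real.pi * Real.cot (Real.pi * γ) *
        (p * jacobiWeight (k₁ ^ 2) (k₂ ^ 2) γ (p ^ 2)) = -((p : ℂ) * c).re := by
      rw [Complex.re_ofReal_mul, hcre]
      ring
    rw [e]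
    refine tendsto_nhds_unique_of_eventuallyEq
      ((tendsto_integral_conjPoissonKer_add hk₁ hp0 (memLp_id_mul hw)).add hh')
      ((Complex.continuous_re.tendsto _).comp hpc).neg (hpos.mono fun y hy => ?_)
    simp only [Function.comp_apply]
    rw [re_mul_jacobiCauchy_sq hk₁ hk h1 h2 hp0 hy, neg_neg]

/-! ### The block system in the space of pairs. -/

/-- The Hilbert space sum of two copies of a Hilbert space. -/
def HilbertPair (E : Type*) : Type _ := WithLp 2 (E × E)

namespace HilbertPair

noncomputable instance instNormedAddCommGroup (E : Type*) [NormedAddCommGroup E]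
    [InnerProductSpace ℝ E] : NormedAddCommGroup (HilbertPair E) :=
  inferInstanceAs (NormedAddCommGroup (WithLp 2 (E × E)))

noncomputable instance instInnerProductSpace (E : Type*) [NormedAddCommGroup E]
    [InnerProductSpace ℝ E] : InnerProductSpace ℝ (HilbertPair E) :=
  inferInstanceAs (InnerProductSpace ℝ (WithLp 2 (E × E)))

instance instCompleteSpace (E : Type*) [NormedAddCommGroup E]
    [InnerProductSpace ℝ E] [CompleteSpace E] : CompleteSpace (HilbertPair E) :=
  inferInstanceAs (CompleteSpace (WithLp 2 (E × E)))

/-- The pair with the given components. -/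
def mk {E : Type*} (f g : E) : HilbertPair E := WithLp.toLp 2 (f, g)

/-- The first component. -/
noncomputable def fst {E : Type*} [NormedAddCommGroup E] [InnerProductSpace ℝ E] :
    HilbertPair E →L[ℝ] E := WithLp.fstL 2 ℝ E E

/-- The second component. -/
noncomputable def snd {E : Type*} [NormedAddCommGroup E] [InnerProductSpace ℝ E] :
    HilbertPair E →L[ℝ] E := WithLp.sndL 2 ℝ E E

/-- The operator on pairs with the given block matrix. -/
noncomputable def blockOperator {E : Type*} [NormedAddCommGroup E] [InnerProductSpace ℝ E]
    (A B C D : E →L[ℝ] E) : HilbertPair E →L[ℝ] HilbertPair E :=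
  (WithLp.prodContinuousLinearEquiv 2 ℝ E E).symm.toContinuousLinearMap ∘L
    (((A ∘L WithLp.fstL 2 ℝ E E) + (B ∘L WithLp.sndL 2 ℝ E E)).prod
      ((C ∘L WithLp.fstL 2 ℝ E E) + (D ∘L WithLp.sndL 2 ℝ E E)))

@[simp]
theorem fst_mk {E : Type*} [NormedAddCommGroup E] [InnerProductSpace ℝ E] (f g : E) :
    fst (mk f g) = f := rfl

@[simp]
theorem snd_mk {E : Type*} [NormedAddCommGroup E] [InnerProductSpace ℝ E] (f g : E) :
    snd (mk f g) = g := rfl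

theorem hilbertPair_ext {E : Type*} [NormedAddCommGroup E] [InnerProductSpace ℝ E]
    {v w : HilbertPair E} (h1 : fst v = fst w) (h2 : snd v = snd w) : v = w :=
  congrArg (WithLp.toLp 2) (Prod.ext h1 h2)

@[simp]
theorem fst_blockOperator {E : Type*} [NormedAddCommGroup E] [InnerProductSpace ℝ E]
    (A B C D : E →L[ℝ] E) (v : HilbertPair E) :
    fst (blockOperator A B C D v) = A (fst v) + B (snd v) := rfl

@[simp]
theorem snd_blockOperator {E : Type*} [NormedAddCommGroup E] [InnerProductSpace ℝ E]
    (A B C D : E →L[ℝ] E) (v : HilbertPair E) :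
    snd (blockOperator A B C D v) = C (fst v) + D (snd v) := rfl

theorem inner_eq {E : Type*} [NormedAddCommGroup E] [InnerProductSpace ℝ E]
    (v w : HilbertPair E) :
    (inner ℝ v w : ℝ) = inner ℝ (fst v) (fst w) + inner ℝ (snd v) (snd w) :=
  WithLp.prod_inner_apply (𝕜 := ℝ) (E := E) (F := E) v w

end HilbertPair

open HilbertPair

theorem exp_smul_blockOperator_diag_neg {E : Type*} [NormedAddCommGroup E] [InnerProductSpace ℝ E]
    [CompleteSpace E] (P : E →L[ℝ] E) (x : ℝ) (v : HilbertPair E) :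
    NormedSpace.exp (x • blockOperator P 0 0 (-P)) v =
      mk (NormedSpace.exp (x • P) (fst v)) (NormedSpace.exp ((-x) • P) (snd v)) :=
  hilbertPair_ext
    (map_exp_apply_of_intertwine (X := x • blockOperator P 0 0 (-P)) (Y := x • P)
      (L := fst) (fun v => by simp) v)
    (map_exp_apply_of_intertwine (X := x • blockOperator P 0 0 (-P)) (Y := (-x) • P)
      (L := snd) (fun v => by simp) v)

/-- Solution of the system `exp(xP) f + c (S f + H g) = r e`, `exp(-xP) g + c (H f + S g) = -r e`
in a Hilbert space, and the expansion of `⟨f + g, e⟩` at `x = 0`. -/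
theorem exists_solution_hyperbolic_system {E : Type*} [NormedAddCommGroup E]
    [InnerProductSpace ℝ E] [CompleteSpace E] {P S H : E →L[ℝ] E} {c r : ℝ} {e f₀ f₁ : E}
    (hc : 0 ≤ c)
    (hP : ∀ f g, inner ℝ (P f) g = inner ℝ f (P g))
    (hS : ∀ f g, inner ℝ (S f) g = inner ℝ (S g) f) (hS0 : ∀ f, 0 ≤ inner ℝ (S f) f)
    (hH : ∀ f g, inner ℝ (H f) g = -inner ℝ (H g) f)
    (h₀ : f₀ + c • (S f₀ - H f₀) = r • e) (h₁ : f₁ + c • (S f₁ + H f₁) = -P f₀) :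
    ∃ F G : ℝ → E,
      (∀ x f g, (NormedSpace.exp (x • P) f + c • (S f + H g) = r • e ∧
        NormedSpace.exp ((-x) • P) g + c • (H f + S g) = -(r • e)) ↔ f = F x ∧ g = G x) ∧
      (∀ x, AnalyticAt ℝ (fun x => (inner ℝ (F x + G x) e : ℝ)) x) ∧
      (∀ x, F (-x) + G (-x) = -(F x + G x)) ∧
      (fun x => r * inner ℝ (F x + G x) e - (-(2 * inner ℝ (P f₀) f₀) * x +
        -(1 / 3 * inner ℝ (P (P (P f₀))) f₀ + 2 * inner ℝ (P (P f₀)) f₁ + 2 * inner ℝ (P f₁) f₁)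
          * x ^ 3)) =O[𝓝 0] fun x => x ^ 4 := by
  set Q := blockOperator P 0 0 (-P) with hQdef
  set T := blockOperator (c • S) (c • H) (c • H) (c • S) with hTdef
  set σ := blockOperator (1 : E →L[ℝ] E) 0 0 (-1) with hσdef
  -- `J (f, g) = (-g, -f)` fixes `b` and `v₀`, changes the sign of `v₁` and reverses the sign of
  -- `Q`.
  set J := blockOperator (0 : E →L[ℝ] E) (-1) (-1) 0 with hJdef
  set b : HilbertPair E := mk (r • e) (-(r • e)) with hb
  set v₀ : HilbertPair E := mk f₀ (-f₀) with hv₀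
  set v₁ : HilbertPair E := mk f₁ f₁ with hv₁
  have hQ : ∀ v w, inner ℝ (Q v) w = inner ℝ v (Q w) := fun v w => by
    simp [hQdef, inner_eq, hP]
  have hσ : ∀ v w, inner ℝ (σ v) w = inner ℝ v (σ w) := fun v w => by
    simp [hσdef, inner_eq]
  have hσQ : ∀ v, σ (Q v) = Q (σ v) := fun v => by
    apply hilbertPair_ext <;> simp [hσdef, hQdef]
  -- The two off-diagonal terms with `H` cancel by skewness, leaving the nonnegative forms of `S`.
  have hT0 : ∀ v, 0 ≤ inner ℝ (T v) v := fun v => by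
    have e1 : (inner ℝ (T v) v : ℝ) =
        c * inner ℝ (S (fst v)) (fst v) + c * inner ℝ (S (snd v)) (snd v) := by
      simp only [hTdef, inner_eq, fst_blockOperator, snd_blockOperator, smul_apply,
        inner_add_left, inner_smul_left, conj_trivial]
      rw [hH (snd v) (fst v)]
      ring
    rw [e1]
    exact add_nonneg (mul_nonneg hc (hS0 _)) (mul_nonneg hc (hS0 _))
  -- The sign in `σ` compensates the skewness of `H`, so `T` is symmetric for the indefinite form.
  have hTσ : ∀ v w, inner ℝ (T v) (σ w) = inner ℝ (T w) (σ v) := fun v w => by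
    simp only [hTdef, hσdef, inner_eq, fst_blockOperator, snd_blockOperator, smul_apply,
      inner_add_left, inner_smul_left, conj_trivial, neg_apply, one_apply_eq_self, zero_apply,
      add_zero, zero_add, inner_neg_right]
    rw [hS (fst v), hS (snd v), hH (snd v), hH (fst v)]
    ring
  have hJT : ∀ v, J (T v) = T (J v) := fun v => by
    apply hilbertPair_ext <;>
    · simp only [hTdef, hJdef, fst_blockOperator, snd_blockOperator, smul_apply,
        neg_apply, one_apply_eq_self, zero_apply, add_zero, zero_add, map_neg]
      module
  have hJQ : ∀ v, J (Q v) = -Q (J v) := fun v => by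
    apply hilbertPair_ext <;> simp [hJdef, hQdef]
  have hJb : J b = b := by
    apply hilbertPair_ext <;> simp [hJdef, hb]
  have hu : ∀ x : ℝ, IsUnit (NormedSpace.exp (x • Q) + T) := fun x => by
    obtain ⟨C, hC, h⟩ := exists_coercive_exp_add hQ hT0 x
    exact isUnit_of_coercive hC h
  have hv0 : v₀ + T v₀ = b := by
    apply hilbertPair_ext <;>
    · simp only [hv₀, hTdef, hb, map_add, fst_blockOperator, snd_blockOperator, fst_mk, snd_mk,
        smul_apply, map_neg, ← h₀]
      module
  have hv1 : v₁ + T v₁ = -Q v₀ := by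
    apply hilbertPair_ext <;>
    · simp only [hv₀, hv₁, hTdef, hQdef, map_add, fst_blockOperator, snd_blockOperator, fst_mk,
        snd_mk, smul_apply, map_neg, neg_apply, zero_apply, neg_zero, add_zero, zero_add, neg_neg,
        ← h₁]
      module
  set V : ℝ → HilbertPair E := fun x => Ring.inverse (NormedSpace.exp (x • Q) + T) b with hV
  have hVe : ∀ x, inner ℝ (V x) (σ b) = r * inner ℝ (fst (V x) + snd (V x)) e := fun x => by
    rw [inner_eq, hσdef, hb]
    simp [inner_add_left, inner_smul_right]
    ring
  have hVa : ∀ x, AnalyticAt ℝ V x := fun x => analyticAt_inverse_apply (hu x) b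
  refine ⟨fun x => fst (V x), fun x => snd (V x), fun x f g => ?_, fun x => ?_, fun x => ?_, ?_⟩
  · have e1 : (NormedSpace.exp (x • Q) + T) (mk f g) = mk
        (NormedSpace.exp (x • P) f + c • (S f + H g))
        (NormedSpace.exp ((-x) • P) g + c • (H f + S g)) := by
      rw [add_apply, hQdef, exp_smul_blockOperator_diag_neg, hTdef]
      apply hilbertPair_ext <;> simp [smul_add]
    constructor
    · rintro ⟨ha, hb'⟩
      have e2 : (NormedSpace.exp (x • Q) + T) (mk f g) = b := by rw [e1, ha, hb']
      have e3 : V x = mk f g := by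
        simp only [hV]
        rw [← e2]
        exact Ring.inverse_apply_self (hu x) _
      simp [e3]
    · rintro ⟨hf, hg⟩
      have e2 := Ring.apply_inverse_self (hu x) b
      have e3 : V x = mk f g := hilbertPair_ext hf.symm hg.symm
      simp only [hV] at e3
      rw [e3, e1] at e2
      exact ⟨congrArg fst e2, congrArg snd e2⟩
  · have hL : (fun x => (inner ℝ (fst (V x) + snd (V x)) e : ℝ)) =
        fun x => ((innerSL ℝ e) ∘L (fst + snd)) (V x) := by
      funext x
      simp [real_inner_comm, inner_add_right]
    rw [hL]
    exact (ContinuousLinearMap.analyticAt _ _).comp (hVa x)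
  · have h := inverse_exp_add_neg hJb hJT hJQ hu x
    simp only [hV]
    rw [h, hJdef]
    simp
  · have h := isBigO_inner_inverse_exp_add hQ hσ hσQ hTσ hu hv0 hv1
    refine h.congr_left fun x => ?_
    have e0 := hVe x
    simp only [hV] at e0 ⊢
    rw [e0]
    -- The even-order coefficients vanish because the contributions of the two components cancel; in
    -- the odd-order ones they double.
    have i1 : (inner ℝ v₀ (σ b) : ℝ) = 0 := by
      simp [inner_eq, hσdef, hb, hv₀]
    have i2 : (inner ℝ (Q v₀) (σ v₀) : ℝ) = 2 * inner ℝ (P f₀) f₀ := by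
      simp [inner_eq, hσdef, hQdef, hv₀]
      ring
    have i3 : (inner ℝ (Q (Q v₀)) (σ v₀) : ℝ) = 0 := by
      simp [inner_eq, hσdef, hQdef, hv₀]
    have i4 : (inner ℝ (Q v₀) (σ v₁) : ℝ) = 0 := by
      simp [inner_eq, hσdef, hQdef, hv₀, hv₁]
    have i5 : (inner ℝ (Q (Q (Q v₀))) (σ v₀) : ℝ) = 2 * inner ℝ (P (P (P f₀))) f₀ := by
      simp [inner_eq, hσdef, hQdef, hv₀]
      ring
    have i6 : (inner ℝ (Q (Q v₀)) (σ v₁) : ℝ) = 2 * inner ℝ (P (P f₀)) f₁ := by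
      simp [inner_eq, hσdef, hQdef, hv₀, hv₁]
      ring
    have i7 : (inner ℝ (Q v₁) (σ v₁) : ℝ) = 2 * inner ℝ (P f₁) f₁ := by
      simp [inner_eq, hσdef, hQdef, hv₁]
      ring
    rw [i1, i2, i3, i4, i5, i6, i7]
    ring

/-! ### Explicit solution at `x = 0` and its moments. -/

theorem MeasureTheory.L2.real_inner_eq_integral_mul {α : Type*} [MeasurableSpace α] {μ : Measure α}
    {F G : Lp ℝ 2 μ} {f g : α → ℝ} (hf : F =ᵐ[μ] f) (hg : G =ᵐ[μ] g) :
    (inner ℝ F G : ℝ) = ∫ p, f p * g p ∂μ := by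
  rw [L2.inner_def]
  refine integral_congr_ae ?_
  filter_upwards [hf, hg] with p h1 h2
  rw [h1, h2]
  simp [mul_comm]

/-- The weight `((p² - k₁²) / (k₂² - p²)) ^ γ`. -/
noncomputable def squareWeight (k₁ k₂ γ p : ℝ) : ℝ := jacobiWeight (k₁ ^ 2) (k₂ ^ 2) γ (p ^ 2)

theorem squareWeight_mul {k₁ k₂ : ℝ} (hk₁ : 0 < k₁) {p : ℝ} (hp : p ∈ Set.Ioo k₁ k₂) (γ δ : ℝ) :
    squareWeight k₁ k₂ γ p * squareWeight k₁ k₂ δ p =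
      jacobiWeight (k₁ ^ 2) (k₂ ^ 2) (γ + δ) (p ^ 2) :=
  (jacobiWeight_add (sq_mem_Ioo hk₁ hp) γ δ).symm

theorem carleman_sub_hilbert_squareWeight {k₁ k₂ γ : ℝ} (hk₁ : 0 < k₁) (hk : k₁ < k₂)
    (h1 : -(1 / 2) < γ) (h2 : γ < 1 / 2) (h0 : γ ≠ 0)
    {S H : Lp ℝ 2 (volume.restrict (Set.Icc k₁ k₂)) →L[ℝ] Lp ℝ 2 (volume.restrict (Set.Icc k₁ k₂))}
    (hS : ∀ f : Lp ℝ 2 (volume.restrict (Set.Icc k₁ k₂)),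
      S f =ᵐ[volume.restrict (Set.Icc k₁ k₂)] fun p => ∫ q in Set.Icc k₁ k₂, f q / (p + q))
    (hH : ∀ f : Lp ℝ 2 (volume.restrict (Set.Icc k₁ k₂)),
      ∀ᵐ p ∂(volume.restrict (Set.Icc k₁ k₂)),
        Tendsto (fun y => ∫ q in Set.Icc k₁ k₂, f q * conjPoissonKer y (p - q)) (𝓝[>] 0)
          (𝓝 (H f p)))
    {F G : Lp ℝ 2 (volume.restrict (Set.Icc k₁ k₂))}
    (hF : F =ᵐ[volume.restrict (Set.Icc k₁ k₂)] squareWeight k₁ k₂ γ)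
    (hG : G =ᵐ[volume.restrict (Set.Icc k₁ k₂)] fun p => p * squareWeight k₁ k₂ γ p) :
    (∀ᵐ p ∂(volume.restrict (Set.Icc k₁ k₂)), S F p - H F p =
      Real.pi / Real.sin (Real.pi * γ) -
        Real.pi * Real.cot (Real.pi * γ) * squareWeight k₁ k₂ γ p) ∧
    (∀ᵐ p ∂(volume.restrict (Set.Icc k₁ k₂)), S G p + H G p =
      -(Real.pi / Real.sin (Real.pi * γ)) * p +
        Real.pi * Real.cot (Real.pi * γ) * (p * squareWeight k₁ k₂ γ p)) := by
  rw [← eventually_and]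
  filter_upwards [hS F, hS G, hH F, hH G, ae_restrict_Icc_mem_Ioo k₁ k₂] with p hSF hSG hHF hHG hp
  have e1 : ∀ y, ∫ q in Set.Icc k₁ k₂, F q * conjPoissonKer y (p - q) = ∫ q in Set.Icc k₁ k₂,
      jacobiWeight (k₁ ^ 2) (k₂ ^ 2) γ (q ^ 2) * conjPoissonKer y (p - q) := fun y =>
    integral_congr_ae (hF.mono fun q hq => by simp only [hq]; rfl)
  have e2 : ∀ y, ∫ q in Set.Icc k₁ k₂, G q * conjPoissonKer y (p - q) = ∫ q in Set.Icc k₁ k₂,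
      (q * jacobiWeight (k₁ ^ 2) (k₂ ^ 2) γ (q ^ 2)) * conjPoissonKer y (p - q) := fun y =>
    integral_congr_ae (hG.mono fun q hq => by simp only [hq]; rfl)
  simp only [e1] at hHF
  simp only [e2] at hHG
  have h := tendsto_conjPoissonKer_jacobiWeight hk₁ hk h1 h2 h0 hp hHF hHG
  have e3 : S F p = ∫ q in Set.Icc k₁ k₂, jacobiWeight (k₁ ^ 2) (k₂ ^ 2) γ (q ^ 2) / (p + q) :=
    hSF.trans (integral_congr_ae (hF.mono fun q hq => by simp only [hq]; rfl))
  have e4 : S G p =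
      ∫ q in Set.Icc k₁ k₂, (q * jacobiWeight (k₁ ^ 2) (k₂ ^ 2) γ (q ^ 2)) / (p + q) :=
    hSG.trans (integral_congr_ae (hG.mono fun q hq => by simp only [hq]; rfl))
  rw [e3, e4]
  exact h

theorem real_cot_neg (x : ℝ) : Real.cot (-x) = -Real.cot x := by
  rw [Real.cot_eq_cos_div_sin, Real.cot_eq_cos_div_sin, Real.cos_neg, Real.sin_neg, div_neg]

/-- The explicit solution of the dressing equations at `x = 0` and of their linearization. -/
theorem exists_solution_at_zero {k₁ k₂ α R : ℝ} (hk₁ : 0 < k₁) (hk : k₁ < k₂)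
    (h1 : 0 < α) (h2 : α < 1 / 2) (hR : R * Real.cot (Real.pi * α) = 1)
    {S H P : Lp ℝ 2 (volume.restrict (Set.Icc k₁ k₂)) →L[ℝ]
      Lp ℝ 2 (volume.restrict (Set.Icc k₁ k₂))}
    (hS : ∀ f : Lp ℝ 2 (volume.restrict (Set.Icc k₁ k₂)),
      S f =ᵐ[volume.restrict (Set.Icc k₁ k₂)] fun p => ∫ q in Set.Icc k₁ k₂, f q / (p + q))
    (hH : ∀ f : Lp ℝ 2 (volume.restrict (Set.Icc k₁ k₂)),
      ∀ᵐ p ∂(volume.restrict (Set.Icc k₁ k₂)),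
        Tendsto (fun y => ∫ q in Set.Icc k₁ k₂, f q * conjPoissonKer y (p - q)) (𝓝[>] 0)
          (𝓝 (H f p)))
    (hP : ∀ f : Lp ℝ 2 (volume.restrict (Set.Icc k₁ k₂)),
      P f =ᵐ[volume.restrict (Set.Icc k₁ k₂)] fun p => 2 * p * f p)
    {e : Lp ℝ 2 (volume.restrict (Set.Icc k₁ k₂))}
    (he : e =ᵐ[volume.restrict (Set.Icc k₁ k₂)] fun _ => 1) :
    ∃ f₀ f₁ : Lp ℝ 2 (volume.restrict (Set.Icc k₁ k₂)),
      (f₀ =ᵐ[volume.restrict (Set.Icc k₁ k₂)] fun p =>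
        Real.sin (Real.pi * α) * squareWeight k₁ k₂ α p) ∧
      (f₁ =ᵐ[volume.restrict (Set.Icc k₁ k₂)] fun p =>
        -(Real.sin (Real.pi * α) * p * (squareWeight k₁ k₂ α p + squareWeight k₁ k₂ (-α) p))) ∧
      f₀ + (R / Real.pi) • (S f₀ - H f₀) = R • e ∧
      f₁ + (R / Real.pi) • (S f₁ + H f₁) = -P f₀ := by
  have hs : Real.sin (Real.pi * α) ≠ 0 :=
    (Real.sin_pos_of_pos_of_lt_pi (by positivity) (by nlinarith [Real.pi_pos])).ne'
  have hw := memLp_jacobiWeight_sq hk₁ hk (γ := α) (by linarith) h2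
  have hw' := memLp_jacobiWeight_sq hk₁ hk (γ := -α) (by linarith) (by linarith)
  have hA := carleman_sub_hilbert_squareWeight hk₁ hk (γ := α) (by linarith) h2 h1.ne' hS hH
    hw.coeFn_toLp (memLp_id_mul hw).coeFn_toLp
  have hB := carleman_sub_hilbert_squareWeight hk₁ hk (γ := -α) (by linarith) (by linarith)
    (neg_ne_zero.2 h1.ne') hS hH hw'.coeFn_toLp (memLp_id_mul hw').coeFn_toLp
  have hFc := hw.coeFn_toLp
  have hGc := (memLp_id_mul hw).coeFn_toLp
  have hGc' := (memLp_id_mul hw').coeFn_toLp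
  set s := Real.sin (Real.pi * α) with hsdef
  set F := hw.toLp with hF
  set G := (memLp_id_mul hw).toLp with hG
  set G' := (memLp_id_mul hw').toLp with hG'
  have hπ := Real.pi_ne_zero
  -- For `s • F` the constant terms match, as `(R/π) s (π/s) = R`, and the weights cancel by `R
  -- cot(πα) = 1`. In the second equation the polynomial parts for `α` and `-α` are opposite, the
  -- cotangent turns the sum of weights into their difference, and only `-2s p` times the weight
  -- `α`, that is `-P f₀`, survives.
  refine ⟨s • F, -s • (G + G'), ?_, ?_, ?_, ?_⟩
  · filter_upwards [Lp.coeFn_smul s F, hFc] with p e1 e2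
    rw [e1, Pi.smul_apply, e2]
    rfl
  · filter_upwards [Lp.coeFn_smul (-s) (G + G'), Lp.coeFn_add G G', hGc, hGc'] with p e1 e2 e3 e4
    rw [e1, Pi.smul_apply, e2, Pi.add_apply, e3, e4]
    simp only [squareWeight, smul_eq_mul]
    ring
  · rw [map_smul, map_smul, ← smul_sub]
    apply Lp.ext
    filter_upwards [Lp.coeFn_add (s • F) ((R / Real.pi) • s • (S F - H F)), Lp.coeFn_smul s F,
      Lp.coeFn_smul (R / Real.pi) (s • (S F - H F)), Lp.coeFn_smul s (S F - H F),
      Lp.coeFn_sub (S F) (H F), hFc, hA.1, he, Lp.coeFn_smul R e] with p e1 e2 e3 e4 e5 e6 e7 e8 e9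
    rw [e1, Pi.add_apply, e2, e3, Pi.smul_apply, Pi.smul_apply, e4, Pi.smul_apply, e5,
      Pi.sub_apply, e6, e7, e9, Pi.smul_apply, e8]
    simp only [squareWeight, smul_eq_mul]
    field_simp
    linear_combination (-(s * jacobiWeight (k₁ ^ 2) (k₂ ^ 2) α (p ^ 2))) * hR
  · rw [map_smul, map_smul, map_smul, map_add, map_add, ← smul_add]
    apply Lp.ext
    filter_upwards [Lp.coeFn_add (-s • (G + G'))
        ((R / Real.pi) • -s • (S G + S G' + (H G + H G'))),
      Lp.coeFn_smul (-s) (G + G'), Lp.coeFn_add G G',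
      Lp.coeFn_smul (R / Real.pi) (-s • (S G + S G' + (H G + H G'))),
      Lp.coeFn_smul (-s) (S G + S G' + (H G + H G')),
      Lp.coeFn_add (S G + S G') (H G + H G'), Lp.coeFn_add (S G) (S G'), Lp.coeFn_add (H G) (H G'),
      hGc, hGc', hA.2, hB.2, hFc, Lp.coeFn_neg (s • P F), Lp.coeFn_smul s (P F), hP F]
      with p e1 e2 e3 e4 e5 e6 e7 e8 e9 e10 e11 e12 e13 e14 e15 e16
    rw [e1, Pi.add_apply, e2, e4, Pi.smul_apply, Pi.smul_apply, e3, e5, Pi.smul_apply, e6,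
      Pi.add_apply, Pi.add_apply, e7, e8, Pi.add_apply, Pi.add_apply, e14, Pi.neg_apply, e15,
      Pi.smul_apply, e16, e13]
    have e17 : S G p + S G' p + (H G p + H G' p) = (S G p + H G p) + (S G' p + H G' p) := by ring
    rw [e17, e11, e12, e9, e10, mul_neg, Real.sin_neg, real_cot_neg, ← hsdef]
    simp only [squareWeight, smul_eq_mul]
    generalize Real.cot (Real.pi * α) = κ at hR ⊢
    field_simp
    linear_combination (-(s * p * (jacobiWeight (k₁ ^ 2) (k₂ ^ 2) α (p ^ 2) -
      jacobiWeight (k₁ ^ 2) (k₂ ^ 2) (-α) (p ^ 2)))) * hR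

theorem integral_two_mul_sq {k₁ k₂ : ℝ} (hk₁ : 0 < k₁) (hk : k₁ < k₂) {ψ φ : ℝ → ℝ}
    (h : ∀ p ∈ Set.Ioo k₁ k₂, ψ p = 2 * p * φ (p ^ 2)) :
    ∫ p in Set.Icc k₁ k₂, ψ p = ∫ s in Set.Ioo (k₁ ^ 2) (k₂ ^ 2), φ s := by
  rw [← setIntegral_Ioo_sq hk₁ hk]
  refine integral_congr_ae ?_
  filter_upwards [ae_restrict_Icc_mem_Ioo k₁ k₂] with p hp
  rw [h p hp, smul_eq_mul]

theorem integrableOn_mul_jacobiWeight (a b : ℝ) {γ : ℝ} (h1 : -1 < γ) (h2 : γ < 1) :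
    IntegrableOn (fun t => t * jacobiWeight a b γ t) (Set.Ioo a b) := by
  simpa [mul_comm] using integrable_jacobiWeight_smul (a := a) (b := b) h1 h2 continuous_id

theorem integrableOn_id_Ioo (a b : ℝ) : IntegrableOn (fun t : ℝ => t) (Set.Ioo a b) :=
  (continuous_id.integrableOn_Icc).mono_set Set.Ioo_subset_Icc_self

/-- The moments of the explicit solution that enter the Taylor expansion. -/
theorem moments_solution_at_zero {k₁ k₂ α : ℝ} (hk₁ : 0 < k₁) (hk : k₁ < k₂)
    (h1 : 0 < α) (h2 : α < 1 / 2)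
    {P : Lp ℝ 2 (volume.restrict (Set.Icc k₁ k₂)) →L[ℝ] Lp ℝ 2 (volume.restrict (Set.Icc k₁ k₂))}
    (hP : ∀ f : Lp ℝ 2 (volume.restrict (Set.Icc k₁ k₂)),
      P f =ᵐ[volume.restrict (Set.Icc k₁ k₂)] fun p => 2 * p * f p)
    {f₀ f₁ : Lp ℝ 2 (volume.restrict (Set.Icc k₁ k₂))}
    (hf₀ : f₀ =ᵐ[volume.restrict (Set.Icc k₁ k₂)] fun p =>
        Real.sin (Real.pi * α) * squareWeight k₁ k₂ α p)
    (hf₁ : f₁ =ᵐ[volume.restrict (Set.Icc k₁ k₂)] fun p =>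
        -(Real.sin (Real.pi * α) * p * (squareWeight k₁ k₂ α p + squareWeight k₁ k₂ (-α) p))) :
    2 * inner ℝ (P f₀) f₀ =
      2 * (Real.pi * Real.tan (Real.pi * α)) * (α * (k₂ ^ 2 - k₁ ^ 2)) ∧
    1 / 3 * inner ℝ (P (P (P f₀))) f₀ + 2 * inner ℝ (P (P f₀)) f₁ + 2 * inner ℝ (P f₁) f₁ =
      -(2 / 3 * (Real.pi * Real.tan (Real.pi * α)) * (α * (k₂ ^ 2 - k₁ ^ 2)) *
        (4 * α * (k₂ ^ 2 - k₁ ^ 2) - (k₂ ^ 2 + k₁ ^ 2))) := by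
  have hs : Real.sin (Real.pi * α) ≠ 0 :=
    (Real.sin_pos_of_pos_of_lt_pi (by positivity) (by nlinarith [Real.pi_pos])).ne'
  have hc : Real.cos (Real.pi * α) ≠ 0 :=
    (Real.cos_pos_of_mem_Ioo ⟨by nlinarith [Real.pi_pos], by nlinarith [Real.pi_pos]⟩).ne'
  have hab : k₁ ^ 2 < k₂ ^ 2 := pow_lt_pow_left₀ hk hk₁.le two_ne_zero
  set s := Real.sin (Real.pi * α) with hsdef
  set a := k₁ ^ 2 with ha
  set b := k₂ ^ 2 with hb
  have hPc : ∀ {f : Lp ℝ 2 (volume.restrict (Set.Icc k₁ k₂))} {φ : ℝ → ℝ},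
      f =ᵐ[volume.restrict (Set.Icc k₁ k₂)] φ →
      P f =ᵐ[volume.restrict (Set.Icc k₁ k₂)] fun p => 2 * p * φ p := fun {f φ} h => by
    filter_upwards [hP f, h] with p e1 e2
    rw [e1, e2]
  have hg1 : -1 < α + α := by linarith
  have hg2 : α + α < 1 := by linarith
  have hg3 : -1 < -α + -α := by linarith
  have hg4 : -α + -α < 1 := by linarith
  -- Cross terms of the exponents `α` and `-α` have no weight; they contribute only `∫ t`, which
  -- cancels in the third-order combination and is never evaluated.
  have hwm : ∀ p ∈ Set.Ioo k₁ k₂, squareWeight k₁ k₂ α p * squareWeight k₁ k₂ (-α) p = 1 :=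
    fun p hp => by
      rw [squareWeight_mul hk₁ hp, add_neg_cancel, jacobiWeight, Real.rpow_zero]
  have hwp : ∀ p ∈ Set.Ioo k₁ k₂, squareWeight k₁ k₂ α p * squareWeight k₁ k₂ α p =
      jacobiWeight a b (α + α) (p ^ 2) := fun p hp => squareWeight_mul hk₁ hp _ _
  have hwn : ∀ p ∈ Set.Ioo k₁ k₂, squareWeight k₁ k₂ (-α) p * squareWeight k₁ k₂ (-α) p =
      jacobiWeight a b (-α + -α) (p ^ 2) := fun p hp => squareWeight_mul hk₁ hp _ _
  have i1 : (inner ℝ (P f₀) f₀ : ℝ) =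
      s ^ 2 * ∫ t in Set.Ioo a b, jacobiWeight a b (α + α) t := by
    rw [L2.real_inner_eq_integral_mul (hPc hf₀) hf₀, ← integral_const_mul]
    refine integral_two_mul_sq hk₁ hk fun p hp => ?_
    rw [← hwp p hp]
    ring
  have i2 : (inner ℝ (P (P (P f₀))) f₀ : ℝ) =
      4 * s ^ 2 * ∫ t in Set.Ioo a b, t * jacobiWeight a b (α + α) t := by
    rw [L2.real_inner_eq_integral_mul (hPc (hPc (hPc hf₀))) hf₀, ← integral_const_mul]
    refine integral_two_mul_sq hk₁ hk fun p hp => ?_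
    rw [← hwp p hp]
    ring
  have i3 : (inner ℝ (P (P f₀)) f₁ : ℝ) =
      -2 * s ^ 2 * ((∫ t in Set.Ioo a b, t * jacobiWeight a b (α + α) t) +
        ∫ t in Set.Ioo a b, t) := by
    rw [L2.real_inner_eq_integral_mul (hPc (hPc hf₀)) hf₁, ← integral_add
      (integrableOn_mul_jacobiWeight a b hg1 hg2) (integrableOn_id_Ioo a b), ← integral_const_mul]
    refine integral_two_mul_sq hk₁ hk fun p hp => ?_
    rw [← hwp p hp]
    linear_combination (-4 * s ^ 2 * p ^ 3) * hwm p hp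
  have i4 : (inner ℝ (P f₁) f₁ : ℝ) =
      s ^ 2 * ((∫ t in Set.Ioo a b, t * jacobiWeight a b (α + α) t) +
        2 * (∫ t in Set.Ioo a b, t) + ∫ t in Set.Ioo a b, t * jacobiWeight a b (-α + -α) t) := by
    have j1 : IntegrableOn (fun t => t * jacobiWeight a b (α + α) t + 2 * t) (Set.Ioo a b) :=
      (integrableOn_mul_jacobiWeight a b hg1 hg2).add ((integrableOn_id_Ioo a b).const_mul 2)
    rw [L2.real_inner_eq_integral_mul (hPc hf₁) hf₁, ← integral_const_mul 2, ← integral_add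
      (integrableOn_mul_jacobiWeight a b hg1 hg2) ((integrableOn_id_Ioo a b).const_mul 2),
      ← integral_add j1 (integrableOn_mul_jacobiWeight a b hg3 hg4), ← integral_const_mul]
    refine integral_two_mul_sq hk₁ hk fun p hp => ?_
    rw [← hwp p hp, ← hwn p hp]
    linear_combination (4 * s ^ 2 * p ^ 3) * hwm p hp
  have hm := integral_jacobiWeight hab hg1 hg2 (by linarith)
  have hm' := integral_jacobiWeight hab hg3 hg4 (by linarith)
  have hA := integral_mul_jacobiWeight hab.le hg1 hg2
  have hA' := integral_mul_jacobiWeight hab.le hg3 hg4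
  have e1 : Real.sin (Real.pi * (α + α)) = 2 * s * Real.cos (Real.pi * α) := by
    rw [← two_mul, mul_left_comm, Real.sin_two_mul]
  have e2 : Real.sin (Real.pi * (-α + -α)) = -(2 * s * Real.cos (Real.pi * α)) := by
    rw [← e1, ← Real.sin_neg]
    congr 1
    ring
  rw [i1, i2, i3, i4, hA, hA', hm, hm', e1, e2, Real.tan_eq_sin_div_cos, ← hsdef]
  generalize Real.cos (Real.pi * α) = c at hc
  constructor
  · field_simp
    ring
  · field_simp
    ring

/-! ### The dressing equations as operator equations, and the conclusion. -/

theorem HasPVIntegral.unique {a b p I J : ℝ} {φ : ℝ → ℝ} (hI : HasPVIntegral a b φ p I)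
    (hJ : HasPVIntegral a b φ p J) : I = J :=
  tendsto_nhds_unique hI hJ

theorem HasPVIntegral.congr_ae {a b p I : ℝ} {φ ψ : ℝ → ℝ} (hI : HasPVIntegral a b φ p I)
    (h : φ =ᵐ[volume.restrict (Set.Icc a b)] ψ) : HasPVIntegral a b ψ p I := by
  refine Tendsto.congr (fun ε => ?_) hI
  exact integral_congr_ae (ae_restrict_of_ae_restrict_of_subset Set.sdiff_subset h)

/-- Moves the exponential from the unknown, where it forms a positive operator, to the integrals,
where the dressing equations have it. -/
theorem exp_mul_add_eq_iff (θ u v r : ℝ) :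
    Real.exp θ * u + v = r ↔ u + Real.exp (-θ) * v = r * Real.exp (-θ) := by
  have h := Real.exp_pos θ
  rw [Real.exp_neg]
  field_simp

theorem setIntegral_div_add_congr {k₁ k₂ : ℝ} (hk : k₁ ≤ k₂) {F f : ℝ → ℝ}
    (h : F =ᵐ[volume.restrict (Set.Icc k₁ k₂)] f) (p : ℝ) :
    ∫ q in Set.Icc k₁ k₂, F q / (p + q) = ∫ q in k₁..k₂, f q / (p + q) := by
  rw [intervalIntegral.integral_of_le hk, ← integral_Icc_eq_integral_Ioc]
  refine integral_congr_ae ?_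
  filter_upwards [h] with q hq
  rw [hq]

/-- The dressing equations as equations in `L²(k₁, k₂)`. -/
theorem isDressingSolution_iff {k₁ k₂ R x : ℝ} (hk : k₁ ≤ k₂)
    {S H P : Lp ℝ 2 (volume.restrict (Set.Icc k₁ k₂)) →L[ℝ]
      Lp ℝ 2 (volume.restrict (Set.Icc k₁ k₂))}
    (hS : ∀ f : Lp ℝ 2 (volume.restrict (Set.Icc k₁ k₂)),
      S f =ᵐ[volume.restrict (Set.Icc k₁ k₂)] fun p => ∫ q in Set.Icc k₁ k₂, f q / (p + q))
    (hH : ∀ f : Lp ℝ 2 (volume.restrict (Set.Icc k₁ k₂)),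
      ∀ᵐ p ∂(volume.restrict (Set.Icc k₁ k₂)),
        HasPVIntegral k₁ k₂ (fun q => f q / (p - q)) p (H f p))
    (hP : ∀ f : Lp ℝ 2 (volume.restrict (Set.Icc k₁ k₂)),
      P f =ᵐ[volume.restrict (Set.Icc k₁ k₂)] fun p => 2 * p * f p)
    {e : Lp ℝ 2 (volume.restrict (Set.Icc k₁ k₂))}
    (he : e =ᵐ[volume.restrict (Set.Icc k₁ k₂)] fun _ => 1)
    {F G : Lp ℝ 2 (volume.restrict (Set.Icc k₁ k₂))} {f g : ℝ → ℝ}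
    (hF : F =ᵐ[volume.restrict (Set.Icc k₁ k₂)] f)
    (hG : G =ᵐ[volume.restrict (Set.Icc k₁ k₂)] g) :
    IsDressingSolution k₁ k₂ (fun _ => R) (fun _ => R) x f g ↔
      NormedSpace.exp (x • P) F + (R / Real.pi) • (S F + H G) = R • e ∧
      NormedSpace.exp ((-x) • P) G + (R / Real.pi) • (H F + S G) = -(R • e) := by
  have hpv : ∀ {F : Lp ℝ 2 (volume.restrict (Set.Icc k₁ k₂))} {f : ℝ → ℝ},
      F =ᵐ[volume.restrict (Set.Icc k₁ k₂)] f → ∀ᵐ p ∂(volume.restrict (Set.Icc k₁ k₂)),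
        HasPVIntegral k₁ k₂ (fun q => f q / (p - q)) p (H F p) := fun {F f} hFf => by
    filter_upwards [hH F] with p hp
    exact hp.congr_ae (hFf.mono fun q hq => by simp only [hq])
  have eF : (NormedSpace.exp (x • P) F + (R / Real.pi) • (S F + H G) = R • e) ↔
      ∀ᵐ p ∂(volume.restrict (Set.Icc k₁ k₂)),
        ∃ I : ℝ, HasPVIntegral k₁ k₂ (fun q => g q / (p - q)) p I ∧
          f p + R / Real.pi * Real.exp (-2 * p * x) * ((∫ q in k₁..k₂, f q / (p + q)) + I)
            = R * Real.exp (-2 * p * x) := by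
    rw [Lp.ext_iff]
    refine eventually_congr ?_
    filter_upwards [Lp.coeFn_add (NormedSpace.exp (x • P) F) ((R / Real.pi) • (S F + H G)),
      Lp.coeFn_smul (R / Real.pi) (S F + H G), Lp.coeFn_add (S F) (H G), Lp.coeFn_smul R e, he,
      exp_mulOperator_apply hP x F, hS F, hpv hG, hF] with p h1 h2 h3 h4 h5 h6 h7 h8 h9
    rw [h1, Pi.add_apply, h2, Pi.smul_apply, h3, Pi.add_apply, h4, Pi.smul_apply, h5, h6, h7, h9,
      setIntegral_div_add_congr hk hF, smul_eq_mul, smul_eq_mul, mul_one, exp_mul_add_eq_iff]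
    have e1 : -(x * (2 * p)) = -2 * p * x := by ring
    rw [e1]
    constructor
    · exact fun h => ⟨H G p, h8, by rw [← h]; ring⟩
    · rintro ⟨I, hI, h⟩
      rw [hI.unique h8] at h
      rw [← h]
      ring
  have eG : (NormedSpace.exp ((-x) • P) G + (R / Real.pi) • (H F + S G) = -(R • e)) ↔
      ∀ᵐ p ∂(volume.restrict (Set.Icc k₁ k₂)),
        ∃ I : ℝ, HasPVIntegral k₁ k₂ (fun q => f q / (p - q)) p I ∧
          g p + R / Real.pi * Real.exp (2 * p * x) * (I + ∫ q in k₁..k₂, g q / (p + q))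
            = -(R * Real.exp (2 * p * x)) := by
    rw [Lp.ext_iff]
    refine eventually_congr ?_
    filter_upwards [Lp.coeFn_add (NormedSpace.exp ((-x) • P) G) ((R / Real.pi) • (H F + S G)),
      Lp.coeFn_smul (R / Real.pi) (H F + S G), Lp.coeFn_add (H F) (S G), Lp.coeFn_smul R e, he,
      exp_mulOperator_apply hP (-x) G, hS G, hpv hF, hG, Lp.coeFn_neg (R • e)]
      with p h1 h2 h3 h4 h5 h6 h7 h8 h9 h10
    rw [h1, Pi.add_apply, h2, Pi.smul_apply, h3, Pi.add_apply, h10, Pi.neg_apply, h4, Pi.smul_apply,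
      h5, h6, h7, h9, setIntegral_div_add_congr hk hG, smul_eq_mul, smul_eq_mul, mul_one,
      exp_mul_add_eq_iff]
    have e1 : -(-x * (2 * p)) = 2 * p * x := by ring
    rw [e1]
    constructor
    · exact fun h => ⟨H F p, h8, by rw [← neg_mul, ← h]; ring⟩
    · rintro ⟨I, hI, h⟩
      rw [hI.unique h8] at h
      rw [neg_mul, ← h]
      ring
  rw [eF, eG]
  refine ⟨fun h => ⟨h.eq_f, h.eq_g⟩, fun h => ⟨?_, ?_, h.1, h.2⟩⟩
  · exact (memLp_congr_ae hF).1 (Lp.memLp F)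
  · exact (memLp_congr_ae hG).1 (Lp.memLp G)

/-- Existence and uniqueness of the solution of the dressing equations, and the behaviour of the
integral of the densities. -/
theorem exists_dressingSolution {k₁ k₂ R α : ℝ} (hk₁ : 0 < k₁) (hk : k₁ < k₂) (hR : 0 < R)
    (hα : α = Real.arctan R / Real.pi) :
    ∃ (f g : ℝ → ℝ → ℝ) (Φ : ℝ → ℝ),
      (∀ x, IsDressingSolution k₁ k₂ (fun _ => R) (fun _ => R) x (fun q => f q x)
        (fun q => g q x)) ∧
      (∀ x φ γ, IsDressingSolution k₁ k₂ (fun _ => R) (fun _ => R) x φ γ →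
        ∫ q in k₁..k₂, (φ q + γ q) = Φ x) ∧
      (∀ x, AnalyticAt ℝ Φ x) ∧ (∀ x, Φ (-x) = -Φ x) ∧
      (fun x => Φ x - (-(2 * Real.pi * α * (k₂ ^ 2 - k₁ ^ 2)) * x +
        2 / 3 * Real.pi * α * (k₂ ^ 2 - k₁ ^ 2) *
          (4 * α * (k₂ ^ 2 - k₁ ^ 2) - (k₂ ^ 2 + k₁ ^ 2)) * x ^ 3)) =O[𝓝 0] fun x => x ^ 4 := by
  have hπ := Real.pi_pos
  have hpa : Real.pi * α = Real.arctan R := by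
    rw [hα]
    field_simp
  have h1 : 0 < α := by
    rw [hα]
    exact div_pos (Real.arctan_pos.2 hR) hπ
  have h2 : α < 1 / 2 := by
    rw [hα, div_lt_iff₀ hπ]
    linarith [Real.arctan_lt_pi_div_two R]
  have htan : Real.tan (Real.pi * α) = R := by rw [hpa, Real.tan_arctan]
  have hcot : R * Real.cot (Real.pi * α) = 1 := by
    rw [← Real.tan_inv_eq_cot, htan, mul_inv_cancel₀ hR.ne']
  obtain ⟨S, hSs, hS0, hS⟩ := exists_carlemanOperator (b := k₂) hk₁
  obtain ⟨H, hHs, hH⟩ := exists_hilbertOperator k₁ k₂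
  obtain ⟨P, hP⟩ := exists_mulOperator (μ := volume.restrict (Set.Icc k₁ k₂))
    (m := fun p => 2 * p) (C := 2 * k₂) (by fun_prop) (by
      filter_upwards [ae_restrict_mem measurableSet_Icc] with p hp
      rw [abs_of_nonneg (by linarith [hp.1])]
      linarith [hp.2])
  have he0 : MemLp (fun _ : ℝ => (1 : ℝ)) 2 (volume.restrict (Set.Icc k₁ k₂)) := memLp_const 1
  have he := he0.coeFn_toLp
  set e := he0.toLp
  obtain ⟨f₀, f₁, hf₀, hf₁, h₀, h₁⟩ := exists_solution_at_zero hk₁ hk h1 h2 hcot hS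
    (fun f => (hH f).mono fun p hp => hp.2) hP he
  obtain ⟨hm1, hm3⟩ := moments_solution_at_zero hk₁ hk h1 h2 hP hf₀ hf₁
  have hPs : ∀ f g, inner ℝ (P f) g = inner ℝ f (P g) := fun f g => by
    rw [L2.real_inner_eq_integral_mul (hP f) (ae_eq_refl g),
      L2.real_inner_eq_integral_mul (ae_eq_refl f) (hP g)]
    exact integral_congr_ae (Eventually.of_forall fun p => by ring)
  obtain ⟨F, G, hiff, han, hodd, hexp⟩ := exists_solution_hyperbolic_system
    (c := R / Real.pi) (by positivity) hPs hSs hS0 hHs h₀ h₁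
  have hchar := fun (x : ℝ) => fun {F G : Lp ℝ 2 (volume.restrict (Set.Icc k₁ k₂))} {f g : ℝ → ℝ}
    (hF : F =ᵐ[volume.restrict (Set.Icc k₁ k₂)] f)
    (hG : G =ᵐ[volume.restrict (Set.Icc k₁ k₂)] g) => isDressingSolution_iff (R := R) (x := x)
      hk.le hS (fun f => (hH f).mono fun p hp => hp.1) hP he hF hG
  refine ⟨fun q x => F x q, fun q x => G x q, fun x => inner ℝ (F x + G x) e, fun x => ?_,
    fun x φ γ h => ?_, han, fun x => ?_, ?_⟩
  · exact (hchar x (ae_eq_refl _) (ae_eq_refl _)).2 ((hiff x (F x) (G x)).2 ⟨rfl, rfl⟩)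
  -- Any solution has `L²` classes solving the operator equation, so they equal `F x` and `G x`; the
  -- integral does not depend on the representatives.
  · have hφ := h.memLp_f.coeFn_toLp
    have hγ := h.memLp_g.coeFn_toLp
    obtain ⟨e1, e2⟩ := (hiff x _ _).1 ((hchar x hφ hγ).1 h)
    have hsum : (F x + G x : Lp ℝ 2 (volume.restrict (Set.Icc k₁ k₂)))
        =ᵐ[volume.restrict (Set.Icc k₁ k₂)] fun q => φ q + γ q := by
      rw [← e1, ← e2]
      filter_upwards [Lp.coeFn_add h.memLp_f.toLp h.memLp_g.toLp, hφ, hγ] with q i1 i2 i3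
      rw [i1, Pi.add_apply, i2, i3]
    simp only
    rw [L2.real_inner_eq_integral_mul hsum he, intervalIntegral.integral_of_le hk.le,
      ← integral_Icc_eq_integral_Ioc]
    simp
  · simp only [hodd, inner_neg_left]
  -- The abstract expansion concerns `R Φ`; `tan(πα) = R` in the moments cancels the factor.
  · refine (hexp.const_mul_left R⁻¹).congr_left fun x => ?_
    rw [hm1, hm3, htan]
    field_simp

theorem mainTheorem4 (k₁ k₂ R α : ℝ) (hk₁ : 0 < k₁) (hk : k₁ < k₂) (hR : 0 < R)
    (hα : α = Real.arctan R / Real.pi) :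
    (∃! u : ℝ → ℝ, IsSymmetricPrimitivePotential k₁ k₂ (fun _ => R) u) ∧
    ∀ u : ℝ → ℝ, IsSymmetricPrimitivePotential k₁ k₂ (fun _ => R) u →
      AnalyticAt ℝ u 0 ∧
      (fun x => u x - (-4 * α * (k₂ ^ 2 - k₁ ^ 2) +
          4 * α * (k₂ ^ 2 - k₁ ^ 2) *
            (4 * α * (k₂ ^ 2 - k₁ ^ 2) - (k₂ ^ 2 + k₁ ^ 2)) * x ^ 2))
        =O[𝓝 0] (fun x => x ^ 4) := by
  obtain ⟨f, g, Φ, hsol, hint, han, hodd, hexp⟩ := exists_dressingSolution hk₁ hk hR hα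
  -- Since every solution has the same integral `Φ`, being a potential means being `(2/π) Φ'`;
  -- existence and uniqueness follow at once.
  have hiff : ∀ u, IsSymmetricPrimitivePotential k₁ k₂ (fun _ => R) u ↔
      u = fun x => 2 / Real.pi * deriv Φ x := by
    intro u
    constructor
    · rintro ⟨φ, γ, h1, h2⟩
      funext x
      have h3 : (fun y => 2 / Real.pi * ∫ q in k₁..k₂, (φ q y + γ q y)) =
          fun y => 2 / Real.pi * Φ y := funext fun y => by rw [hint y _ _ (h1 y)]
      have h4 := h2 x
      rw [h3] at h4
      exact h4.unique ((han x).differentiableAt.hasDerivAt.const_mul _)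
    · rintro rfl
      refine ⟨f, g, hsol, fun x => ?_⟩
      have h3 : (fun y => 2 / Real.pi * ∫ q in k₁..k₂, (f q y + g q y)) =
          fun y => 2 / Real.pi * Φ y := funext fun y => by rw [hint y _ _ (hsol y)]
      rw [h3]
      exact (han x).differentiableAt.hasDerivAt.const_mul _
  refine ⟨⟨_, (hiff _).2 rfl, fun u hu => (hiff u).1 hu⟩, fun u hu => ?_⟩
  rw [(hiff u).1 hu]
  refine ⟨analyticAt_const.mul (han 0).deriv, ?_⟩
  refine ((deriv_isBigO_of_odd_of_isBigO (han 0) hodd hexp).const_mul_left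
    (2 / Real.pi)).congr_left fun x => ?_
  have := Real.pi_ne_zero
  field_simp
  ring
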